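/- **Setting.** Let $X$ be a topological space with a positive measure $\mu$ and a quasimetric $d:X\times X\to[0,\infty)$: $d(x,y)=0$ iff $x=y$; $d(x,y)\le C_t[d(x,z)+d(z,y)]$; $d(x,y)\le C_s\,d(y,x)$. Write $B(x,r)=\{y: d(x,y)<r\}$ and $d_X=\sup_{x,y}d(x,y)$. Assume that $d$ is measurable on $X\times X$, that $d_X<\infty$, that all balls have finite measure, that every neighbourhood of a point $x$ contains a ball $B(x,r)$, $r>0$, that the continuous compactly supported functions are dense in $L^1(X,\mu)$, that $\mu$ is doubling, i.e. $\mu B(x,2r)\le C_d\,\mu B(x,r)$ for all $x\in X$, $0<r<d_X$, and that, for some $c>0$, $\mu(B(x,R)\setminus B(x,r))>0$ for all $x\in X$ and $0<r<R<c\,d_X$. For $1\le p<\infty$ and $0\le\lambda<1$ let $$\|f\|_{L^{p,\lambda}}=\sup_{x\in X,\,0<r<d_X}\Big(\frac1{\mu B(x,r)^{\lambda}}\int_{B(x,r)}|f|^p\,d\mu\Big)^{1/p}.$$ For $1<p<\infty$, $0<\lambda<1$, $\theta>0$ and a non-negative non-decreasing function $A$ on $(0,p-1]$ with $A(0+)=0$,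 let $L^{p),\lambda)}_{\theta,A}$ be the space of measurable real functions with finite norm $$\|f\|_{L^{p),\lambda)}_{\theta,A}}=\sup_{0<\varepsilon<s_{\max}}\varepsilon^{\frac{\theta}{p-\varepsilon}}\,\|f\|_{L^{p-\varepsilon,\lambda-A(\varepsilon)}},\qquad s_{\max}=\min\{p-1,\ \sup\{x>0: A(x)\le\lambda\}\}.$$ $\mathrm{BMO}$ is the set of real functions $b$, integrable over the balls $B(x,r)$, $0<r<d_X$, with $\sup_{x\in X,\,0<r<d_X}\frac1{\mu B(x,r)}\int_{B(x,r)}|b-b_{B(x,r)}|\,d\mu<\infty$, where $b_B$ is the average of $b$ over $B$. Further, $$Mg(x)=\sup_{0<r<d_X}\frac1{\mu B(x,r)}\int_{B(x,r)}|g|\,d\mu,\qquad I^\alpha f(x)=\int_X\frac{f(y)}{\mu B(x,d(x,y))^{1-\alpha}}\,d\mu(y),\qquad [b,I^\alpha]f=b\,I^\alpha f-I^\alpha(bf).$$ **Theorem.** Let $1<p<\infty$, $0<\lambda<1$, $0<\alpha<(1-\lambda)/p$, $\frac1p-\frac1q=\frac{\alpha}{1-\lambda}$, $\theta_1>0$ and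 $\theta_2\ge\theta_1\big(1+\frac{\alpha q}{1-\lambda}\big)$. Let $A_1$ on $(0,p-1]$ and $A_2$ on $(0,q-1]$ be continuous, non-negative and non-decreasing, such that 1. $A_2\in C^1((0,\delta])$ for some $\delta>0$; 2. $\lim_{x\to0+}A_2(x)=0$; 3. the limit $B=\lim_{x\to0+}A_2'(x)$ exists and $0\le B<\frac{(1-\lambda)^2}{\alpha q^2}$; 4. $A_1(\eta)=A_2(\bar\phi^{-1}(\eta))$ for $\eta\in\bar\phi((0,\delta])$, where, for some $\delta>0$, $\bar\phi^{-1}$ is the inverse of the injective restriction to $(0,\delta]$ of $$\bar\phi(x)=p+\frac{(x-q)(1-\lambda+A_2(x))}{1-\lambda+A_2(x)-\alpha(x-q)}.$$ Let $b\in\mathrm{BMO}$. Then $f\mapsto M([b,I^\alpha]f)$ is bounded from $L^{p),\lambda)}_{\theta_1,A_1}$ to $L^{q),\lambda)}_{\theta_2,A_2}$: there is a constant $C<\infty$ such that for every $f\in L^{p),\lambda)}_{\theta_1,A_1}$ the integrals defining $I^\alpha f(x)$ and $I^\alpha(bf)(x)$ converge absolutely for almost every $x$, the functions $[b,I^\alpha]f$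 and $M([b,I^\alpha]f)$ are measurable, and $$\|M([b,I^\alpha]f)\|_{L^{q),\lambda)}_{\theta_2,A_2}}\le C\,\|f\|_{L^{p),\lambda)}_{\theta_1,A_1}}.$$ -/

import Mathlib

open Set Filter Topology MeasureTheory
open scoped ENNReal NNReal

noncomputable section

namespace GrandMorrey

/-- The ball `B(x,r) = {y : d(x,y) < r}`. -/
def qball {X : Type*} (d : X → X → ℝ) (x : X) (r : ℝ) : Set X := {y | d x y < r}

/-- The diameter `d_X = sup d(x,y)` (used for bounded `d` only). -/
def qdiam {X : Type*} (d : X → X → ℝ) : ℝ := ⨆ z : X × X, d z.1 z.2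

/-- `(X,d,μ)` is a space of homogeneous type in which annuli have positive measure.

* `d` is a quasimetric (quasi-symmetric, with a quasi-triangle inequality), measurable on `X × X`;
  in particular the balls are measurable;
* balls have finite measure, and every neighbourhood of `x` contains a ball centred at `x`;
* the continuous compactly supported functions are dense in `L¹(X,μ)`;
* `μ` is doubling;
* annuli of radii below a fixed fraction of the diameter have positive measure. -/
structure IsHomogeneousType {X : Type*} [TopologicalSpace X] [MeasurableSpace X]
    (d : X → X → ℝ) (μ : Measure X) : Prop where
  nonneg : ∀ x y, 0 ≤ d x y
  eq_zero_iff : ∀ x y, d x y = 0 ↔ x = y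
  quasi_triangle : ∃ Ct : ℝ, 0 < Ct ∧ ∀ x y z, d x y ≤ Ct * (d x z + d z y)
  quasi_symm : ∃ Cs : ℝ, 0 < Cs ∧ ∀ x y, d x y ≤ Cs * d y x
  measurable_dist : Measurable fun z : X × X => d z.1 z.2
  measure_ball_lt_top : ∀ x r, 0 < r → μ (qball d x r) < ∞
  exists_ball_subset : ∀ x, ∀ V ∈ 𝓝 x, ∃ r, 0 < r ∧ qball d x r ⊆ V
  dense_compactlySupported : ∀ f : X → ℝ, Integrable f μ → ∀ ε : ℝ≥0∞, ε ≠ 0 →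
    ∃ g : X → ℝ, Continuous g ∧ HasCompactSupport g ∧ Integrable g μ ∧
      ∫⁻ x, ‖f x - g x‖ₑ ∂μ ≤ ε
  doubling : ∃ Cd : ℝ≥0, ∀ x r, 0 < r → r < qdiam d →
    μ (qball d x (2 * r)) ≤ Cd * μ (qball d x r)
  annulus_pos : ∃ c : ℝ, 0 < c ∧ ∀ x r R, 0 < r → r < R → R < c * qdiam d →
    0 < μ (qball d x R \ qball d x r)

section Operators

variable {X : Type*} [MeasurableSpace X] (d : X → X → ℝ) (μ : Measure X)

/-- The Morrey norm
`sup_{x, 0<r<d_X} (μ(B(x,r))^{-l} ∫_{B(x,r)} g^p dμ)^{1/p}` of a `[0,∞]`-valued function. -/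
def morreyNorm (p l : ℝ) (g : X → ℝ≥0∞) : ℝ≥0∞ :=
  ⨆ (x : X) (r : ℝ) (_ : 0 < r ∧ r < qdiam d),
    ((∫⁻ y in qball d x r, g y ^ p ∂μ) / μ (qball d x r) ^ l) ^ (1 / p)

/-- `s_max = min {p - 1, a}` with `a = sup {x > 0 : A x ≤ l}`, for `A` living on `(0, p - 1]`. -/
def sMax (p l : ℝ) (A : ℝ → ℝ) : ℝ :=
  min (p - 1) (sSup {x | x ∈ Ioc 0 (p - 1) ∧ A x ≤ l})

/-- The norm of the generalized grand Morrey space `L^{p),l)}_{φ,A}`: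
`sup_{0<ε<s_max} φ(ε)^{1/(p-ε)} ‖g‖_{L^{p-ε, l-A(ε)}}`. -/
def grandMorreyNorm (p l : ℝ) (φ A : ℝ → ℝ) (g : X → ℝ≥0∞) : ℝ≥0∞ :=
  ⨆ (ε : ℝ) (_ : 0 < ε ∧ ε < sMax p l A),
    ENNReal.ofReal (φ ε) ^ (1 / (p - ε)) * morreyNorm d μ (p - ε) (l - A ε) g

/-- The norm of `L^{p),l)}_{θ,A}`, that is, `φ(ε) = ε^θ`. -/
def grandMorreyNormPow (p l θ : ℝ) (A : ℝ → ℝ) (g : X → ℝ≥0∞) : ℝ≥0∞ :=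
  grandMorreyNorm d μ p l (fun ε => ε ^ θ) A g

/-- The seminorm of `BMO`: supremum of the mean oscillations over balls. -/
def bmoNorm (b : X → ℝ) : ℝ≥0∞ :=
  ⨆ (x : X) (r : ℝ) (_ : 0 < r ∧ r < qdiam d),
    (∫⁻ y in qball d x r, ‖b y - ⨍ z in qball d x r, b z ∂μ‖ₑ ∂μ) / μ (qball d x r)

/-- `b ∈ BMO`: `b` is integrable over balls, with bounded mean oscillation. -/
def MemBMO (b : X → ℝ) : Prop :=
  AEMeasurable b μ ∧
    (∀ x r, 0 < r → r < qdiam d → IntegrableOn b (qball d x r) μ) ∧ bmoNorm d μ b < ∞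

/-- The Hardy-Littlewood maximal function `sup_{0<r<d_X} μ(B(x,r))⁻¹ ∫_{B(x,r)} |g| dμ`. -/
def maximalFn (g : X → ℝ) (x : X) : ℝ≥0∞ :=
  ⨆ (r : ℝ) (_ : 0 < r ∧ r < qdiam d),
    (∫⁻ y in qball d x r, ‖g y‖ₑ ∂μ) / μ (qball d x r)

/-- The integrand `f(y) / μ(B(x,d(x,y)))^{1-α}` of the potential operator. -/
def potentialIntegrand (α : ℝ) (f : X → ℝ) (x y : X) : ℝ :=
  f y / μ.real (qball d x (d x y)) ^ (1 - α)

/-- The potential operator `I^α f(x) = ∫ f(y) / μ(B(x,d(x,y)))^{1-α} dμ(y)`. -/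
def potential (α : ℝ) (f : X → ℝ) (x : X) : ℝ :=
  ∫ y, potentialIntegrand d μ α f x y ∂μ

end Operators

/-- The commutator `[b,U] f = b U(f) - U(b f)`. -/
def commutator {X : Type*} (b : X → ℝ) (U : (X → ℝ) → X → ℝ) (f : X → ℝ) (x : X) : ℝ :=
  b x * U f x - U (fun y => b y * f y) x

/-- The auxiliary function
`φ̄(x) = p + (x - q)(1 - l + A₂(x)) / (1 - l + A₂(x) - α (x - q))`. -/
def phiBar (p q α l : ℝ) (A₂ : ℝ → ℝ) (x : ℝ) : ℝ :=
  p + (x - q) * (1 - l + A₂ x) / (1 - l + A₂ x - α * (x - q))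

end GrandMorrey

end

/-!
Write `D` for the diameter. If `D = 0` the space has at most one point and everything vanishes.
Otherwise `X` has finite measure, the positivity of annuli makes the doubling measure reverse
doubling (`DoublingSpace.exists_homSpace`), and since `X` is covered by finitely many balls of
radius `D / 2`, all bounds on balls of radius less than `D` extend to all balls.

*Classical Morrey spaces.* The core of the proof is a version of Adams' theorem for the commutator
on the spaces `L^{p,l}`, with a constant that is uniform as long as `p ≥ p₀ > 1`, `q ≤ q₁`,
`0 ≤ l ≤ l₁ < 1` and `1/p - 1/q = α/(1-l)` (`AdamsExponents`). The kernel is dominated by a sum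
over the radii `rₖ = R₀ E⁻ᵏ`, so that the commutator is dominated pointwise by
`∑ₖ μ(B(x,rₖ))^{α-1} ∫_{B(x,rₖ)} |b(x) - b(y)| |f(y)| dμ(y)`. Inserting a mean value of `b` over
`B(x,rₖ)` splits this sum into two (`HomSpace.dyPot_comm_le`).

* In the first one, `powPot`, the oscillation of `b` stays under the integral; by Hölder's
  inequality and the John–Nirenberg inequality (`HomSpace.exists_osc_rpow`) it is replaced by an
  `L^t` average of `f` with `t` close to `1`. Hedberg's argument (`tsum_hedberg`) bounds the sum by
  `M_t f(x)^{p/q} ‖f‖^{1-p/q}`, where `M_t f = (M |f|^t)^{1/t}`, and the maximal operator is bounded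
  on Morrey spaces (`HomSpace.exists_morrey_hlMax`).
* In the second one, `oscPot`, the oscillation depends on `x` and cannot be bounded pointwise. On a
  ball `B` it is estimated by duality against `h ∈ L^{q'}(B)`. For the part of `f` near `B`,
  Fubini's theorem and Hölder's inequality move the oscillation onto `h`, which becomes `M_t h`
  (`HomSpace.exists_dual_near`); for the part away from `B` only the scales `rₖ` larger than the
  radius of `B` occur, and reverse doubling makes the resulting series geometric
  (`HomSpace.exists_dual_far`).

*Grand Morrey spaces.* For small `ε` and `η = φ̄(ε)` the exponents `p - η`, `q - ε` and
`l - A₂(ε) = l - A₁(η)` satisfy Adams' relation exactly. The bound on `B` is what makes `η` at least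
a multiple of `ε` (`one_div_sub_one_div_bounds`), and the bound on `θ₂` is what makes the weight
`ε^{θ₂/(q-ε)}` at most a multiple of `η^{θ₁/(p-η)}` (`weight_le`). Hence the uniform estimate gives
the claim for the small values of `ε`; the others are reduced to a fixed small one by Hölder's
inequality (`exists_grandMorreyNormPow_le`).
-/

open Set Filter Topology MeasureTheory
open scoped ENNReal NNReal

namespace GrandMorrey

/-! ### Quasimetric spaces with a doubling measure -/

/-- A quasimetric space of diameter less than `R₀` with a doubling measure, and with explicit
constants: `K` is the constant of both the quasi-triangle inequality and the quasi-symmetry, `A` is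
the doubling constant for *all* radii. -/
structure DoublingSpace {X : Type*} [MeasurableSpace X] (d : X → X → ℝ) (μ : Measure X)
    (K R₀ : ℝ) (A : ℝ≥0∞) : Prop where
  self : ∀ x, d x x = 0
  eq_of_zero : ∀ x y, d x y = 0 → x = y
  nonneg : ∀ x y, 0 ≤ d x y
  one_le_K : 1 ≤ K
  tri : ∀ x y z, d x y ≤ K * (d x z + d z y)
  symm : ∀ x y, d x y ≤ K * d y x
  meas : Measurable fun z : X × X => d z.1 z.2
  lt_diam : ∀ x y, d x y < R₀
  R₀_pos : 0 < R₀
  pos : ∀ x r, 0 < r → 0 < μ (qball d x r)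
  doubling : ∀ x r, 0 < r → μ (qball d x (2 * r)) ≤ A * μ (qball d x r)
  A_ne_top : A ≠ ∞

/-- A doubling space with the reverse doubling property `μ B(x, r / E) ≤ τ μ B(x, r)`, where
`τ < 1`. -/
structure HomSpace {X : Type*} [MeasurableSpace X] (d : X → X → ℝ) (μ : Measure X)
    (K R₀ E : ℝ) (A τ : ℝ≥0∞) : Prop extends DoublingSpace d μ K R₀ A where
  two_le_E : 2 ≤ E
  reverse : ∀ x r, 0 < r → r ≤ R₀ → μ (qball d x (r / E)) ≤ τ * μ (qball d x r)
  τ_lt_one : τ < 1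

section Geometry

variable {X : Type*} {d : X → X → ℝ}

lemma mem_qball {x y : X} {r : ℝ} : y ∈ qball d x r ↔ d x y < r := Iff.rfl

lemma qball_mono {x : X} {r s : ℝ} (h : r ≤ s) : qball d x r ⊆ qball d x s :=
  fun _ hy => lt_of_lt_of_le hy h

variable [MeasurableSpace X]

lemma measurableSet_qball (hd : Measurable fun z : X × X => d z.1 z.2) (x : X) (r : ℝ) :
    MeasurableSet (qball d x r) :=
  measurableSet_lt (hd.comp measurable_prodMk_left) measurable_const

lemma measurableSet_qball' (hd : Measurable fun z : X × X => d z.1 z.2) (y : X) (r : ℝ) :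
    MeasurableSet {x | d x y < r} :=
  measurableSet_lt (hd.comp measurable_prodMk_right) measurable_const

variable {μ : Measure X} {K R₀ : ℝ} {A : ℝ≥0∞}

namespace DoublingSpace

variable (H : DoublingSpace d μ K R₀ A)
include H

lemma K_pos : 0 < K := lt_of_lt_of_le one_pos H.one_le_K

lemma K_le_sq : K ≤ K ^ 2 := by nlinarith [H.one_le_K]

lemma one_le_sq : 1 ≤ K ^ 2 := by nlinarith [H.one_le_K]

lemma mem_self {x : X} {r : ℝ} (hr : 0 < r) : x ∈ qball d x r := by
  rw [mem_qball, H.self]; exact hr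

lemma qball_eq_univ {x : X} {r : ℝ} (hr : R₀ ≤ r) : qball d x r = univ :=
  eq_univ_of_forall fun _ => lt_of_lt_of_le (H.lt_diam _ _) hr

lemma tri_lt {x y z : X} {r s : ℝ} (h₁ : d x z < r) (h₂ : d z y < s) : d x y < K * (r + s) :=
  lt_of_le_of_lt (H.tri x y z) (mul_lt_mul_of_pos_left (add_lt_add h₁ h₂) H.K_pos)

lemma symm_lt {x y : X} {r : ℝ} (h : d x y < r) : d y x < K * r :=
  lt_of_le_of_lt (H.symm y x) (mul_lt_mul_of_pos_left h H.K_pos)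

lemma measurableSet_ball (x : X) (r : ℝ) : MeasurableSet (qball d x r) :=
  measurableSet_qball H.meas x r

lemma measurableSet_ball' (y : X) (r : ℝ) : MeasurableSet {x | d x y < r} :=
  measurableSet_qball' H.meas y r

/-- Balls of comparable radii whose centres are close have comparable measures. -/
lemma exists_compar (Λ : ℝ) : ∃ C : ℝ≥0∞, C ≠ ∞ ∧ 1 ≤ C ∧ ∀ x y r, 0 < r → d x y < Λ * r →
    μ (qball d x (Λ * r)) ≤ C * μ (qball d y r) := by
  obtain ⟨n, hn⟩ := pow_unbounded_of_one_lt (K * (K * Λ + Λ)) (one_lt_two : (1 : ℝ) < 2)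
  have hA : ∀ k : ℕ, ∀ y r, 0 < r → μ (qball d y (2 ^ k * r)) ≤ A ^ k * μ (qball d y r) := by
    intro k
    induction k with
    | zero => intro y r _; simp
    | succ k ih =>
      intro y r hr
      calc μ (qball d y (2 ^ (k + 1) * r)) = μ (qball d y (2 * (2 ^ k * r))) := by ring_nf
        _ ≤ A * μ (qball d y (2 ^ k * r)) := H.doubling _ _ (by positivity)
        _ ≤ A * (A ^ k * μ (qball d y r)) := by gcongr; exact ih y r hr
        _ = A ^ (k + 1) * μ (qball d y r) := by rw [pow_succ]; ring
  refine ⟨max 1 (A ^ n), ?_, le_max_left _ _, fun x y r hr hxy => ?_⟩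
  · exact (max_lt ENNReal.one_lt_top (ENNReal.pow_lt_top H.A_ne_top.lt_top)).ne
  · have hsub : qball d x (Λ * r) ⊆ qball d y (2 ^ n * r) := by
      intro z hz
      have := H.tri_lt (H.symm_lt hxy) (mem_qball.1 hz)
      rw [mem_qball]
      nlinarith
    calc μ (qball d x (Λ * r)) ≤ μ (qball d y (2 ^ n * r)) := measure_mono hsub
      _ ≤ A ^ n * μ (qball d y r) := hA n y r hr
      _ ≤ _ := by gcongr; exact le_max_right _ _

/-- Vitali's covering lemma for balls of bounded radii. -/
lemma exists_vitali [IsFiniteMeasure μ] (t : Set (X × ℝ)) (R : ℝ)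
    (ht : ∀ a ∈ t, 0 < a.2 ∧ a.2 ≤ R) :
    ∃ u ⊆ t, u.Countable ∧ u.PairwiseDisjoint (fun a => qball d a.1 a.2) ∧
      ∀ a ∈ t, ∃ b ∈ u, qball d a.1 a.2 ⊆ qball d b.1 (5 * K ^ 3 * b.2) := by
  obtain ⟨u, hut, hdis, hcov⟩ := Vitali.exists_disjoint_subfamily_covering_enlargement
    (fun a : X × ℝ => qball d a.1 a.2) t (fun a => a.2) 2 one_lt_two
    (fun a ha => (ht a ha).1.le) R (fun a ha => (ht a ha).2)
    (fun a ha => ⟨a.1, H.mem_self (ht a ha).1⟩)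
  refine ⟨u, hut, ?_, hdis, ?_⟩
  · have := Measure.countable_meas_pos_of_disjoint_iUnion (μ := μ)
      (As := fun a : u => qball d a.1.1 a.1.2) (fun a => H.measurableSet_ball _ _)
      (fun a b hab => hdis a.2 b.2 (fun h => hab (Subtype.ext h)))
    have huniv : {i : u | 0 < μ (qball d i.1.1 i.1.2)} = univ :=
      eq_univ_of_forall fun a => H.pos _ _ (ht _ (hut a.2)).1
    rw [huniv] at this
    exact countable_coe_iff.1 (countable_univ_iff.1 this)
  · intro a ha
    obtain ⟨b, hb, ⟨z, hz₁, hz₂⟩, hab⟩ := hcov a ha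
    refine ⟨b, hb, fun y hy => ?_⟩
    have hb0 := (ht b (hut hb)).1
    have h₁ := H.tri_lt (mem_qball.1 hz₂) (H.tri_lt (H.symm_lt (mem_qball.1 hz₁)) hy)
    rw [mem_qball]
    refine h₁.trans_le ?_
    have hK := H.one_le_K
    have hK1 := H.one_le_sq
    have hK2 := H.K_le_sq
    have hK3 : K ^ 2 ≤ K ^ 3 := by nlinarith [sq_nonneg K]
    calc K * (b.2 + K * (K * a.2 + a.2)) ≤ K * (b.2 + K * (K * (2 * b.2) + 2 * b.2)) := by gcongr
      _ = (K + 2 * K ^ 3 + 2 * K ^ 2) * b.2 := by ring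
      _ ≤ 5 * K ^ 3 * b.2 := by gcongr; nlinarith

/-- Joint measurability of the measure of the ball with given centre and radius. -/
lemma measurable_measure_ball [IsFiniteMeasure μ] {Y : Type*} [MeasurableSpace Y] {c : Y → X}
    {ρ : Y → ℝ} (hc : Measurable c) (hρ : Measurable ρ) :
    Measurable fun y => μ (qball d (c y) (ρ y)) := by
  have : MeasurableSet {z : Y × X | d (c z.1) z.2 < ρ z.1} :=
    measurableSet_lt (H.meas.comp ((hc.comp measurable_fst).prodMk measurable_snd))
      (hρ.comp measurable_fst)
  exact measurable_measure_prodMk_left this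

lemma measurable_setLIntegral_ball [IsFiniteMeasure μ] {g : X → X → ℝ≥0∞}
    (hg : Measurable (Function.uncurry g)) (r : ℝ) :
    Measurable fun x => ∫⁻ y in qball d x r, g x y ∂μ := by
  have h : ∀ x, ∫⁻ y in qball d x r, g x y ∂μ =
      ∫⁻ y, {z : X × X | d z.1 z.2 < r}.indicator (Function.uncurry g) (x, y) ∂μ := by
    intro x
    rw [← lintegral_indicator (H.measurableSet_ball x r)]
    rfl
  simp_rw [h]
  exact (hg.indicator (measurableSet_lt H.meas measurable_const)).lintegral_prod_right'

/-- Fubini's theorem on `{(x, y) : d(x, y) < r}`. -/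
lemma lintegral_ball_swap [IsFiniteMeasure μ] {g : X → X → ℝ≥0∞}
    (hg : Measurable (Function.uncurry g)) (r : ℝ) :
    ∫⁻ x, ∫⁻ y in qball d x r, g x y ∂μ ∂μ = ∫⁻ y, ∫⁻ x in {x | d x y < r}, g x y ∂μ ∂μ := by
  have h : ∀ x, ∫⁻ y in qball d x r, g x y ∂μ =
      ∫⁻ y, {z : X × X | d z.1 z.2 < r}.indicator (Function.uncurry g) (x, y) ∂μ := by
    intro x
    rw [← lintegral_indicator (H.measurableSet_ball x r)]
    rfl
  have h' : ∀ y, ∫⁻ x in {x | d x y < r}, g x y ∂μ =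
      ∫⁻ x, {z : X × X | d z.1 z.2 < r}.indicator (Function.uncurry g) (x, y) ∂μ := by
    intro y
    rw [← lintegral_indicator (H.measurableSet_ball' y r)]
    rfl
  simp_rw [h, h']
  exact lintegral_lintegral_swap
    (hg.indicator (measurableSet_lt H.meas measurable_const)).aemeasurable

end DoublingSpace

end Geometry

/-! ### The Hardy–Littlewood maximal function -/

section Auxiliary

/-- The layer-cake formula for a power of a single number. -/
lemma lintegral_Ioi_indicator_rpow {p : ℝ} (hp : 0 < p) (a : ℝ≥0∞) :
    ∫⁻ t in Ioi (0 : ℝ), {t : ℝ | ENNReal.ofReal t < a}.indicator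
      (fun t => ENNReal.ofReal (t ^ (p - 1))) t = a ^ p / ENNReal.ofReal p := by
  have key : ∀ b : ℝ, 0 < b → ∫⁻ t in Ioo (0 : ℝ) b, ENNReal.ofReal (t ^ (p - 1)) =
      ENNReal.ofReal b ^ p / ENNReal.ofReal p := by
    intro b hb
    have hint : IntervalIntegrable (fun t : ℝ => t ^ (p - 1)) volume 0 b :=
      intervalIntegral.intervalIntegrable_rpow' (by linarith)
    rw [setLIntegral_congr Ioo_ae_eq_Ioc, ← ofReal_integral_eq_lintegral_ofReal
      ((intervalIntegrable_iff_integrableOn_Ioc_of_le hb.le).1 hint)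
      ((ae_restrict_iff' measurableSet_Ioc).2 (ae_of_all _ fun t ht => Real.rpow_nonneg ht.1.le _)),
      ← intervalIntegral.integral_of_le hb.le, integral_rpow (Or.inl (by linarith)),
      ENNReal.ofReal_rpow_of_pos hb, ← ENNReal.ofReal_div_of_pos hp]
    simp [Real.zero_rpow hp.ne']
  have hmeas : MeasurableSet {t : ℝ | ENNReal.ofReal t < a} :=
    measurableSet_lt ENNReal.measurable_ofReal measurable_const
  rw [setLIntegral_indicator hmeas]
  by_cases ha : a = ∞
  · subst ha
    have h1 : {t : ℝ | ENNReal.ofReal t < ∞} ∩ Ioi 0 = Ioi 0 := by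
      ext t; simp
    rw [h1, ENNReal.top_rpow_of_pos hp, ENNReal.top_div_of_ne_top ENNReal.ofReal_ne_top]
    refine top_unique (le_of_tendsto' (f := fun n : ℕ => ENNReal.ofReal ((n : ℝ) + 1) ^ p /
      ENNReal.ofReal p) (x := atTop) ?_ ?_)
    · have h2 : Tendsto (fun n : ℕ => ENNReal.ofReal (((n : ℝ) + 1) ^ p / p)) atTop (𝓝 ∞) :=
        ENNReal.tendsto_ofReal_nhds_top.2 (((tendsto_rpow_atTop hp).comp
          (tendsto_atTop_add_const_right _ _ tendsto_natCast_atTop_atTop)).atTop_div_const hp)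
      refine h2.congr fun n => ?_
      rw [ENNReal.ofReal_div_of_pos hp, ENNReal.ofReal_rpow_of_pos (by positivity)]
    · intro n
      rw [← key _ (by positivity)]
      exact lintegral_mono_set fun t ht => ht.1
  · rcases eq_or_ne a 0 with rfl | ha0
    · simp [hp]
    have hb : 0 < a.toReal := ENNReal.toReal_pos ha0 ha
    have h1 : {t : ℝ | ENNReal.ofReal t < a} ∩ Ioi 0 = Ioo 0 a.toReal := by
      ext t
      simp only [mem_inter_iff, mem_ofPred_eq, mem_Ioi, mem_Ioo]
      constructor
      · rintro ⟨h, h'⟩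
        exact ⟨h', (ENNReal.ofReal_lt_iff_lt_toReal h'.le ha).1 h⟩
      · rintro ⟨h', h⟩
        exact ⟨(ENNReal.ofReal_lt_iff_lt_toReal h'.le ha).2 h, h'⟩
    rw [h1, key _ hb, ENNReal.ofReal_toReal ha]

variable {X : Type*} [MeasurableSpace X]

/-- Hölder's inequality for `ℝ≥0∞`-valued functions, comparing two exponents. -/
lemma lintegral_rpow_le_of_le {ν : Measure X} [IsFiniteMeasure ν] {s p : ℝ} (hs : 0 < s)
    (hp : s ≤ p) {g : X → ℝ≥0∞} (hg : AEMeasurable g ν) :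
    (∫⁻ x, g x ^ s ∂ν) ^ (1 / s) ≤ (∫⁻ x, g x ^ p ∂ν) ^ (1 / p) * ν univ ^ (1 / s - 1 / p) := by
  rcases hp.eq_or_lt with rfl | hp
  · simp
  have hp0 : 0 < p := hs.trans hp
  have h1 : 1 < p / s := (one_lt_div hs).2 hp
  have hc := Real.HolderConjugate.conjExponent h1
  have := ENNReal.lintegral_mul_le_Lp_mul_Lq ν hc (hg.pow_const s)
    (aemeasurable_const (b := (1 : ℝ≥0∞)))
  simp only [Pi.mul_apply, mul_one, ← ENNReal.rpow_mul, ENNReal.one_rpow, lintegral_one] at this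
  rw [mul_div_cancel₀ _ hs.ne'] at this
  refine (ENNReal.rpow_le_rpow this (by positivity)).trans ?_
  rw [ENNReal.mul_rpow_of_nonneg _ _ (by positivity), ← ENNReal.rpow_mul, ← ENNReal.rpow_mul]
  have e1 : 1 / (p / s) * (1 / s) = 1 / p := by field_simp
  have e2 : 1 / (p / s).conjExponent * (1 / s) = 1 / s - 1 / p := by
    have := hc.inv_add_inv_eq_one
    have h3 : 1 / (p / s).conjExponent = 1 - s / p := by
      rw [one_div, ← inv_div p s]; linarith
    rw [h3]; field_simp
  rw [e1, e2]

end Auxiliary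

section Maximal

variable {X : Type*} [MeasurableSpace X]

/-- The average of `g` over the ball `B(x, r)`. -/
noncomputable def ballAvg (d : X → X → ℝ) (μ : Measure X) (g : X → ℝ≥0∞) (x : X) (r : ℝ) : ℝ≥0∞ :=
  (∫⁻ y in qball d x r, g y ∂μ) / μ (qball d x r)

/-- The Hardy-Littlewood maximal function over balls of radius less than `ρ`. -/
noncomputable def hlMax (d : X → X → ℝ) (μ : Measure X) (ρ : ℝ) (g : X → ℝ≥0∞) (x : X) : ℝ≥0∞ :=
  ⨆ (r : ℝ) (_ : 0 < r ∧ r < ρ), ballAvg d μ g x r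

variable {d : X → X → ℝ} {μ : Measure X} {K R₀ E : ℝ} {A τ : ℝ≥0∞}

lemma ballAvg_le_hlMax_of_lt {ρ : ℝ} (g : X → ℝ≥0∞) (x : X) {r : ℝ} (hr : 0 < r) (h : r < ρ) :
    ballAvg d μ g x r ≤ hlMax d μ ρ g x :=
  le_iSup₂ (f := fun r (_ : 0 < r ∧ r < ρ) => ballAvg d μ g x r) r ⟨hr, h⟩

namespace HomSpace

variable (H : HomSpace d μ K R₀ E A τ)
include H

lemma ballAvg_le_hlMax (g : X → ℝ≥0∞) (x : X) {r : ℝ} (hr : 0 < r) :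
    ballAvg d μ g x r ≤ hlMax d μ (R₀ + 1) g x := by
  rcases lt_or_ge r R₀ with h | h
  · exact ballAvg_le_hlMax_of_lt g x hr (by linarith)
  · have : ballAvg d μ g x r = ballAvg d μ g x R₀ := by
      simp only [ballAvg, H.qball_eq_univ h, H.qball_eq_univ le_rfl]
    rw [this]
    exact ballAvg_le_hlMax_of_lt g x H.R₀_pos (by linarith)

lemma hlMax_le_hlMax (ρ : ℝ) (g : X → ℝ≥0∞) (x : X) :
    hlMax d μ ρ g x ≤ hlMax d μ (R₀ + 1) g x :=
  iSup₂_le fun _ hr => H.ballAvg_le_hlMax g x hr.1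

lemma ball_ne_zero (x : X) {r : ℝ} (hr : 0 < r) : μ (qball d x r) ≠ 0 := (H.pos x r hr).ne'

variable [IsFiniteMeasure μ]

lemma lt_ballAvg_iff {g : X → ℝ≥0∞} {x : X} {r : ℝ} (hr : 0 < r) {c : ℝ≥0∞} :
    c < ballAvg d μ g x r ↔ c * μ (qball d x r) < ∫⁻ y in qball d x r, g y ∂μ :=
  ENNReal.lt_div_iff_mul_lt (Or.inl (H.ball_ne_zero x hr)) (Or.inl (measure_ne_top _ _))

lemma ballAvg_le_iff {g : X → ℝ≥0∞} {x : X} {r : ℝ} (hr : 0 < r) {c : ℝ≥0∞} :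
    ballAvg d μ g x r ≤ c ↔ ∫⁻ y in qball d x r, g y ∂μ ≤ c * μ (qball d x r) := by
  rw [← not_lt, H.lt_ballAvg_iff hr, not_lt]

/-- The supremum in the maximal function may be taken over rational radii. -/
lemma hlMax_eq_rat (ρ : ℝ) (g : X → ℝ≥0∞) (x : X) :
    hlMax d μ ρ g x = ⨆ (q : ℚ) (_ : 0 < (q : ℝ) ∧ (q : ℝ) < ρ), ballAvg d μ g x q := by
  refine le_antisymm (iSup₂_le fun r hr => ?_)
    (iSup₂_le fun q hq => ballAvg_le_hlMax_of_lt g x hq.1 hq.2)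
  refine le_of_forall_lt fun c hc => ?_
  rw [H.lt_ballAvg_iff hr.1] at hc
  have hU : qball d x r = ⋃ q : {q : ℚ // 0 < (q : ℝ) ∧ (q : ℝ) < r}, qball d x (q : ℚ) := by
    ext y
    simp only [mem_iUnion, mem_qball]
    constructor
    · intro hy
      obtain ⟨q, h1, h2⟩ := exists_rat_btwn hy
      exact ⟨⟨q, (H.nonneg x y).trans_lt h1, h2⟩, h1⟩
    · rintro ⟨q, hq⟩
      exact hq.trans q.2.2
  have hdir : Directed (· ⊆ ·)
      fun q : {q : ℚ // 0 < (q : ℝ) ∧ (q : ℝ) < r} => qball d x (q : ℚ) := by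
    refine Monotone.directed_le fun a b hab => qball_mono ?_
    exact_mod_cast hab
  rw [show ∫⁻ y in qball d x r, g y ∂μ = _ from by
    rw [hU, setLIntegral_iUnion_of_directed _ hdir], lt_iSup_iff] at hc
  obtain ⟨q, hq⟩ := hc
  refine lt_of_lt_of_le ?_ (le_iSup₂ (f := fun (q : ℚ) (_ : 0 < (q : ℝ) ∧ (q : ℝ) < ρ) =>
    ballAvg d μ g x q) q.1 ⟨q.2.1, q.2.2.trans hr.2⟩)
  rw [H.lt_ballAvg_iff q.2.1]
  refine lt_of_le_of_lt ?_ hq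
  gcongr
  exact qball_mono q.2.2.le

lemma measurable_ballAvg {g : X → ℝ≥0∞} (hg : Measurable g) (r : ℝ) :
    Measurable fun x => ballAvg d μ g x r :=
  (H.measurable_setLIntegral_ball (g := fun _ y => g y) (hg.comp measurable_snd) r).div
    (H.measurable_measure_ball measurable_id measurable_const)

lemma measurable_hlMax (ρ : ℝ) {g : X → ℝ≥0∞} (hg : Measurable g) :
    Measurable (hlMax d μ ρ g) := by
  have : hlMax d μ ρ g = fun x => ⨆ (q : ℚ) (_ : 0 < (q : ℝ) ∧ (q : ℝ) < ρ),
      ballAvg d μ g x q := funext fun x => H.hlMax_eq_rat ρ g x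
  rw [this]
  exact Measurable.iSup fun q => Measurable.iSup fun _ => H.measurable_ballAvg hg _

/-- The weak type `(1,1)` inequality, with a constant independent of the range of radii. -/
lemma exists_weak_type : ∃ C : ℝ≥0∞, C ≠ ∞ ∧ ∀ (ρ : ℝ) (g : X → ℝ≥0∞) (c : ℝ≥0∞),
    c * μ {x | c < hlMax d μ ρ g x} ≤ C * ∫⁻ x, g x ∂μ := by
  obtain ⟨C, hC, -, hcomp⟩ := H.exists_compar (5 * K ^ 3)
  refine ⟨C, hC, fun ρ g c => ?_⟩
  let t : Set (X × ℝ) := {a | (0 < a.2 ∧ a.2 < ρ) ∧ c < ballAvg d μ g a.1 a.2}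
  obtain ⟨u, hut, hcount, hdis, hcov⟩ := H.exists_vitali t ρ fun a ha => ⟨ha.1.1, ha.1.2.le⟩
  have hsub : {x | c < hlMax d μ ρ g x} ⊆ ⋃ b ∈ u, qball d b.1 (5 * K ^ 3 * b.2) := by
    intro x hx
    simp only [hlMax, mem_ofPred_eq, lt_iSup_iff] at hx
    obtain ⟨r, hr, hx⟩ := hx
    obtain ⟨b, hb, hsub⟩ := hcov (x, r) ⟨hr, hx⟩
    exact mem_biUnion hb (hsub (H.mem_self hr.1))
  have hK := H.one_le_K
  calc c * μ {x | c < hlMax d μ ρ g x}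
      ≤ c * ∑' b : u, μ (qball d b.1.1 (5 * K ^ 3 * b.1.2)) := by
        gcongr
        exact (measure_mono hsub).trans (measure_biUnion_le μ hcount _)
    _ ≤ c * ∑' b : u, C * μ (qball d b.1.1 b.1.2) := by
        gcongr with b
        have hb := (hut b.2).1.1
        exact hcomp _ _ _ hb (by rw [H.self]; positivity)
    _ = C * ∑' b : u, c * μ (qball d b.1.1 b.1.2) := by
        rw [ENNReal.tsum_mul_left, ENNReal.tsum_mul_left]; ring
    _ ≤ C * ∑' b : u, ∫⁻ y in qball d b.1.1 b.1.2, g y ∂μ := by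
        gcongr with b
        exact ((H.lt_ballAvg_iff (hut b.2).1.1).1 (hut b.2).2).le
    _ = C * ∫⁻ y in ⋃ b ∈ u, qball d b.1 b.2, g y ∂μ := by
        rw [lintegral_biUnion hcount (fun b _ => H.measurableSet_ball _ _) hdis]
    _ ≤ C * ∫⁻ x, g x ∂μ := by
        gcongr
        exact Measure.restrict_le_self

/-- The maximal function is bounded on `L^p`, uniformly for `p` in a compact subset of `(1, ∞)`: the
weak type inequality is integrated over the levels, as in Marcinkiewicz interpolation. -/
lemma exists_strong_type (e₀ e₁ : ℝ) (he₀ : 1 < e₀) : ∃ C : ℝ≥0∞, C ≠ ∞ ∧ 1 ≤ C ∧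
    ∀ p, e₀ ≤ p → p ≤ e₁ → ∀ g : X → ℝ≥0∞, Measurable g →
      ∫⁻ x, hlMax d μ (R₀ + 1) g x ^ p ∂μ ≤ C * ∫⁻ x, g x ^ p ∂μ := by
  obtain ⟨C, hC, hweak⟩ := H.exists_weak_type
  refine ⟨max 1 (ENNReal.ofReal e₁ * (2 * C * (2 ^ (e₁ - 1) / ENNReal.ofReal (e₀ - 1)))), ?_,
    le_max_left _ _, fun p hp₀ hp₁ g hg => ?_⟩
  · refine (max_lt ENNReal.one_lt_top (ENNReal.mul_lt_top ENNReal.ofReal_lt_top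
      (ENNReal.mul_lt_top (ENNReal.mul_lt_top (by simp) hC.lt_top)
        (ENNReal.div_lt_top ?_ ?_)))).ne
    · exact ENNReal.rpow_ne_top_of_ne_zero (by simp) (by simp)
    · simpa using he₀
  have hp : 0 < p := by linarith
  have hp1 : 0 < p - 1 := by linarith
  set M := hlMax d μ (R₀ + 1) g with hM
  have hMm : Measurable M := H.measurable_hlMax _ hg
  have layer : ∀ (q : ℝ), 0 < q → ∀ a : ℝ≥0∞, a ^ q = ENNReal.ofReal q *
      ∫⁻ t in Ioi (0 : ℝ), {t : ℝ | ENNReal.ofReal t < a}.indicator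
        (fun t => ENNReal.ofReal (t ^ (q - 1))) t := by
    intro q hq a
    rw [lintegral_Ioi_indicator_rpow hq,
      ENNReal.mul_div_cancel (by simpa using hq) ENNReal.ofReal_ne_top]
  -- At height `t` only the part of `g` above `t / 2` matters.
  have hlevel : ∀ t : ℝ, 0 < t → ENNReal.ofReal (t / 2) * μ {x | ENNReal.ofReal t < M x} ≤
      C * ∫⁻ x, {x | ENNReal.ofReal (t / 2) < g x}.indicator g x ∂μ := by
    intro t ht
    refine le_trans ?_ (hweak (R₀ + 1) _ (ENNReal.ofReal (t / 2)))
    refine mul_le_mul_right (measure_mono fun x hx => ?_) _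
    by_contra hcon
    simp only [mem_ofPred_eq, not_lt] at hcon
    rw [mem_ofPred_eq] at hx
    refine absurd hx (not_lt.2 ?_)
    refine iSup₂_le fun r hr => ?_
    rw [H.ballAvg_le_iff hr.1]
    have h1 := (ballAvg_le_hlMax_of_lt (d := d) (μ := μ)
      ({x | ENNReal.ofReal (t / 2) < g x}.indicator g) x hr.1 hr.2).trans hcon
    rw [H.ballAvg_le_iff hr.1] at h1
    have h2 : ∀ y, g y ≤ {x | ENNReal.ofReal (t / 2) < g x}.indicator g y
        + ENNReal.ofReal (t / 2) := by
      intro y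
      by_cases hy : ENNReal.ofReal (t / 2) < g y
      · rw [indicator_of_mem (show y ∈ {x | ENNReal.ofReal (t / 2) < g x} from hy)]
        exact le_self_add
      · exact (not_lt.1 hy).trans le_add_self
    calc ∫⁻ y in qball d x r, g y ∂μ
        ≤ ∫⁻ y in qball d x r, ({x | ENNReal.ofReal (t / 2) < g x}.indicator g y
          + ENNReal.ofReal (t / 2)) ∂μ := lintegral_mono h2
      _ ≤ ENNReal.ofReal (t / 2) * μ (qball d x r)
          + ENNReal.ofReal (t / 2) * μ (qball d x r) := by
          rw [lintegral_add_right _ measurable_const, setLIntegral_const]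
          gcongr
      _ = ENNReal.ofReal t * μ (qball d x r) := by
          rw [← add_mul, ← ENNReal.ofReal_add (by positivity) (by positivity), add_halves]
  have hmS : ∀ {f : X → ℝ≥0∞}, Measurable f → ∀ c : ℝ, ∀ e : ℝ,
      Measurable (Function.uncurry fun (x : X) (t : ℝ) =>
        {t : ℝ | ENNReal.ofReal (t / c) < f x}.indicator (fun t => ENNReal.ofReal (t ^ e)) t) := by
    intro f hf c e
    have hs : MeasurableSet {z : X × ℝ | ENNReal.ofReal (z.2 / c) < f z.1} :=
      measurableSet_lt (by fun_prop) (by fun_prop)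
    have : (Function.uncurry fun (x : X) (t : ℝ) =>
        {t : ℝ | ENNReal.ofReal (t / c) < f x}.indicator (fun t => ENNReal.ofReal (t ^ e)) t) =
        {z : X × ℝ | ENNReal.ofReal (z.2 / c) < f z.1}.indicator
          (fun z => ENNReal.ofReal (z.2 ^ e)) := by
      ext z; rfl
    rw [this]
    exact Measurable.indicator (by fun_prop) hs
  have hstep : ∫⁻ x, M x ^ p ∂μ ≤ ENNReal.ofReal p * (2 * C * ∫⁻ x, (2 * g x) ^ (p - 1) /
      ENNReal.ofReal (p - 1) * g x ∂μ) := by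
    calc ∫⁻ x, M x ^ p ∂μ
        = ENNReal.ofReal p * ∫⁻ x, (∫⁻ t in Ioi (0 : ℝ),
          {t : ℝ | ENNReal.ofReal (t / 1) < M x}.indicator
            (fun t => ENNReal.ofReal (t ^ (p - 1))) t) ∂μ := by
          simp_rw [div_one]
          rw [← lintegral_const_mul']
          · exact lintegral_congr fun x => layer p hp (M x)
          · exact ENNReal.ofReal_ne_top
      _ = ENNReal.ofReal p * ∫⁻ t in Ioi (0 : ℝ),
          ∫⁻ x, {t : ℝ | ENNReal.ofReal (t / 1) < M x}.indicator
          (fun t => ENNReal.ofReal (t ^ (p - 1))) t ∂μ := by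
          rw [lintegral_lintegral_swap (hmS hMm 1 (p - 1)).aemeasurable]
      _ ≤ ENNReal.ofReal p * ∫⁻ t in Ioi (0 : ℝ), 2 * C *
          ∫⁻ x, {t : ℝ | ENNReal.ofReal (t / 2) < g x}.indicator
          (fun t => ENNReal.ofReal (t ^ (p - 1 - 1))) t * g x ∂μ := by
          gcongr 1
          refine setLIntegral_mono' measurableSet_Ioi fun t ht => ?_
          have ht : 0 < t := ht
          have e1 : ∫⁻ x, {t : ℝ | ENNReal.ofReal (t / 1) < M x}.indicator
              (fun t => ENNReal.ofReal (t ^ (p - 1))) t ∂μ =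
              ENNReal.ofReal (t ^ (p - 1)) * μ {x | ENNReal.ofReal t < M x} := by
            rw [← lintegral_indicator_const (measurableSet_lt measurable_const hMm)]
            refine lintegral_congr fun x => ?_
            simp [indicator]
          have e2 : ∫⁻ x, {t : ℝ | ENNReal.ofReal (t / 2) < g x}.indicator
              (fun t => ENNReal.ofReal (t ^ (p - 1 - 1))) t * g x ∂μ =
              ENNReal.ofReal (t ^ (p - 1 - 1)) *
                ∫⁻ x, {x | ENNReal.ofReal (t / 2) < g x}.indicator g x ∂μ := by
            rw [← lintegral_const_mul']
            · refine lintegral_congr fun x => ?_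
              simp only [indicator, mem_ofPred_eq]
              split_ifs <;> simp
            · exact ENNReal.ofReal_ne_top
          have e3 : ENNReal.ofReal (t ^ (p - 1)) =
              2 * ENNReal.ofReal (t ^ (p - 1 - 1)) * ENNReal.ofReal (t / 2) := by
            have : t ^ (p - 1) = t ^ (p - 1 - 1) * t := by
              rw [← Real.rpow_add_one ht.ne']; ring_nf
            rw [show (2 : ℝ≥0∞) = ENNReal.ofReal 2 by simp, ← ENNReal.ofReal_mul (by norm_num),
              ← ENNReal.ofReal_mul (by positivity), this]
            ring_nf
          rw [e1, e2, e3]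
          calc 2 * ENNReal.ofReal (t ^ (p - 1 - 1)) * ENNReal.ofReal (t / 2) *
                μ {x | ENNReal.ofReal t < M x}
              = 2 * ENNReal.ofReal (t ^ (p - 1 - 1)) * (ENNReal.ofReal (t / 2) *
                μ {x | ENNReal.ofReal t < M x}) := by ring
            _ ≤ 2 * ENNReal.ofReal (t ^ (p - 1 - 1)) * (C *
                ∫⁻ x, {x | ENNReal.ofReal (t / 2) < g x}.indicator g x ∂μ) := by
                exact mul_le_mul_right (hlevel t ht) _
            _ = _ := by ring
      _ = ENNReal.ofReal p * (2 * C * ∫⁻ x, (∫⁻ t in Ioi (0 : ℝ),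
          {t : ℝ | ENNReal.ofReal (t / 2) < g x}.indicator
            (fun t => ENNReal.ofReal (t ^ (p - 1 - 1))) t * g x) ∂μ) := by
          rw [lintegral_const_mul' _ _ (ENNReal.mul_ne_top (by simp) hC)]
          rw [lintegral_lintegral_swap (μ := μ)
            (f := fun x t => {t : ℝ | ENNReal.ofReal (t / 2) < g x}.indicator
              (fun t => ENNReal.ofReal (t ^ (p - 1 - 1))) t * g x)
            ((hmS hg 2 (p - 1 - 1)).mul (hg.comp measurable_fst)).aemeasurable]
      _ = _ := by
          congr 3
          funext x
          rw [lintegral_mul_const (μ := volume.restrict (Ioi (0 : ℝ))) _ (f := fun t =>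
              {t : ℝ | ENNReal.ofReal (t / 2) < g x}.indicator
                (fun t => ENNReal.ofReal (t ^ (p - 1 - 1))) t)
              ((hmS hg 2 (p - 1 - 1)).comp measurable_prodMk_left),
            ← lintegral_Ioi_indicator_rpow hp1]
          congr 2
          funext t
          congr 1
          ext t
          simp only [mem_ofPred_eq]
          rw [ENNReal.ofReal_div_of_pos two_pos, ENNReal.ofReal_ofNat,
            ENNReal.div_lt_iff (by simp) (by simp), mul_comm]
  refine hstep.trans ?_
  have hfin : ∀ x, (2 * g x) ^ (p - 1) / ENNReal.ofReal (p - 1) * g x =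
      2 ^ (p - 1) / ENNReal.ofReal (p - 1) * g x ^ p := by
    intro x
    have : g x ^ p = g x ^ (p - 1) * g x := by
      conv_rhs => rw [← ENNReal.rpow_one (g x), ← ENNReal.rpow_mul, one_mul]
      rw [← ENNReal.rpow_add_of_nonneg _ _ hp1.le zero_le_one, sub_add_cancel]
    rw [this, ENNReal.mul_rpow_of_nonneg _ _ hp1.le, div_eq_mul_inv, div_eq_mul_inv]
    ring
  simp_rw [hfin]
  rw [lintegral_const_mul _ (hg.pow_const p), ← mul_assoc (2 * C), ← mul_assoc]
  refine mul_le_mul_left ?_ _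
  refine le_trans ?_ (le_max_right _ _)
  gcongr
  exact one_le_two

end HomSpace

end Maximal

/-! ### Morrey bounds and the maximal function -/

lemma rpow_le_self_of_one_le {x : ℝ≥0∞} {z : ℝ} (hx : 1 ≤ x) (hz : z ≤ 1) : x ^ z ≤ x := by
  simpa using ENNReal.rpow_le_rpow_of_exponent_le hx hz

section Morrey

variable {X : Type*} [MeasurableSpace X]

/-- `‖g‖_{L^{p,l}} ≤ N`, where all balls of positive radius are taken into account. -/
def MorreyBound (d : X → X → ℝ) (μ : Measure X) (g : X → ℝ≥0∞) (p l : ℝ) (N : ℝ≥0∞) : Prop :=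
  ∀ x r, 0 < r → ∫⁻ y in qball d x r, g y ^ p ∂μ ≤ N ^ p * μ (qball d x r) ^ l

variable {d : X → X → ℝ} {μ : Measure X} {K R₀ E : ℝ} {A τ : ℝ≥0∞}

lemma MorreyBound.mono {g h : X → ℝ≥0∞} {p l : ℝ} {N N' : ℝ≥0∞} (hN : MorreyBound d μ g p l N)
    (hp : 0 ≤ p) (hg : h ≤ g) (hNN : N ≤ N') : MorreyBound d μ h p l N' := fun x r hr =>
  calc ∫⁻ y in qball d x r, h y ^ p ∂μ ≤ ∫⁻ y in qball d x r, g y ^ p ∂μ :=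
        lintegral_mono fun y => ENNReal.rpow_le_rpow (hg y) hp
    _ ≤ N ^ p * μ (qball d x r) ^ l := hN x r hr
    _ ≤ N' ^ p * μ (qball d x r) ^ l := by gcongr

lemma MorreyBound.rpow {g : X → ℝ≥0∞} {p l t : ℝ} {N : ℝ≥0∞} (hN : MorreyBound d μ g p l N)
    (ht : 0 < t) : MorreyBound d μ (fun x => g x ^ t) (p / t) l (N ^ t) := by
  intro x r hr
  have := hN x r hr
  simp_rw [← ENNReal.rpow_mul, mul_div_cancel₀ _ ht.ne']
  exact this

/-- A bound for `∫ (f + g)^q` from bounds for `∫ f^q` and `∫ g^q`. -/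
lemma lintegral_add_rpow_le {ν : Measure X} {f g : X → ℝ≥0∞} {q q₁ : ℝ}
    (hq : 1 ≤ q) (hq₁ : q ≤ q₁) (hf : AEMeasurable f ν) :
    ∫⁻ x, (f x + g x) ^ q ∂ν ≤
      2 ^ q₁ * (∫⁻ x, f x ^ q ∂ν + ∫⁻ x, g x ^ q ∂ν) := by
  rw [← lintegral_add_left' (hf.pow_const q), ← lintegral_const_mul' _ _
    (ENNReal.rpow_ne_top_of_ne_zero (by simp) (by simp))]
  refine lintegral_mono fun x => (ENNReal.rpow_add_le_mul_rpow_add_rpow _ _ hq).trans ?_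
  gcongr
  · exact one_le_two
  · linarith

namespace HomSpace

variable (H : HomSpace d μ K R₀ E A τ) [IsFiniteMeasure μ]
include H

/-- Averages of a Morrey function are controlled by a negative power of the measure of the ball. -/
lemma ballAvg_rpow_le {g : X → ℝ≥0∞} (hg : Measurable g) {p l t : ℝ} {N : ℝ≥0∞} (ht : 0 < t)
    (htp : t ≤ p) (hN : MorreyBound d μ g p l N) {x : X} {r : ℝ} (hr : 0 < r) :
    ballAvg d μ (fun y => g y ^ t) x r ^ (1 / t) ≤ μ (qball d x r) ^ (-((1 - l) / p)) * N := by
  have hp : 0 < p := ht.trans_le htp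
  have h0 := H.ball_ne_zero x hr
  have h1 : μ (qball d x r) ≠ ∞ := measure_ne_top _ _
  have h := lintegral_rpow_le_of_le (ν := μ.restrict (qball d x r)) ht htp hg.aemeasurable
  rw [Measure.restrict_apply_univ] at h
  rw [ballAvg, ENNReal.div_rpow_of_nonneg _ _ (by positivity), div_eq_mul_inv, ← ENNReal.rpow_neg]
  calc (∫⁻ y in qball d x r, g y ^ t ∂μ) ^ (1 / t) * μ (qball d x r) ^ (-(1 / t))
      ≤ (N ^ p * μ (qball d x r) ^ l) ^ (1 / p) * μ (qball d x r) ^ (1 / t - 1 / p) *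
          μ (qball d x r) ^ (-(1 / t)) := by
        gcongr
        exact h.trans (by gcongr; exact hN x r hr)
    _ = μ (qball d x r) ^ (-((1 - l) / p)) * N := by
        rw [ENNReal.mul_rpow_of_nonneg _ _ (by positivity), ← ENNReal.rpow_mul, ← ENNReal.rpow_mul,
          mul_one_div_cancel hp.ne', ENNReal.rpow_one, mul_assoc, mul_assoc, mul_comm N]
        congr 1
        rw [← ENNReal.rpow_add _ _ h0 h1, ← ENNReal.rpow_add _ _ h0 h1]
        congr 1
        field_simp
        ring

lemma ballAvg_le {g : X → ℝ≥0∞} (hg : Measurable g) {p l : ℝ} {N : ℝ≥0∞}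
    (hp : 1 ≤ p) (hN : MorreyBound d μ g p l N) {x : X} {r : ℝ} (hr : 0 < r) :
    ballAvg d μ g x r ≤ μ (qball d x r) ^ (-((1 - l) / p)) * N := by
  simpa using H.ballAvg_rpow_le hg one_pos hp hN hr

/-- The maximal operator is bounded on Morrey spaces, uniformly in the parameters. -/
lemma exists_morrey_hlMax (e₀ e₁ : ℝ) (he₀ : 1 < e₀) : ∃ C : ℝ≥0∞, C ≠ ∞ ∧
    ∀ p l, e₀ ≤ p → p ≤ e₁ → 0 ≤ l → l ≤ 1 → ∀ (g : X → ℝ≥0∞) (N : ℝ≥0∞), Measurable g →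
      MorreyBound d μ g p l N → MorreyBound d μ (hlMax d μ (R₀ + 1) g) p l (C * N) := by
  obtain ⟨C₁, hC₁, hC₁1, hstrong⟩ := H.exists_strong_type e₀ e₁ he₀
  obtain ⟨C₂, hC₂, hC₂1, hcomp⟩ := H.exists_compar (2 * K)
  have hK := H.one_le_K
  refine ⟨2 ^ e₁ * (C₁ * C₂ + C₂), ?_, fun p l hp₀ hp₁ hl0 hl1 g N hg hN x₀ R hR => ?_⟩
  · exact ENNReal.mul_ne_top (ENNReal.rpow_ne_top_of_ne_zero (by simp) (by simp))
      (ENNReal.add_ne_top.2 ⟨ENNReal.mul_ne_top hC₁ hC₂, hC₂⟩)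
  have hp1 : 1 ≤ p := by linarith
  have hp : 0 < p := by linarith
  set b := μ (qball d x₀ R) with hb
  have hb0 : b ≠ 0 := H.ball_ne_zero x₀ hR
  have hbt : b ≠ ∞ := measure_ne_top _ _
  set g₁ := (qball d x₀ (2 * K * R)).indicator g with hg₁
  have hg₁m : Measurable g₁ := hg.indicator (H.measurableSet_ball _ _)
  -- On the ball, averages over small balls see only `g₁`, and averages over large balls are
  -- bounded by the Morrey bound of `g`.
  have hpt : ∀ x ∈ qball d x₀ R, hlMax d μ (R₀ + 1) g x ≤
      hlMax d μ (R₀ + 1) g₁ x + C₂ * (b ^ (-((1 - l) / p)) * N) := by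
    intro x hx
    refine iSup₂_le fun r hr => ?_
    rcases le_or_gt r R with h | h
    · refine le_trans ?_ le_self_add
      refine le_trans (le_of_eq ?_) (ballAvg_le_hlMax_of_lt g₁ x hr.1 hr.2)
      rw [ballAvg, ballAvg]
      congr 1
      refine setLIntegral_congr_fun (H.measurableSet_ball x r) fun y hy => ?_
      rw [hg₁, indicator_of_mem]
      have := H.tri_lt hx hy
      rw [mem_qball]
      nlinarith
    · refine le_trans ?_ le_add_self
      refine (H.ballAvg_le hg hp1 hN hr.1).trans ?_
      rw [← mul_assoc]
      gcongr
      have h1 : b ≤ C₂ * μ (qball d x r) := by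
        refine (measure_mono (qball_mono ?_)).trans (hcomp x₀ x r hr.1 ?_)
        · nlinarith
        · exact lt_of_lt_of_le hx (by nlinarith)
      have hβ : 0 ≤ (1 - l) / p := div_nonneg (by linarith) hp.le
      have hβ1 : (1 - l) / p ≤ 1 := by rw [div_le_one hp]; linarith
      rw [ENNReal.rpow_neg, ENNReal.rpow_neg, ← div_eq_mul_inv, ENNReal.le_div_iff_mul_le
        (Or.inl (by simp [hb0, hbt])) (Or.inl (ENNReal.rpow_ne_top_of_nonneg hβ hbt)), mul_comm,
        ← div_eq_mul_inv]
      refine ENNReal.div_le_of_le_mul ?_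
      calc b ^ ((1 - l) / p) ≤ (C₂ * μ (qball d x r)) ^ ((1 - l) / p) := by gcongr
        _ = C₂ ^ ((1 - l) / p) * μ (qball d x r) ^ ((1 - l) / p) :=
          ENNReal.mul_rpow_of_nonneg _ _ hβ
        _ ≤ C₂ * μ (qball d x r) ^ ((1 - l) / p) := by
          gcongr
          exact rpow_le_self_of_one_le hC₂1 hβ1
  have hfar : (C₂ * (b ^ (-((1 - l) / p)) * N)) ^ p * b = C₂ ^ p * (N ^ p * b ^ l) := by
    rw [ENNReal.mul_rpow_of_nonneg _ _ hp.le, ENNReal.mul_rpow_of_nonneg _ _ hp.le,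
      ← ENNReal.rpow_mul]
    have : b ^ l = b ^ (-((1 - l) / p) * p) * b := by
      conv_rhs => rw [← ENNReal.rpow_one b, ← ENNReal.rpow_mul, one_mul]
      rw [← ENNReal.rpow_add _ _ hb0 hbt]
      congr 1
      field_simp
      ring
    rw [this]; ring
  have hnear : ∫⁻ x in qball d x₀ R, hlMax d μ (R₀ + 1) g₁ x ^ p ∂μ ≤
      C₁ * C₂ * (N ^ p * b ^ l) := by
    calc ∫⁻ x in qball d x₀ R, hlMax d μ (R₀ + 1) g₁ x ^ p ∂μ
        ≤ ∫⁻ x, hlMax d μ (R₀ + 1) g₁ x ^ p ∂μ := setLIntegral_le_lintegral _ _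
      _ ≤ C₁ * ∫⁻ x, g₁ x ^ p ∂μ := hstrong p hp₀ hp₁ g₁ hg₁m
      _ = C₁ * ∫⁻ x in qball d x₀ (2 * K * R), g x ^ p ∂μ := by
        rw [← lintegral_indicator (H.measurableSet_ball _ _)]
        congr 2
        funext x
        by_cases hx : x ∈ qball d x₀ (2 * K * R)
        · simp [hg₁, hx]
        · simp [hg₁, hx, hp]
      _ ≤ C₁ * (N ^ p * μ (qball d x₀ (2 * K * R)) ^ l) := by
        gcongr; exact hN _ _ (by positivity)
      _ ≤ C₁ * (N ^ p * (C₂ * b) ^ l) := by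
        gcongr; exact hcomp _ _ _ hR (by rw [H.self]; positivity)
      _ ≤ C₁ * (N ^ p * (C₂ * b ^ l)) := by
        gcongr
        rw [ENNReal.mul_rpow_of_nonneg _ _ hl0]
        gcongr
        exact rpow_le_self_of_one_le hC₂1 hl1
      _ = _ := by ring
  calc ∫⁻ x in qball d x₀ R, hlMax d μ (R₀ + 1) g x ^ p ∂μ
      ≤ ∫⁻ x in qball d x₀ R, (hlMax d μ (R₀ + 1) g₁ x
          + C₂ * (b ^ (-((1 - l) / p)) * N)) ^ p ∂μ :=
        setLIntegral_mono' (H.measurableSet_ball _ _) fun x hx =>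
          ENNReal.rpow_le_rpow (hpt x hx) hp.le
    _ ≤ 2 ^ e₁ * (C₁ * C₂ * (N ^ p * b ^ l) + C₂ ^ p * (N ^ p * b ^ l)) := by
        refine (lintegral_add_rpow_le hp1 hp₁ (H.measurable_hlMax _ hg₁m).aemeasurable).trans ?_
        gcongr
        rw [setLIntegral_const, ← hfar]
    _ ≤ (2 ^ e₁ * (C₁ * C₂ + C₂)) ^ p * (N ^ p * b ^ l) := by
        have h2 : (1 : ℝ≥0∞) ≤ 2 ^ e₁ := ENNReal.one_le_rpow (by simp) (by linarith)
        rw [← add_mul, ← mul_assoc, ENNReal.mul_rpow_of_nonneg _ _ hp.le]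
        gcongr
        · exact ENNReal.le_rpow_self_of_one_le h2 hp1
        · refine le_trans ?_ (ENNReal.add_rpow_le_rpow_add _ _ hp1)
          gcongr
          exact ENNReal.le_rpow_self_of_one_le (one_le_mul hC₁1 hC₂1) hp1
    _ = _ := by rw [← mul_assoc, ← ENNReal.mul_rpow_of_nonneg _ _ hp.le]

end HomSpace

end Morrey

/-! ### Lebesgue's theorem and the John–Nirenberg inequality -/

section JohnNirenberg

variable {X : Type*} [MeasurableSpace X] {d : X → X → ℝ} {μ : Measure X} {K R₀ E : ℝ}
  {A τ : ℝ≥0∞}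

namespace HomSpace

variable (H : HomSpace d μ K R₀ E A τ) [IsFiniteMeasure μ]
include H

/-- A weak form of Lebesgue's differentiation theorem: an integrable function is dominated almost
everywhere by its maximal function over arbitrarily small balls. Continuous functions satisfy this,
and the weak type inequality controls the error of approximation by them. -/
lemma ae_enorm_le_hlMax [TopologicalSpace X]
    (hnhds : ∀ x : X, ∀ V ∈ 𝓝 x, ∃ r, 0 < r ∧ qball d x r ⊆ V)
    (hdense : ∀ f : X → ℝ, Integrable f μ → ∀ ε : ℝ≥0∞, ε ≠ 0 →
      ∃ g : X → ℝ, Continuous g ∧ HasCompactSupport g ∧ Integrable g μ ∧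
        ∫⁻ x, ‖f x - g x‖ₑ ∂μ ≤ ε)
    {g : X → ℝ} (hg : Integrable g μ) {ρ : ℝ} (hρ : 0 < ρ) :
    ∀ᵐ x ∂μ, ‖g x‖ₑ ≤ hlMax d μ ρ (fun y => ‖g y‖ₑ) x := by
  obtain ⟨C, hC, hweak⟩ := H.exists_weak_type
  have key : ∀ δ : ℝ, 0 < δ → μ {x | hlMax d μ ρ (fun y => ‖g y‖ₑ) x
      + ENNReal.ofReal (3 * δ) < ‖g x‖ₑ} = 0 := by
    intro δ hδ
    set S := {x | hlMax d μ ρ (fun y => ‖g y‖ₑ) x + ENNReal.ofReal (3 * δ) < ‖g x‖ₑ} with hS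
    have hδ0 : ENNReal.ofReal δ ≠ 0 := by simpa using hδ
    have hle : ∀ ε : ℝ≥0∞, ε ≠ 0 → ENNReal.ofReal δ * μ S ≤ (1 + C) * ε := by
      intro ε hε
      obtain ⟨c, hcc, -, hci, hcε⟩ := hdense g hg ε hε
      have hsub : S ⊆ {x | ENNReal.ofReal δ ≤ ‖g x - c x‖ₑ} ∪
          {x | ENNReal.ofReal δ < hlMax d μ ρ (fun y => ‖g y - c y‖ₑ) x} := by
        intro x hx
        by_contra hcon
        rw [mem_union, not_or, mem_ofPred_eq, mem_ofPred_eq, not_le, not_lt] at hcon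
        rw [hS, mem_ofPred_eq] at hx
        obtain ⟨r₁, hr₁, hr₁s⟩ := hnhds x {y | ‖c x - c y‖ₑ < ENNReal.ofReal δ} (by
          have : Tendsto (fun y => ‖c x - c y‖ₑ) (𝓝 x) (𝓝 0) := by
            have h := ((continuous_const (y := c x)).sub hcc).enorm.tendsto x
            simpa using h
          exact this.eventually_lt_const (pos_iff_ne_zero.2 hδ0))
        set r := min r₁ (ρ / 2) with hr
        have hr0 : 0 < r := lt_min hr₁ (by positivity)
        have hrρ : r < ρ := (min_le_right _ _).trans_lt (by linarith)
        set m := μ (qball d x r) with hm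
        have hm0 : m ≠ 0 := H.ball_ne_zero x hr0
        have hmt : m ≠ ∞ := measure_ne_top _ _
        have h1 : ∫⁻ y in qball d x r, ‖g y‖ₑ ∂μ ≤ hlMax d μ ρ (fun y => ‖g y‖ₑ) x * m :=
          (H.ballAvg_le_iff hr0).1 (ballAvg_le_hlMax_of_lt _ x hr0 hrρ)
        have h2 : ∫⁻ y in qball d x r, ‖g y - c y‖ₑ ∂μ ≤ ENNReal.ofReal δ * m :=
          (H.ballAvg_le_iff hr0).1 ((ballAvg_le_hlMax_of_lt _ x hr0 hrρ).trans hcon.2)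
        have h3 : ‖c x‖ₑ * m ≤ (hlMax d μ ρ (fun y => ‖g y‖ₑ) x + ENNReal.ofReal δ
            + ENNReal.ofReal δ) * m := by
          calc ‖c x‖ₑ * m = ∫⁻ y in qball d x r, ‖c x‖ₑ ∂μ := by rw [setLIntegral_const]
            _ ≤ ∫⁻ y in qball d x r, (‖g y‖ₑ + ‖g y - c y‖ₑ + ENNReal.ofReal δ) ∂μ := by
              refine setLIntegral_mono' (H.measurableSet_ball x r) fun y hy => ?_
              have hy1 : ‖c x - c y‖ₑ < ENNReal.ofReal δ :=
                hr₁s (qball_mono (min_le_left _ _) hy)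
              calc ‖c x‖ₑ = ‖g y - (g y - c y) + (c x - c y)‖ₑ := by ring_nf
                _ ≤ ‖g y‖ₑ + ‖g y - c y‖ₑ + ‖c x - c y‖ₑ :=
                  (enorm_add_le _ _).trans (add_le_add_left enorm_sub_le _)
                _ ≤ _ := by gcongr
            _ = ∫⁻ y in qball d x r, ‖g y‖ₑ ∂μ + ∫⁻ y in qball d x r, ‖g y - c y‖ₑ ∂μ
                + ENNReal.ofReal δ * m := by
              rw [lintegral_add_right _ measurable_const,
                lintegral_add_left' hg.1.aemeasurable.enorm.restrict, setLIntegral_const]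
            _ ≤ _ := by rw [add_mul, add_mul]; gcongr
        have h4 := (ENNReal.mul_le_mul_iff_left hm0 hmt).1 h3
        refine absurd hx (not_lt.2 ?_)
        calc ‖g x‖ₑ = ‖(g x - c x) + c x‖ₑ := by ring_nf
          _ ≤ ‖g x - c x‖ₑ + ‖c x‖ₑ := enorm_add_le _ _
          _ ≤ ENNReal.ofReal δ + (hlMax d μ ρ (fun y => ‖g y‖ₑ) x + ENNReal.ofReal δ
            + ENNReal.ofReal δ) := add_le_add hcon.1.le h4
          _ = _ := by
            rw [show 3 * δ = δ + δ + δ by ring, ENNReal.ofReal_add (by positivity) hδ.le,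
              ENNReal.ofReal_add hδ.le hδ.le]
            ring
      calc ENNReal.ofReal δ * μ S
          ≤ ENNReal.ofReal δ * μ {x | ENNReal.ofReal δ ≤ ‖g x - c x‖ₑ} +
            ENNReal.ofReal δ * μ {x | ENNReal.ofReal δ < hlMax d μ ρ (fun y => ‖g y - c y‖ₑ) x} := by
            rw [← mul_add]
            gcongr
            exact (measure_mono hsub).trans (measure_union_le _ _)
        _ ≤ ∫⁻ x, ‖g x - c x‖ₑ ∂μ + C * ∫⁻ x, ‖g x - c x‖ₑ ∂μ := by
            exact add_le_add
              (mul_meas_ge_le_lintegral₀ (hg.sub hci).1.aemeasurable.enorm _) (hweak _ _ _)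
        _ ≤ (1 + C) * ε := by rw [add_mul, one_mul]; gcongr
    by_contra hne
    have h0 : ENNReal.ofReal δ * μ S ≠ 0 := mul_ne_zero hδ0 hne
    have hfin : ENNReal.ofReal δ * μ S ≠ ∞ := ENNReal.mul_ne_top ENNReal.ofReal_ne_top
      (measure_ne_top _ _)
    have h1C : (1 + C) ≠ 0 := by simp
    have h1C' : (1 + C) ≠ ∞ := ENNReal.add_ne_top.2 ⟨by simp, hC⟩
    have := hle (ENNReal.ofReal δ * μ S / (1 + C) / 2)
      (by simp [ENNReal.div_eq_zero_iff, h0, h1C'])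
    rw [← mul_div_assoc, ENNReal.mul_div_cancel h1C h1C'] at this
    exact absurd this (not_le.2 (ENNReal.half_lt_self h0 hfin))
  have hall : ∀ n : ℕ, ∀ᵐ x ∂μ, ¬ (hlMax d μ ρ (fun y => ‖g y‖ₑ) x
      + ENNReal.ofReal (3 * (1 / ((n : ℝ) + 1))) < ‖g x‖ₑ) := fun n => by
    rw [ae_iff]
    simpa only [not_not] using key (1 / ((n : ℝ) + 1)) (by positivity)
  filter_upwards [ae_all_iff.2 hall] with x hx
  refine ge_of_tendsto' (x := atTop) ?_ fun n => not_lt.1 (hx n)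
  have h1 : Tendsto (fun n : ℕ => ENNReal.ofReal (3 * (1 / ((n : ℝ) + 1)))) atTop (𝓝 0) := by
    have := (tendsto_one_div_add_atTop_nhds_zero_nat (𝕜 := ℝ)).const_mul 3
    rw [mul_zero] at this
    simpa using (ENNReal.tendsto_ofReal this)
  simpa using tendsto_const_nhds.add h1

/-- The John-Nirenberg inequality: exponential decay of the level sets of `b - c` on balls. By a
Calderón-Zygmund decomposition, the points where `b - c` is large are covered by balls of at most
half the total measure on which the average of `b - c` is bounded; each increment of the level by
`L` therefore gains a factor `1/2`. -/
lemma exists_johnNirenberg {b : X → ℝ} (hb : Integrable b μ)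
    (hleb : ∀ c ρ : ℝ, 0 < ρ → ∀ᵐ x ∂μ, ‖b x - c‖ₑ ≤ hlMax d μ ρ (fun y => ‖b y - c‖ₑ) x)
    {N : ℝ≥0∞} (hN : N ≠ ∞)
    (hosc : ∀ x r, 0 < r → ∃ c : ℝ, ∫⁻ y in qball d x r, ‖b y - c‖ₑ ∂μ ≤ N * μ (qball d x r)) :
    ∃ (L : ℝ≥0∞) (c : X → ℝ → ℝ), L ≠ ∞ ∧ 1 ≤ L ∧ ∀ (n : ℕ) x R, 0 < R →
      μ ({y | n * L < ‖b y - c x R‖ₑ} ∩ qball d x R) ≤ 2⁻¹ ^ n * μ (qball d x R) := by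
  have hK := H.one_le_K
  have hK3 : 1 ≤ K ^ 3 := one_le_pow₀ hK
  choose! c₁ hc₁ using hosc
  obtain ⟨C₂, hC₂, hC₂1, hcomp₂⟩ := H.exists_compar (2 * K)
  obtain ⟨C₃, hC₃, hC₃1, hcomp₃⟩ := H.exists_compar (5 * K ^ 3)
  set Λ := 5 * K ^ 3 with hΛ
  have hΛ0 : 0 < Λ := by positivity
  have hΛ1 : 1 < Λ := by linarith
  set N' := max 1 N * C₂ with hN'
  have hN'1 : 1 ≤ N' := one_le_mul (le_max_left _ _) hC₂1
  have hN't : N' ≠ ∞ := ENNReal.mul_ne_top (max_lt ENNReal.one_lt_top hN.lt_top).ne hC₂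
  have hself : ∀ x r, 0 < r → ∀ c : ℝ, 0 < c → d x x < c * r := fun x r hr c hc => by
    rw [H.self]; positivity
  -- The constant attached to a ball is that of an enlarged ball, so that the oscillation about it
  -- is also controlled on smaller balls that leave the original ball.
  set c : X → ℝ → ℝ := fun x R => c₁ x (2 * K * R) with hc
  have hcosc : ∀ x R, 0 < R →
      ∫⁻ y in qball d x (2 * K * R), ‖b y - c x R‖ₑ ∂μ ≤ N' * μ (qball d x R) := by
    intro x R hR
    refine (hc₁ x (2 * K * R) (by positivity)).trans ?_
    exact (mul_le_mul' (le_max_right _ _)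
      (hcomp₂ x x R hR (hself x R hR _ (by positivity)))).trans_eq (mul_assoc _ _ _).symm
  set L₁ := 2 * C₃ * N' with hL₁
  refine ⟨N' + L₁, c, ?_, hN'1.trans le_self_add, ?_⟩
  · exact ENNReal.add_ne_top.2 ⟨hN't, ENNReal.mul_ne_top (ENNReal.mul_ne_top (by simp) hC₃) hN't⟩
  intro n
  induction n with
  | zero =>
    intro x R _
    simpa using measure_mono inter_subset_right
  | succ n ih =>
    intro x₀ R hR
    set c₀ := c x₀ R with hc₀
    have hin : ∀ x ∈ qball d x₀ R, ∀ r, r ≤ R → qball d x r ⊆ qball d x₀ (2 * K * R) := by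
      intro x hx r hr y hy
      have := H.tri_lt hx hy
      rw [mem_qball]; nlinarith
    have hfar : ∀ x ∈ qball d x₀ R, ∀ s, R / Λ ≤ s → s < R →
        ballAvg d μ (fun y => ‖b y - c₀‖ₑ) x s ≤ L₁ := by
      intro x hx s hs hsR
      have hs0 : 0 < s := (div_pos hR hΛ0).trans_le hs
      have hRs : R ≤ Λ * s := by rw [div_le_iff₀ hΛ0] at hs; linarith
      rw [H.ballAvg_le_iff hs0]
      calc ∫⁻ y in qball d x s, ‖b y - c₀‖ₑ ∂μ
          ≤ ∫⁻ y in qball d x₀ (2 * K * R), ‖b y - c₀‖ₑ ∂μ :=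
            lintegral_mono_set (hin x hx s hsR.le)
        _ ≤ N' * μ (qball d x₀ R) := hcosc x₀ R hR
        _ ≤ N' * (C₃ * μ (qball d x s)) := by
            gcongr
            exact (measure_mono (qball_mono hRs)).trans
              (hcomp₃ x₀ x s hs0 (lt_of_lt_of_le hx hRs))
        _ ≤ L₁ * μ (qball d x s) := by
            rw [hL₁, ← mul_assoc, mul_comm N']
            gcongr
            calc C₃ = 1 * C₃ := (one_mul _).symm
              _ ≤ 2 * C₃ := by gcongr; exact one_le_two
    let t : Set (X × ℝ) := {a | a.1 ∈ qball d x₀ R ∧ 0 < a.2 ∧ a.2 < R / Λ ∧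
      L₁ < ballAvg d μ (fun y => ‖b y - c₀‖ₑ) a.1 a.2 ∧
      ballAvg d μ (fun y => ‖b y - c₀‖ₑ) a.1 (Λ * a.2) ≤ L₁}
    -- The stopping radius: enlarging the radius by `Λ` brings the average below the threshold.
    have hradius : ∀ x ∈ qball d x₀ R, L₁ < hlMax d μ (R / Λ) (fun y => ‖b y - c₀‖ₑ) x →
        ∃ r, (x, r) ∈ t := by
      intro x hx hlt
      simp only [hlMax, lt_iSup_iff] at hlt
      obtain ⟨r₀, hr₀, hlt⟩ := hlt
      by_contra! hcon
      have hind : ∀ j : ℕ, Λ ^ j * r₀ < R / Λ ∧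
          L₁ < ballAvg d μ (fun y => ‖b y - c₀‖ₑ) x (Λ ^ j * r₀) := by
        intro j
        induction j with
        | zero => simpa using ⟨hr₀.2, hlt⟩
        | succ j ihj =>
          have hpos : 0 < Λ ^ j * r₀ := mul_pos (pow_pos hΛ0 _) hr₀.1
          have h1 : L₁ < ballAvg d μ (fun y => ‖b y - c₀‖ₑ) x (Λ ^ (j + 1) * r₀) := by
            by_contra h2
            refine hcon (Λ ^ j * r₀) ⟨hx, hpos, ihj.1, ihj.2, ?_⟩
            rw [show Λ * (x, Λ ^ j * r₀).2 = Λ ^ (j + 1) * r₀ by simp only []; ring]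
            exact not_lt.1 h2
          refine ⟨?_, h1⟩
          by_contra h2
          refine absurd h1 (not_lt.2 (hfar x hx _ (not_lt.1 h2) ?_))
          have := (lt_div_iff₀ hΛ0).1 ihj.1
          calc Λ ^ (j + 1) * r₀ = Λ ^ j * r₀ * Λ := by ring
            _ < R := this
      obtain ⟨j, hj⟩ := pow_unbounded_of_one_lt (R / Λ / r₀) hΛ1
      rw [div_lt_iff₀ hr₀.1] at hj
      exact absurd (hind j).1 (not_lt.2 hj.le)
    obtain ⟨u, hut, hcount, hdis, hcov⟩ := H.exists_vitali t R fun a ha =>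
      ⟨ha.2.1, ha.2.2.1.le.trans (div_le_self hR.le hΛ1.le)⟩
    have hcenter : ∀ a ∈ t, ‖c a.1 (Λ * a.2) - c₀‖ₑ ≤ N' + L₁ := by
      intro a ha
      have hr : 0 < Λ * a.2 := mul_pos hΛ0 ha.2.1
      set m := μ (qball d a.1 (Λ * a.2)) with hm
      have hm0 : m ≠ 0 := H.ball_ne_zero _ hr
      have hmt : m ≠ ∞ := measure_ne_top _ _
      refine (ENNReal.mul_le_mul_iff_left hm0 hmt).1 ?_
      calc ‖c a.1 (Λ * a.2) - c₀‖ₑ * m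
          = ∫⁻ y in qball d a.1 (Λ * a.2), ‖c a.1 (Λ * a.2) - c₀‖ₑ ∂μ := by
            rw [setLIntegral_const]
        _ ≤ ∫⁻ y in qball d a.1 (Λ * a.2), (‖b y - c a.1 (Λ * a.2)‖ₑ + ‖b y - c₀‖ₑ) ∂μ := by
            refine lintegral_mono fun y => ?_
            calc ‖c a.1 (Λ * a.2) - c₀‖ₑ = ‖(b y - c₀) - (b y - c a.1 (Λ * a.2))‖ₑ := by ring_nf
              _ ≤ ‖b y - c₀‖ₑ + ‖b y - c a.1 (Λ * a.2)‖ₑ := enorm_sub_le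
              _ = _ := add_comm _ _
        _ = ∫⁻ y in qball d a.1 (Λ * a.2), ‖b y - c a.1 (Λ * a.2)‖ₑ ∂μ +
            ∫⁻ y in qball d a.1 (Λ * a.2), ‖b y - c₀‖ₑ ∂μ := by
            rw [lintegral_add_left']
            exact (hb.1.aemeasurable.sub aemeasurable_const).enorm.restrict
        _ ≤ N' * m + L₁ * m := by
            gcongr
            · refine (lintegral_mono_set (qball_mono ?_)).trans (hcosc a.1 _ hr)
              nlinarith
            · exact (H.ballAvg_le_iff hr).1 ha.2.2.2.2
        _ = _ := by rw [add_mul]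
    have hsub : ∀ᵐ y ∂μ,
        y ∈ {y | ((n + 1 : ℕ) : ℝ≥0∞) * (N' + L₁) < ‖b y - c₀‖ₑ} ∩ qball d x₀ R →
        y ∈ ⋃ a ∈ u, {y | n * (N' + L₁) < ‖b y - c a.1 (Λ * a.2)‖ₑ} ∩
          qball d a.1 (Λ * a.2) := by
      filter_upwards [hleb c₀ (R / Λ) (by positivity)] with y hy hmem
      rw [mem_inter_iff, mem_ofPred_eq] at hmem
      obtain ⟨hylt, hyB⟩ := hmem
      push_cast at hylt
      rw [add_mul, one_mul] at hylt
      have h1 : L₁ < hlMax d μ (R / Λ) (fun y => ‖b y - c₀‖ₑ) y :=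
        lt_of_le_of_lt (le_add_self.trans le_add_self) (hylt.trans_le hy)
      obtain ⟨r, hr⟩ := hradius y hyB h1
      obtain ⟨a, ha, hsub⟩ := hcov _ hr
      refine mem_biUnion ha ⟨?_, hsub (H.mem_self hr.2.1)⟩
      rw [mem_ofPred_eq]
      have h2 : ‖b y - c₀‖ₑ ≤ ‖b y - c a.1 (Λ * a.2)‖ₑ + (N' + L₁) := by
        calc ‖b y - c₀‖ₑ = ‖(b y - c a.1 (Λ * a.2)) + (c a.1 (Λ * a.2) - c₀)‖ₑ := by ring_nf
          _ ≤ _ := (enorm_add_le _ _).trans (add_le_add_right (hcenter a (hut ha)) _)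
      exact lt_of_add_lt_add_right (hylt.trans_le h2)
    have hsum : C₃ * ∑' a : u, μ (qball d a.1.1 a.1.2) ≤ 2⁻¹ * μ (qball d x₀ R) := by
      have h1 : L₁ * ∑' a : u, μ (qball d a.1.1 a.1.2) ≤ N' * μ (qball d x₀ R) := by
        rw [← ENNReal.tsum_mul_left]
        calc ∑' a : u, L₁ * μ (qball d a.1.1 a.1.2)
            ≤ ∑' a : u, ∫⁻ y in qball d a.1.1 a.1.2, ‖b y - c₀‖ₑ ∂μ := by
              gcongr with a
              have ha := hut a.2
              exact ((H.lt_ballAvg_iff ha.2.1).1 ha.2.2.2.1).le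
          _ = ∫⁻ y in ⋃ a ∈ u, qball d a.1 a.2, ‖b y - c₀‖ₑ ∂μ := by
              rw [lintegral_biUnion hcount (fun b _ => H.measurableSet_ball _ _) hdis]
          _ ≤ ∫⁻ y in qball d x₀ (2 * K * R), ‖b y - c₀‖ₑ ∂μ := by
              refine lintegral_mono_set (iUnion₂_subset fun a ha => ?_)
              have ha := hut ha
              exact hin _ ha.1 _ (ha.2.2.1.le.trans (div_le_self hR.le hΛ1.le))
          _ ≤ N' * μ (qball d x₀ R) := hcosc x₀ R hR
      have h2 : N' * (2 * (C₃ * ∑' a : u, μ (qball d a.1.1 a.1.2))) ≤ N' * μ (qball d x₀ R) := by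
        refine le_trans (le_of_eq ?_) h1
        rw [hL₁]; ring
      have h3 := (ENNReal.mul_le_mul_iff_right (zero_lt_one.trans_le hN'1).ne' hN't).1 h2
      rw [mul_comm 2⁻¹, ← div_eq_mul_inv, ENNReal.le_div_iff_mul_le (by simp) (by simp), mul_comm]
      exact h3
    calc μ ({y | ((n + 1 : ℕ) : ℝ≥0∞) * (N' + L₁) < ‖b y - c₀‖ₑ} ∩ qball d x₀ R)
        ≤ μ (⋃ a ∈ u, {y | n * (N' + L₁) < ‖b y - c a.1 (Λ * a.2)‖ₑ} ∩
          qball d a.1 (Λ * a.2)) := measure_mono_ae hsub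
      _ ≤ ∑' a : u, μ ({y | n * (N' + L₁) < ‖b y - c a.1.1 (Λ * a.1.2)‖ₑ} ∩
          qball d a.1.1 (Λ * a.1.2)) := measure_biUnion_le μ hcount _
      _ ≤ ∑' a : u, 2⁻¹ ^ n * (C₃ * μ (qball d a.1.1 a.1.2)) := by
          gcongr with a
          have ha := (hut a.2).2.1
          refine (ih a.1.1 _ (mul_pos hΛ0 ha)).trans ?_
          gcongr
          exact hcomp₃ _ _ _ ha (hself _ _ ha _ hΛ0)
      _ = 2⁻¹ ^ n * (C₃ * ∑' a : u, μ (qball d a.1.1 a.1.2)) := by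
          rw [ENNReal.tsum_mul_left, ENNReal.tsum_mul_left]
      _ ≤ 2⁻¹ ^ n * (2⁻¹ * μ (qball d x₀ R)) := by gcongr
      _ = 2⁻¹ ^ (n + 1) * μ (qball d x₀ R) := by rw [pow_succ]; ring

omit H [IsFiniteMeasure μ] in
lemma tsum_rpow_mul_geometric_ne_top (s : ℝ) :
    ∑' n : ℕ, ((n : ℝ≥0∞) + 1) ^ s * 2⁻¹ ^ n ≠ ∞ := by
  obtain ⟨k, hk⟩ := exists_nat_ge s
  have hsum : Summable fun n : ℕ => ((n : ℝ) + 1) ^ k * (2⁻¹ : ℝ) ^ n := by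
    have h1 := summable_pow_mul_geometric_of_norm_lt_one (R := ℝ) k (r := 2⁻¹) (by norm_num)
    have h2 := ((summable_nat_add_iff 1).2 h1).mul_left 2
    refine h2.congr fun n => ?_
    push_cast
    rw [pow_succ]; ring
  refine ne_top_of_le_ne_top hsum.tsum_ofReal_ne_top (ENNReal.tsum_le_tsum fun n => ?_)
  have h1 : (1 : ℝ≥0∞) ≤ (n : ℝ≥0∞) + 1 := le_add_self
  calc ((n : ℝ≥0∞) + 1) ^ s * 2⁻¹ ^ n ≤ ((n : ℝ≥0∞) + 1) ^ (k : ℝ) * 2⁻¹ ^ n := by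
        gcongr
    _ = ENNReal.ofReal (((n : ℝ) + 1) ^ k * (2⁻¹ : ℝ) ^ n) := by
        rw [ENNReal.rpow_natCast, ENNReal.ofReal_mul (by positivity),
          ENNReal.ofReal_pow (by positivity), ENNReal.ofReal_pow (by positivity),
          ENNReal.ofReal_add (by positivity) zero_le_one, ENNReal.ofReal_natCast,
          ENNReal.ofReal_one, ENNReal.ofReal_inv_of_pos two_pos, ENNReal.ofReal_ofNat]

/-- `L^s` oscillations are controlled for every `s`, by summation of the John-Nirenberg inequality
over the levels. -/
lemma exists_osc_rpow {b : X → ℝ} (hbm : Measurable b) (hb : Integrable b μ)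
    (hleb : ∀ c ρ : ℝ, 0 < ρ → ∀ᵐ x ∂μ, ‖b x - c‖ₑ ≤ hlMax d μ ρ (fun y => ‖b y - c‖ₑ) x)
    {N : ℝ≥0∞} (hN : N ≠ ∞)
    (hosc : ∀ x r, 0 < r → ∃ c : ℝ, ∫⁻ y in qball d x r, ‖b y - c‖ₑ ∂μ ≤ N * μ (qball d x r))
    {s : ℝ} (hs : 0 < s) : ∃ C : ℝ≥0∞, C ≠ ∞ ∧ 1 ≤ C ∧ ∀ x r, 0 < r → ∃ c : ℝ,
      ∫⁻ y in qball d x r, ‖b y - c‖ₑ ^ s ∂μ ≤ C * μ (qball d x r) := by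
  obtain ⟨L, c, hL, hL1, hdecay⟩ := H.exists_johnNirenberg hb hleb hN hosc
  have hL0 : L ≠ 0 := (zero_lt_one.trans_le hL1).ne'
  refine ⟨max 1 (L ^ s * ∑' n : ℕ, ((n : ℝ≥0∞) + 1) ^ s * 2⁻¹ ^ n), ?_, le_max_left _ _,
    fun x r hr => ⟨c x r, ?_⟩⟩
  · exact (max_lt ENNReal.one_lt_top (ENNReal.mul_lt_top
      (ENNReal.rpow_lt_top_of_nonneg hs.le hL) (tsum_rpow_mul_geometric_ne_top s).lt_top)).ne
  have hpt : ∀ y, ‖b y - c x r‖ₑ ^ s ≤ ∑' n : ℕ,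
      {y | n * L < ‖b y - c x r‖ₑ}.indicator (fun _ => L ^ s * ((n : ℝ≥0∞) + 1) ^ s) y := by
    intro y
    rcases eq_or_ne (‖b y - c x r‖ₑ) 0 with h0 | h0
    · rw [h0, ENNReal.zero_rpow_of_pos hs]; exact zero_le
    have hex : ∃ n : ℕ, ‖b y - c x r‖ₑ ≤ n * L := by
      obtain ⟨n, hn⟩ := ENNReal.exists_nat_gt (enorm_ne_top (x := b y - c x r))
      exact ⟨n, hn.le.trans (le_mul_of_one_le_right zero_le hL1)⟩
    classical
    have hfind := Nat.find_spec hex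
    obtain ⟨n, hn⟩ : ∃ n, Nat.find hex = n + 1 := Nat.exists_eq_succ_of_ne_zero (by
      intro h
      rw [h] at hfind
      simp only [Nat.cast_zero, zero_mul, nonpos_iff_eq_zero] at hfind
      exact h0 hfind)
    have hlt : n * L < ‖b y - c x r‖ₑ := not_le.1 (Nat.find_min hex (by omega))
    rw [hn] at hfind
    refine le_trans ?_ (ENNReal.le_tsum n)
    rw [indicator_of_mem (show y ∈ {y | n * L < ‖b y - c x r‖ₑ} from hlt),
      ← ENNReal.mul_rpow_of_nonneg _ _ hs.le]
    refine ENNReal.rpow_le_rpow ?_ hs.le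
    rw [mul_comm]; push_cast at hfind; exact hfind
  have hms : ∀ n : ℕ, MeasurableSet {y | n * L < ‖b y - c x r‖ₑ} := fun n =>
    measurableSet_lt measurable_const (by fun_prop)
  calc ∫⁻ y in qball d x r, ‖b y - c x r‖ₑ ^ s ∂μ
      ≤ ∫⁻ y in qball d x r, ∑' n : ℕ, {y | n * L < ‖b y - c x r‖ₑ}.indicator
          (fun _ => L ^ s * ((n : ℝ≥0∞) + 1) ^ s) y ∂μ := lintegral_mono hpt
    _ = ∑' n : ℕ, L ^ s * ((n : ℝ≥0∞) + 1) ^ s *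
          μ ({y | n * L < ‖b y - c x r‖ₑ} ∩ qball d x r) := by
        rw [lintegral_tsum fun n => (measurable_const.indicator (hms n)).aemeasurable]
        congr 1
        funext n
        rw [lintegral_indicator_const (hms n), Measure.restrict_apply (hms n)]
    _ ≤ ∑' n : ℕ, L ^ s * ((n : ℝ≥0∞) + 1) ^ s * (2⁻¹ ^ n * μ (qball d x r)) := by
        gcongr with n
        exact hdecay n x r hr
    _ = (L ^ s * ∑' n : ℕ, ((n : ℝ≥0∞) + 1) ^ s * 2⁻¹ ^ n) * μ (qball d x r) := by
        rw [← ENNReal.tsum_mul_left, ← ENNReal.tsum_mul_right]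
        congr 1; funext n
        ring
    _ ≤ _ := by gcongr; exact le_max_right _ _

end HomSpace

end JohnNirenberg

/-! ### Geometric sums and the discretized potential -/

section Sequences

variable {z m : ℕ → ℝ≥0∞} {τ : ℝ≥0∞} {δ : ℝ}

lemma geometric_decay (hz : ∀ k, z (k + 1) ≤ τ * z k) (j i : ℕ) : z (j + i) ≤ τ ^ i * z j := by
  induction i with
  | zero => simp
  | succ i ih =>
    calc z (j + (i + 1)) ≤ τ * z (j + i) := hz (j + i)
      _ ≤ τ * (τ ^ i * z j) := by gcongr
      _ = τ ^ (i + 1) * z j := by rw [pow_succ]; ring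

lemma sum_inv_rpow_le (hδ : 0 < δ) (hz : ∀ k, z (k + 1) ≤ τ * z k) (n : ℕ)
    (h1 : ∀ k < n, 1 ≤ z k) : ∑ k ∈ Finset.range n, (z k)⁻¹ ^ δ ≤ (1 - τ ^ δ)⁻¹ := by
  rw [← Finset.sum_range_reflect, ← ENNReal.tsum_geometric]
  refine le_trans (Finset.sum_le_sum fun j hj => ?_) (ENNReal.sum_le_tsum (Finset.range n))
  rw [Finset.mem_range] at hj
  rw [← ENNReal.rpow_natCast, ← ENNReal.rpow_mul, mul_comm, ENNReal.rpow_mul,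
    ENNReal.rpow_natCast]
  refine ENNReal.rpow_le_rpow ?_ hδ.le
  have h2 := geometric_decay hz (n - 1 - j) j
  rw [show n - 1 - j + j = n - 1 by omega] at h2
  have h3 : 1 ≤ τ ^ j * z (n - 1 - j) := (h1 _ (by omega)).trans h2
  rw [← one_div]
  exact ENNReal.div_le_of_le_mul h3

/-- A sequence decaying geometrically crosses the level `1` only once, so that the sum of
`min (z k) (z k)⁻¹ ^ δ` is bounded independently of the sequence. -/
lemma tsum_min_rpow_le (hδ : 0 < δ) (hz : ∀ k, z (k + 1) ≤ τ * z k) :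
    ∑' k, min (z k) (z k)⁻¹ ^ δ ≤ 2 * (1 - τ ^ δ)⁻¹ := by
  have hpart : ∀ n, (∀ k < n, 1 ≤ z k) →
      ∑ k ∈ Finset.range n, min (z k) (z k)⁻¹ ^ δ ≤ (1 - τ ^ δ)⁻¹ := fun n hn =>
    (Finset.sum_le_sum fun k _ => ENNReal.rpow_le_rpow (min_le_right _ _) hδ.le).trans
      (sum_inv_rpow_le hδ hz n hn)
  by_cases hex : ∃ k, z k < 1
  · obtain ⟨n, hn, hmin⟩ : ∃ n, z n < 1 ∧ ∀ k < n, 1 ≤ z k := by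
      classical
      exact ⟨Nat.find hex, Nat.find_spec hex, fun k hk => not_lt.1 (Nat.find_min hex hk)⟩
    rw [← Summable.sum_add_tsum_nat_add' (k := n) ENNReal.summable, two_mul]
    refine add_le_add (hpart n hmin) ?_
    rw [← ENNReal.tsum_geometric]
    refine ENNReal.tsum_le_tsum fun i => ?_
    rw [← ENNReal.rpow_natCast, ← ENNReal.rpow_mul, mul_comm δ, ENNReal.rpow_mul,
      ENNReal.rpow_natCast]
    refine ENNReal.rpow_le_rpow ((min_le_left _ _).trans ?_) hδ.le
    rw [add_comm]
    calc z (n + i) ≤ τ ^ i * z n := geometric_decay hz n i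
      _ ≤ τ ^ i * 1 := by gcongr
      _ = τ ^ i := mul_one _
  · push Not at hex
    rw [ENNReal.tsum_eq_iSup_nat]
    refine iSup_le fun n => (hpart n fun k _ => hex k).trans ?_
    rw [two_mul]; exact le_self_add

/-- The constant of the geometric sums below. -/
noncomputable def geomConst (τ : ℝ≥0∞) (δ : ℝ) : ℝ≥0∞ := 2 * (1 - τ ^ δ)⁻¹

lemma geomConst_ne_top (hδ : 0 < δ) (hτ : τ < 1) : geomConst τ δ ≠ ∞ := by
  refine ENNReal.mul_ne_top (by simp) (ENNReal.inv_ne_top.2 ?_)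
  exact (tsub_pos_of_lt (ENNReal.rpow_lt_one hτ hδ)).ne'

lemma one_le_geomConst : 1 ≤ geomConst τ δ :=
  one_le_mul one_le_two (ENNReal.one_le_inv.2 tsub_le_self)

lemma tsum_min_div_rpow_le (hδ : 0 < δ) (hm : ∀ k, m (k + 1) ≤ τ * m k) (T : ℝ≥0∞) :
    ∑' k, min (m k / T) (m k / T)⁻¹ ^ δ ≤ geomConst τ δ :=
  tsum_min_rpow_le hδ fun k => by
    rw [div_eq_mul_inv, div_eq_mul_inv, ← mul_assoc]; gcongr; exact hm k

/-- Geometric sums over the indices with `b ≤ m k`. -/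
lemma tsum_rpow_neg_le (hδ : 0 < δ) (hm : ∀ k, m (k + 1) ≤ τ * m k) {b : ℝ≥0∞} (hb0 : b ≠ 0)
    (hbt : b ≠ ∞) (hmt : ∀ k, m k ≠ ∞) {γ : ℝ} (hγ : δ ≤ γ) :
    ∑' k, (if b ≤ m k then m k ^ (-γ) else 0) ≤ geomConst τ δ * b ^ (-γ) := by
  refine le_trans ?_ (mul_le_mul_left (tsum_min_div_rpow_le hδ hm b) _)
  rw [← ENNReal.tsum_mul_right]
  refine ENNReal.tsum_le_tsum fun k => ?_
  split_ifs with h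
  · have hz1 : 1 ≤ m k / b := (ENNReal.le_div_iff_mul_le (Or.inl hb0) (Or.inl hbt)).2 (by simpa)
    have hz2 : (m k / b)⁻¹ ≤ 1 := ENNReal.inv_le_one.2 hz1
    rw [min_eq_right (hz2.trans hz1)]
    have h3 : m k = m k / b * b := (ENNReal.div_mul_cancel hb0 hbt).symm
    have h4 : m k / b ≠ ∞ := ENNReal.div_ne_top (hmt k) hb0
    calc m k ^ (-γ) = (m k / b * b) ^ (-γ) := by rw [← h3]
      _ = (m k / b) ^ (-γ) * b ^ (-γ) := ENNReal.mul_rpow_of_ne_top h4 hbt _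
      _ = (m k / b)⁻¹ ^ γ * b ^ (-γ) := by rw [ENNReal.rpow_neg, ENNReal.inv_rpow]
      _ ≤ (m k / b)⁻¹ ^ δ * b ^ (-γ) := by
        gcongr ?_ * _
        exact ENNReal.rpow_le_rpow_of_exponent_ge hz2 hγ
  · exact zero_le

/-- Hedberg's trick: the bound `M` is used at the small scales and `m k ^ (-β) * N` at the large
ones. -/
lemma tsum_hedberg (hδ : 0 < δ) (hm : ∀ k, m (k + 1) ≤ τ * m k) (hm0 : ∀ k, m k ≠ 0)
    (hmt : ∀ k, m k ≠ ∞) {α β : ℝ} (hα : δ ≤ α) (hβ : δ ≤ β - α) {a : ℕ → ℝ≥0∞}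
    {M N : ℝ≥0∞} (haM : ∀ k, a k ≤ M) (haN : ∀ k, a k ≤ m k ^ (-β) * N) :
    ∑' k, m k ^ α * a k ≤ geomConst τ δ * (M ^ (1 - α / β) * N ^ (α / β)) := by
  have hα0 : 0 < α := hδ.trans_le hα
  have hβ0 : 0 < β := by linarith
  have hu : 0 < α / β := by positivity
  have hu1 : 0 < 1 - α / β := by rw [sub_pos, div_lt_one hβ0]; linarith
  have hg0 : geomConst τ δ ≠ 0 := (zero_lt_one.trans_le one_le_geomConst).ne'
  rcases eq_or_ne M 0 with rfl | hM0
  · have : ∀ k, a k = 0 := fun k => nonpos_iff_eq_zero.1 (haM k)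
    simp [this]
  rcases eq_or_ne N 0 with rfl | hN0
  · have : ∀ k, a k = 0 := fun k => nonpos_iff_eq_zero.1 ((haN k).trans (by simp))
    simp [this]
  rcases eq_or_ne M ∞ with rfl | hMt
  · rw [ENNReal.top_rpow_of_pos hu1, ENNReal.top_mul (by simp [hN0, hu.not_gt]),
      ENNReal.mul_top hg0]
    exact le_top
  rcases eq_or_ne N ∞ with rfl | hNt
  · rw [ENNReal.top_rpow_of_pos hu, ENNReal.mul_top (by simp [hM0, hMt]),
      ENNReal.mul_top hg0]
    exact le_top
  -- The threshold scale `T`, at which the two bounds agree.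
  set T := (N / M) ^ (1 / β) with hT
  have hNM0 : N / M ≠ 0 := by simp [ENNReal.div_eq_zero_iff, hN0, hMt]
  have hNMt : N / M ≠ ∞ := ENNReal.div_ne_top hNt hM0
  have hT0 : T ≠ 0 := by simp [hT, hNM0, hNMt]
  have hTt : T ≠ ∞ := ENNReal.rpow_ne_top_of_nonneg (by positivity) hNMt
  have hN : N = M * T ^ β := by
    rw [hT, ← ENNReal.rpow_mul, one_div_mul_cancel hβ0.ne', ENNReal.rpow_one,
      ENNReal.mul_div_cancel hM0 hMt]
  have hX : M ^ (1 - α / β) * N ^ (α / β) = M * T ^ α := by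
    rw [hN, ENNReal.mul_rpow_of_nonneg _ _ hu.le, ← ENNReal.rpow_mul, mul_div_cancel₀ _ hβ0.ne',
      ← mul_assoc, ← ENNReal.rpow_add _ _ hM0 hMt, sub_add_cancel, ENNReal.rpow_one]
  rw [hX]
  refine le_trans ?_ (mul_le_mul_left (tsum_min_div_rpow_le hδ hm T) _)
  rw [← ENNReal.tsum_mul_right]
  refine ENNReal.tsum_le_tsum fun k => ?_
  set w := m k / T with hw
  have hw0 : w ≠ 0 := by simp [hw, ENNReal.div_eq_zero_iff, hm0 k, hTt]
  have hwt : w ≠ ∞ := ENNReal.div_ne_top (hmt k) hT0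
  have hmk : m k = w * T := (ENNReal.div_mul_cancel hT0 hTt).symm
  rcases le_total w 1 with h | h
  · rw [min_eq_left (h.trans (ENNReal.one_le_inv.2 h))]
    calc m k ^ α * a k ≤ (w * T) ^ α * M := by rw [hmk]; gcongr; exact haM k
      _ = w ^ α * (M * T ^ α) := by rw [ENNReal.mul_rpow_of_nonneg _ _ hα0.le]; ring
      _ ≤ w ^ δ * (M * T ^ α) := by
        gcongr ?_ * _
        exact ENNReal.rpow_le_rpow_of_exponent_ge h hα
  · rw [min_eq_right ((ENNReal.inv_le_one.2 h).trans h)]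
    calc m k ^ α * a k ≤ (w * T) ^ α * ((w * T) ^ (-β) * (M * T ^ β)) := by
          rw [← hmk, ← hN]; gcongr; exact haN k
      _ = w ^ (α - β) * (M * T ^ α) := by
          rw [ENNReal.mul_rpow_of_ne_top hwt hTt, ENNReal.mul_rpow_of_ne_top hwt hTt,
            sub_eq_add_neg, ENNReal.rpow_add _ _ hw0 hwt]
          have : T ^ (-β) * T ^ β = 1 := by
            rw [← ENNReal.rpow_add _ _ hT0 hTt, neg_add_cancel, ENNReal.rpow_zero]
          calc w ^ α * T ^ α * (w ^ (-β) * T ^ (-β) * (M * T ^ β))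
              = w ^ α * w ^ (-β) * (M * T ^ α) * (T ^ (-β) * T ^ β) := by ring
            _ = _ := by rw [this, mul_one]
      _ = w⁻¹ ^ (β - α) * (M * T ^ α) := by
          rw [← neg_sub, ENNReal.rpow_neg, ENNReal.inv_rpow]
      _ ≤ w⁻¹ ^ δ * (M * T ^ α) := by
          gcongr ?_ * _
          exact ENNReal.rpow_le_rpow_of_exponent_ge (ENNReal.inv_le_one.2 h) hβ

end Sequences

section Potential

variable {X : Type*} [MeasurableSpace X]

/-- The radii `R₀ E⁻ᵏ` at which potentials are discretized. -/
noncomputable def rad (R₀ E : ℝ) (k : ℕ) : ℝ := R₀ / E ^ k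

/-- The discretized potential `∑ₖ μ(B(x, rₖ))^{α-1} ∫_{B(x, Λ rₖ)} g`, with `rₖ = R₀ E⁻ᵏ`. -/
noncomputable def dyPot (d : X → X → ℝ) (μ : Measure X) (R₀ E Λ α : ℝ) (g : X → ℝ≥0∞) (x : X) :
    ℝ≥0∞ :=
  ∑' k, μ (qball d x (rad R₀ E k)) ^ (α - 1) * ∫⁻ y in qball d x (Λ * rad R₀ E k), g y ∂μ

variable {d : X → X → ℝ} {μ : Measure X} {K R₀ E : ℝ} {A τ : ℝ≥0∞}

namespace HomSpace

variable (H : HomSpace d μ K R₀ E A τ)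
include H

lemma E_pos : 0 < E := two_pos.trans_le H.two_le_E

lemma rad_pos (k : ℕ) : 0 < rad R₀ E k := div_pos H.R₀_pos (pow_pos H.E_pos k)

lemma rad_le (k : ℕ) : rad R₀ E k ≤ R₀ :=
  div_le_self H.R₀_pos.le (one_le_pow₀ (one_le_two.trans H.two_le_E))

omit [MeasurableSpace X] H in
lemma rad_succ (k : ℕ) : rad R₀ E (k + 1) = rad R₀ E k / E := by
  rw [rad, rad, pow_succ, div_div]

lemma rad_eq (k : ℕ) : rad R₀ E k = E * rad R₀ E (k + 1) := by
  rw [rad_succ, mul_div_cancel₀ _ H.E_pos.ne']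

lemma measure_rad_succ_le (x : X) (k : ℕ) :
    μ (qball d x (rad R₀ E (k + 1))) ≤ τ * μ (qball d x (rad R₀ E k)) := by
  rw [rad_succ]; exact H.reverse x _ (H.rad_pos k) (H.rad_le k)

/-- Every positive distance lies between two consecutive radii. -/
lemma exists_rad_le_lt {t : ℝ} (ht : 0 < t) (htR : t < R₀) :
    ∃ k, rad R₀ E (k + 1) ≤ t ∧ t < rad R₀ E k := by
  have hE1 : 1 < E := by linarith [H.two_le_E]
  have hex : ∃ k, rad R₀ E k ≤ t := by
    obtain ⟨k, hk⟩ := pow_unbounded_of_one_lt (R₀ / t) hE1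
    refine ⟨k, ?_⟩
    rw [div_lt_iff₀ ht] at hk
    rw [rad, div_le_iff₀ (pow_pos H.E_pos k), mul_comm]
    exact hk.le
  classical
  have hspec := Nat.find_spec hex
  obtain ⟨n, hn⟩ : ∃ n, Nat.find hex = n + 1 := Nat.exists_eq_succ_of_ne_zero fun h => by
    rw [h, rad, pow_zero, div_one] at hspec
    linarith
  rw [hn] at hspec
  exact ⟨n, hspec, not_le.1 (Nat.find_min hex (by omega))⟩

lemma dist_pos {x y : X} (h : x ≠ y) : 0 < d x y :=
  lt_of_le_of_ne (H.nonneg x y) fun h0 => h (H.eq_of_zero x y h0.symm)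

variable [IsFiniteMeasure μ]

lemma measurable_dyPot (Λ α : ℝ) {g : X → ℝ≥0∞} (hg : Measurable g) :
    Measurable (dyPot d μ R₀ E Λ α g) :=
  Measurable.tsum fun _ =>
    ((H.measurable_measure_ball measurable_id measurable_const).pow_const _).mul
      (H.measurable_setLIntegral_ball (g := fun _ y => g y) (hg.comp measurable_snd) _)

/-- The potential is dominated by its discretization. -/
lemma exists_lintegral_potential_le {α : ℝ} (hα : α < 1) : ∃ C : ℝ≥0∞, C ≠ ∞ ∧
    ∀ f : X → ℝ, Measurable f → ∀ x, ∫⁻ y, ‖potentialIntegrand d μ α f x y‖ₑ ∂μ ≤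
      C * dyPot d μ R₀ E 1 α (fun y => ‖f y‖ₑ) x := by
  obtain ⟨C, hC, hC1, hcomp⟩ := H.exists_compar E
  have hα' : 0 ≤ 1 - α := by linarith
  refine ⟨C ^ (1 - α), ENNReal.rpow_ne_top_of_nonneg hα' hC, fun f hf x => ?_⟩
  have hpt : ∀ y, ‖potentialIntegrand d μ α f x y‖ₑ ≤ ∑' k, C ^ (1 - α) *
      (μ (qball d x (rad R₀ E k)) ^ (α - 1) *
        (qball d x (rad R₀ E k)).indicator (fun y => ‖f y‖ₑ) y) := by
    intro y
    by_cases hxy : x = y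
    · -- On the diagonal the ball is empty and the integrand vanishes.
      have h0 : qball d x (d x y) = ∅ := by
        ext z
        rw [mem_qball, ← hxy, H.self]
        simpa using H.nonneg x z
      rw [potentialIntegrand, h0]
      simp [Real.zero_rpow (by linarith : (1 - α) ≠ 0)]
    · have hd := H.dist_pos hxy
      obtain ⟨k, hk1, hk2⟩ := H.exists_rad_le_lt hd (H.lt_diam x y)
      refine le_trans ?_ (ENNReal.le_tsum k)
      rw [indicator_of_mem (show y ∈ qball d x (rad R₀ E k) from hk2)]
      set v := μ (qball d x (d x y)) with hv
      have hv0 : v ≠ 0 := H.ball_ne_zero x hd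
      have hvt : v ≠ ∞ := measure_ne_top _ _
      set m := μ (qball d x (rad R₀ E k)) with hm
      have hm0 : m ≠ 0 := H.ball_ne_zero x (H.rad_pos k)
      have hmt : m ≠ ∞ := measure_ne_top _ _
      have hmv : m ≤ C * v := by
        rw [hm, H.rad_eq]
        refine (hcomp x x _ (H.rad_pos _) ?_).trans ?_
        · rw [H.self]; exact mul_pos H.E_pos (H.rad_pos _)
        · gcongr; exact measure_mono (qball_mono hk1)
      have hreal : 0 < μ.real (qball d x (d x y)) := ENNReal.toReal_pos hv0 hvt
      have h1 : ‖potentialIntegrand d μ α f x y‖ₑ = ‖f y‖ₑ * v ^ (α - 1) := by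
        rw [potentialIntegrand, div_eq_mul_inv, ← Real.rpow_neg hreal.le, enorm_mul,
          Real.enorm_of_nonneg (Real.rpow_nonneg hreal.le _), ← ENNReal.ofReal_rpow_of_pos hreal,
          neg_sub, ofReal_measureReal]
      rw [h1, mul_comm, ← mul_assoc]
      gcongr
      rw [← neg_sub, ENNReal.rpow_neg, ENNReal.rpow_neg, ← div_eq_mul_inv]
      rw [ENNReal.le_div_iff_mul_le (Or.inl (by simp [hm0, hmt])) (Or.inl (by
        exact ENNReal.rpow_ne_top_of_nonneg hα' hmt)), mul_comm, ← div_eq_mul_inv]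
      refine ENNReal.div_le_of_le_mul ?_
      rw [← ENNReal.mul_rpow_of_nonneg _ _ hα']
      gcongr
  calc ∫⁻ y, ‖potentialIntegrand d μ α f x y‖ₑ ∂μ
      ≤ ∫⁻ y, ∑' k, C ^ (1 - α) * (μ (qball d x (rad R₀ E k)) ^ (α - 1) *
        (qball d x (rad R₀ E k)).indicator (fun y => ‖f y‖ₑ) y) ∂μ := lintegral_mono hpt
    _ = C ^ (1 - α) * dyPot d μ R₀ E 1 α (fun y => ‖f y‖ₑ) x := by
      rw [lintegral_tsum fun k => by
        have := (hf.enorm.indicator (H.measurableSet_ball x (rad R₀ E k))).aemeasurable (μ := μ)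
        exact (this.const_mul _).const_mul _]
      rw [dyPot, ← ENNReal.tsum_mul_left]
      congr 1
      funext k
      have := hf.enorm.indicator (H.measurableSet_ball x (rad R₀ E k))
      rw [lintegral_const_mul _ (this.const_mul _), lintegral_const_mul _ this,
        lintegral_indicator (H.measurableSet_ball x _), one_mul]

end HomSpace

end Potential

/-! ### Oscillation and power parts of the commutator -/

lemma rpow_neg_le_of_le_mul {u v C : ℝ≥0∞} {γ : ℝ} (hγ : 0 ≤ γ) (hγ1 : γ ≤ 1) (hC : 1 ≤ C)
    (hCt : C ≠ ∞) (h : u ≤ C * v) : v ^ (-γ) ≤ C * u ^ (-γ) := by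
  have hC0 : C ^ γ ≠ 0 := by
    have : C ≠ 0 := (zero_lt_one.trans_le hC).ne'
    simp [this, hCt]
  have hCt' : C ^ γ ≠ ∞ := ENNReal.rpow_ne_top_of_nonneg hγ hCt
  rw [ENNReal.rpow_neg, ENNReal.rpow_neg]
  calc (v ^ γ)⁻¹ = C ^ γ * (C ^ γ * v ^ γ)⁻¹ := by
        rw [ENNReal.mul_inv (Or.inl hC0) (Or.inl hCt'), ← mul_assoc,
          ENNReal.mul_inv_cancel hC0 hCt', one_mul]
    _ ≤ C * (u ^ γ)⁻¹ := by
        gcongr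
        · exact rpow_le_self_of_one_le hC hγ1
        · rw [← ENNReal.mul_rpow_of_nonneg _ _ hγ]; gcongr

section Duality

variable {X : Type*} [MeasurableSpace X] {μ : Measure X}

/-- The converse of Hölder's inequality on a finite measure space. -/
lemma setLIntegral_rpow_le_of_dual [IsFiniteMeasure μ] {F : X → ℝ≥0∞} (hF : Measurable F)
    {B : Set X} (hB : MeasurableSet B) {q q' : ℝ} (hq : q.HolderConjugate q') {Q : ℝ≥0∞}
    (hdual : ∀ h : X → ℝ≥0∞, Measurable h → (∀ x, x ∉ B → h x = 0) →
      ∫⁻ x, h x * F x ∂μ ≤ Q * (∫⁻ x, h x ^ q' ∂μ) ^ (1 / q')) :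
    ∫⁻ x in B, F x ^ q ∂μ ≤ Q ^ q := by
  have hq0 : 0 < q := hq.pos
  have hq1 : 0 < q - 1 := hq.sub_one_pos
  -- Truncations of `F`, which have finite integrals.
  set G : ℕ → X → ℝ≥0∞ := fun n => B.indicator fun x => min (F x) n with hG
  have hGm : ∀ n, Measurable (G n) := fun n => (hF.min measurable_const).indicator hB
  have hGF : ∀ n x, G n x ≤ F x := fun n x => by
    by_cases hx : x ∈ B
    · simp [hG, hx]
    · simp [hG, hx]
  have hGn : ∀ n x, G n x ≤ n := fun n x => by
    by_cases hx : x ∈ B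
    · simp [hG, hx]
    · simp [hG, hx]
  have hbound : ∀ n, ∫⁻ x, G n x ^ q ∂μ ≤ Q ^ q := by
    intro n
    set I := ∫⁻ x, G n x ^ q ∂μ with hI
    have hIt : I ≠ ∞ := by
      refine ne_top_of_le_ne_top ?_ (lintegral_mono fun x => ENNReal.rpow_le_rpow (hGn n x) hq0.le)
      rw [lintegral_const]
      exact ENNReal.mul_ne_top (ENNReal.rpow_ne_top_of_nonneg hq0.le (by simp)) (measure_ne_top _ _)
    rcases eq_or_ne I 0 with h0 | h0
    · rw [h0]; exact zero_le
    have h1 : I ≤ Q * I ^ (1 / q') := by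
      have h2 := hdual (fun x => G n x ^ (q - 1)) ((hGm n).pow_const _) (fun x hx => by
        simp [hG, hx, hq1])
      have h3 : ∀ x, (G n x ^ (q - 1)) ^ q' = G n x ^ q := fun x => by
        rw [← ENNReal.rpow_mul, hq.sub_one_mul_conj]
      simp_rw [h3] at h2
      refine le_trans (lintegral_mono fun x => ?_) h2
      calc G n x ^ q = G n x ^ (q - 1) * G n x ^ (1 : ℝ) := by
            rw [← ENNReal.rpow_add_of_nonneg _ _ hq1.le zero_le_one, sub_add_cancel]
        _ ≤ G n x ^ (q - 1) * F x := by rw [ENNReal.rpow_one]; gcongr; exact hGF n x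
    have h4 : I ^ (1 / q) * I ^ (1 / q') = I := by
      rw [← ENNReal.rpow_add _ _ h0 hIt, one_div, one_div, hq.inv_add_inv_eq_one, ENNReal.rpow_one]
    have h5 : I ^ (1 / q) ≤ Q := by
      have h6 : I ^ (1 / q') ≠ 0 := by simp [h0, hIt]
      have h7 : I ^ (1 / q') ≠ ∞ :=
        ENNReal.rpow_ne_top_of_nonneg (one_div_nonneg.2 hq.symm.nonneg) hIt
      refine (ENNReal.mul_le_mul_iff_left h6 h7).1 ?_
      rw [h4]; exact h1
    calc I = (I ^ (1 / q)) ^ q := by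
          rw [← ENNReal.rpow_mul, one_div_mul_cancel hq0.ne', ENNReal.rpow_one]
      _ ≤ Q ^ q := ENNReal.rpow_le_rpow h5 hq0.le
  have hlim : ∫⁻ x in B, F x ^ q ∂μ = ⨆ n, ∫⁻ x, G n x ^ q ∂μ := by
    rw [← lintegral_iSup (fun n => (hGm n).pow_const q), ← lintegral_indicator hB]
    · refine lintegral_congr fun x => ?_
      by_cases hx : x ∈ B
      · simp only [hG, hx, indicator_of_mem]
        refine le_antisymm ?_ (iSup_le fun n => ENNReal.rpow_le_rpow (min_le_left _ _) hq0.le)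
        rcases eq_or_ne (F x) ∞ with ht | ht
        · rw [ht, ENNReal.top_rpow_of_pos hq0]
          refine le_of_forall_lt fun c hc => ?_
          obtain ⟨n, hn⟩ := ENNReal.exists_nat_gt
            (ENNReal.rpow_ne_top_of_nonneg (y := q⁻¹) (by positivity) hc.ne)
          refine lt_of_lt_of_le ?_ (le_iSup (fun n : ℕ => min ∞ (n : ℝ≥0∞) ^ q) n)
          rw [min_eq_right le_top]
          calc c = (c ^ q⁻¹) ^ q := by
                rw [← ENNReal.rpow_mul, inv_mul_cancel₀ hq0.ne', ENNReal.rpow_one]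
            _ < _ := ENNReal.rpow_lt_rpow hn hq0
        · obtain ⟨n, hn⟩ := ENNReal.exists_nat_gt ht
          refine le_trans ?_ (le_iSup (fun n : ℕ => min (F x) (n : ℝ≥0∞) ^ q) n)
          rw [min_eq_left hn.le]
      · simp [hG, hx, hq0]
    · intro m n hmn x
      by_cases hx : x ∈ B
      · simp only [hG, hx, indicator_of_mem]
        gcongr
      · simp [hG, hx]
  rw [hlim]
  exact iSup_le hbound

end Duality

section Commutator

variable {X : Type*} [MeasurableSpace X]

/-- The mean oscillation `⨍_{B(x, r)} |b(x) - b(z)| dμ(z)` about the value at the centre. -/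
noncomputable def centreOsc (d : X → X → ℝ) (μ : Measure X) (b : X → ℝ) (r : ℝ) (x : X) : ℝ≥0∞ :=
  ballAvg d μ (fun z => ‖b x - b z‖ₑ) x r

/-- The part of the discretized commutator carrying the oscillation of `b` about `b(x)`. -/
noncomputable def oscPot (d : X → X → ℝ) (μ : Measure X) (R₀ E : ℝ) (b : X → ℝ) (α : ℝ)
    (g : X → ℝ≥0∞) (x : X) : ℝ≥0∞ :=
  ∑' k, μ (qball d x (rad R₀ E k)) ^ (α - 1) *
    (centreOsc d μ b (rad R₀ E k) x * ∫⁻ y in qball d x (rad R₀ E k), g y ∂μ)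

/-- The discretized potential with `L^t` averages in place of averages. -/
noncomputable def powPot (d : X → X → ℝ) (μ : Measure X) (R₀ E t α : ℝ)
    (g : X → ℝ≥0∞) (x : X) : ℝ≥0∞ :=
  ∑' k, μ (qball d x (rad R₀ E k)) ^ α *
    ballAvg d μ (fun y => g y ^ t) x (rad R₀ E k) ^ (1 / t)

/-- The `L^s` oscillations of `b` over balls are bounded by `N^{1/s}`. -/
def OscBound (d : X → X → ℝ) (μ : Measure X) (b : X → ℝ) (s : ℝ) (N : ℝ≥0∞) : Prop :=
  ∀ x r, 0 < r → ∃ c : ℝ, ∫⁻ y in qball d x r, ‖b y - c‖ₑ ^ s ∂μ ≤ N * μ (qball d x r)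

variable {d : X → X → ℝ} {μ : Measure X} {K R₀ E : ℝ} {A τ : ℝ≥0∞}

namespace HomSpace

variable (H : HomSpace d μ K R₀ E A τ) [IsFiniteMeasure μ]
include H

lemma measurable_centreOsc {b : X → ℝ} (hb : Measurable b) (r : ℝ) :
    Measurable (centreOsc d μ b r) :=
  (H.measurable_setLIntegral_ball (g := fun x z => ‖b x - b z‖ₑ)
    ((hb.comp measurable_fst).sub (hb.comp measurable_snd)).enorm r).div
    (H.measurable_measure_ball measurable_id measurable_const)

lemma measurable_setLIntegral_ball_const {g : X → ℝ≥0∞} (hg : Measurable g) (r : ℝ) :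
    Measurable fun x => ∫⁻ y in qball d x r, g y ∂μ :=
  H.measurable_setLIntegral_ball (g := fun _ y => g y) (hg.comp measurable_snd) r

lemma measurable_measure_ball_const (r : ℝ) : Measurable fun x => μ (qball d x r) :=
  H.measurable_measure_ball measurable_id measurable_const

lemma measurable_oscPot {b : X → ℝ} (hb : Measurable b) (α : ℝ) {g : X → ℝ≥0∞}
    (hg : Measurable g) : Measurable (oscPot d μ R₀ E b α g) :=
  Measurable.tsum fun _ => ((H.measurable_measure_ball_const _).pow_const _).mul
    ((H.measurable_centreOsc hb _).mul (H.measurable_setLIntegral_ball_const hg _))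

lemma measurable_powPot (t α : ℝ) {g : X → ℝ≥0∞}
    (hg : Measurable g) : Measurable (powPot d μ R₀ E t α g) :=
  Measurable.tsum fun _ => ((H.measurable_measure_ball_const _).pow_const _).mul
    ((H.measurable_ballAvg (hg.pow_const t) _).pow_const _)

lemma lintegral_ball_eq (g : X → ℝ≥0∞) (x : X) {r : ℝ} (hr : 0 < r) :
    ∫⁻ y in qball d x r, g y ∂μ = μ (qball d x r) * ballAvg d μ g x r :=
  (ENNReal.mul_div_cancel (H.ball_ne_zero x hr) (measure_ne_top _ _)).symm

omit H in
lemma lintegral_osc_le {b : X → ℝ} (hb : Measurable b) {s : ℝ} {N : ℝ≥0∞} (hs : 1 ≤ s)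
    (hN1 : 1 ≤ N) {c : ℝ} {B : Set X} (hB0 : μ B ≠ 0)
    (hc : ∫⁻ y in B, ‖b y - c‖ₑ ^ s ∂μ ≤ N * μ B) :
    ∫⁻ y in B, ‖b y - c‖ₑ ∂μ ≤ N * μ B := by
  have hBt : μ B ≠ ∞ := measure_ne_top _ _
  have hs0 : 0 < s := by linarith
  have h := lintegral_rpow_le_of_le (ν := μ.restrict B) one_pos hs
    (hb.sub_const c).enorm.aemeasurable
  simp only [ENNReal.rpow_one, div_one, Measure.restrict_apply_univ] at h
  calc ∫⁻ y in B, ‖b y - c‖ₑ ∂μ ≤ (N * μ B) ^ (1 / s) * μ B ^ (1 - 1 / s) := by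
        refine h.trans ?_
        gcongr
    _ = N ^ (1 / s) * μ B := by
        rw [ENNReal.mul_rpow_of_nonneg _ _ (by positivity), mul_assoc,
          ← ENNReal.rpow_add _ _ hB0 hBt, add_sub_cancel, ENNReal.rpow_one]
    _ ≤ N * μ B := by
        gcongr
        exact rpow_le_self_of_one_le hN1 (by rw [div_le_one hs0]; exact hs)

/-- Splitting of a single scale of the commutator. -/
lemma lintegral_comm_le {b : X → ℝ} (hb : Measurable b) {s t : ℝ} (hst : s.HolderConjugate t)
    {N : ℝ≥0∞} (hN1 : 1 ≤ N) (hosc : OscBound d μ b s N) {g : X → ℝ≥0∞} (hg : Measurable g)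
    (x : X) {r : ℝ} (hr : 0 < r) :
    ∫⁻ y in qball d x r, ‖b x - b y‖ₑ * g y ∂μ ≤
      centreOsc d μ b r x * ∫⁻ y in qball d x r, g y ∂μ +
        2 * N * (μ (qball d x r) * ballAvg d μ (fun y => g y ^ t) x r ^ (1 / t)) := by
  obtain ⟨c, hc⟩ := hosc x r hr
  set m := μ (qball d x r) with hm
  have hm0 : m ≠ 0 := H.ball_ne_zero x hr
  have hmt : m ≠ ∞ := measure_ne_top _ _
  have hs0 := hst.pos
  have ht0 := hst.symm.pos
  have hL1 := lintegral_osc_le hb hst.lt.le hN1 hm0 hc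
  have hbc : Measurable fun y => ‖b y - c‖ₑ := (hb.sub_const c).enorm
  have hxc : ‖b x - c‖ₑ ≤ centreOsc d μ b r x + N := by
    refine (ENNReal.mul_le_mul_iff_left hm0 hmt).1 ?_
    calc ‖b x - c‖ₑ * m = ∫⁻ z in qball d x r, ‖b x - c‖ₑ ∂μ := by rw [setLIntegral_const]
      _ ≤ ∫⁻ z in qball d x r, (‖b x - b z‖ₑ + ‖b z - c‖ₑ) ∂μ := by
        refine lintegral_mono fun z => ?_
        calc ‖b x - c‖ₑ = ‖(b x - b z) + (b z - c)‖ₑ := by ring_nf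
          _ ≤ _ := enorm_add_le _ _
      _ = ∫⁻ z in qball d x r, ‖b x - b z‖ₑ ∂μ + ∫⁻ z in qball d x r, ‖b z - c‖ₑ ∂μ :=
        lintegral_add_right _ hbc
      _ ≤ centreOsc d μ b r x * m + N * m := by
        refine add_le_add ?_ hL1
        rw [H.lintegral_ball_eq _ x hr, mul_comm]
        rfl
      _ = _ := by rw [add_mul]
  set Av := ballAvg d μ (fun y => g y ^ t) x r ^ (1 / t) with hAv
  have hgt : (∫⁻ y in qball d x r, g y ^ t ∂μ) ^ (1 / t) = m ^ (1 / t) * Av := by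
    rw [H.lintegral_ball_eq _ x hr, ENNReal.mul_rpow_of_nonneg _ _ (by positivity)]
  have hg1 : ∫⁻ y in qball d x r, g y ∂μ ≤ m * Av := by
    have h := lintegral_rpow_le_of_le (ν := μ.restrict (qball d x r)) one_pos hst.symm.lt.le
      hg.aemeasurable
    simp only [ENNReal.rpow_one, div_one, Measure.restrict_apply_univ] at h
    refine h.trans (le_of_eq ?_)
    rw [hgt, mul_right_comm, ← ENNReal.rpow_add _ _ hm0 hmt, add_sub_cancel, ENNReal.rpow_one]
  have hg2 : ∫⁻ y in qball d x r, ‖b y - c‖ₑ * g y ∂μ ≤ N * (m * Av) := by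
    calc ∫⁻ y in qball d x r, ‖b y - c‖ₑ * g y ∂μ
        ≤ (∫⁻ y in qball d x r, ‖b y - c‖ₑ ^ s ∂μ) ^ (1 / s) *
          (∫⁻ y in qball d x r, g y ^ t ∂μ) ^ (1 / t) :=
          ENNReal.lintegral_mul_le_Lp_mul_Lq _ hst hbc.aemeasurable hg.aemeasurable
      _ ≤ (N * m) ^ (1 / s) * (m ^ (1 / t) * Av) := by rw [hgt]; gcongr
      _ = N ^ (1 / s) * (m * Av) := by
          have : m = m ^ (1 / s) * m ^ (1 / t) := by
            rw [← ENNReal.rpow_add _ _ hm0 hmt, one_div, one_div, hst.inv_add_inv_eq_one,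
              ENNReal.rpow_one]
          rw [ENNReal.mul_rpow_of_nonneg _ _ (by positivity)]
          conv_rhs => rw [this]
          ring
      _ ≤ N * (m * Av) := by
          gcongr
          refine rpow_le_self_of_one_le hN1 ?_
          rw [div_le_one hs0]; exact hst.lt.le
  calc ∫⁻ y in qball d x r, ‖b x - b y‖ₑ * g y ∂μ
      ≤ ∫⁻ y in qball d x r, (‖b x - c‖ₑ * g y + ‖b y - c‖ₑ * g y) ∂μ := by
        refine lintegral_mono fun y => ?_
        rw [← add_mul]
        gcongr
        calc ‖b x - b y‖ₑ = ‖(b x - c) - (b y - c)‖ₑ := by ring_nf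
          _ ≤ _ := enorm_sub_le
    _ = ‖b x - c‖ₑ * ∫⁻ y in qball d x r, g y ∂μ +
        ∫⁻ y in qball d x r, ‖b y - c‖ₑ * g y ∂μ := by
        rw [lintegral_add_left (hg.const_mul _), lintegral_const_mul _ hg]
    _ ≤ (centreOsc d μ b r x + N) * ∫⁻ y in qball d x r, g y ∂μ + N * (m * Av) := by gcongr
    _ ≤ centreOsc d μ b r x * ∫⁻ y in qball d x r, g y ∂μ + N * (m * Av) + N * (m * Av) := by
        rw [add_mul]; gcongr
    _ = _ := by ring

lemma dyPot_comm_le {b : X → ℝ} (hb : Measurable b) {s t : ℝ} (hst : s.HolderConjugate t)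
    {N : ℝ≥0∞} (hN1 : 1 ≤ N) (hosc : OscBound d μ b s N) {g : X → ℝ≥0∞} (hg : Measurable g)
    (α : ℝ) (x : X) :
    dyPot d μ R₀ E 1 α (fun y => ‖b x - b y‖ₑ * g y) x ≤
      oscPot d μ R₀ E b α g x + 2 * N * powPot d μ R₀ E t α g x := by
  rw [dyPot, oscPot, powPot, ← ENNReal.tsum_mul_left, ← ENNReal.tsum_add]
  refine ENNReal.tsum_le_tsum fun k => ?_
  rw [one_mul]
  set m := μ (qball d x (rad R₀ E k)) with hm
  have hm0 : m ≠ 0 := H.ball_ne_zero x (H.rad_pos k)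
  have hmt : m ≠ ∞ := measure_ne_top _ _
  have h1 : m ^ α = m ^ (α - 1) * m := by
    conv_rhs => rw [← ENNReal.rpow_one m, ← ENNReal.rpow_mul, one_mul]
    rw [← ENNReal.rpow_add _ _ hm0 hmt, sub_add_cancel]
  refine (mul_le_mul_right (H.lintegral_comm_le hb hst hN1 hosc hg x (H.rad_pos k)) _).trans
    (le_of_eq ?_)
  rw [h1]
  ring

/-- The `L^s` norms over balls of the oscillations about the centre. -/
lemma exists_lintegral_centreOsc_le {b : X → ℝ} (hb : Measurable b) {s : ℝ} (hs : 1 ≤ s)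
    {N : ℝ≥0∞} (hN1 : 1 ≤ N) (hNt : N ≠ ∞) (hosc : OscBound d μ b s N) {Λ : ℝ} (hΛ : 1 ≤ Λ) :
    ∃ C : ℝ≥0∞, C ≠ ∞ ∧ 1 ≤ C ∧ ∀ y r, 0 < r →
      ∫⁻ x in qball d y (Λ * r), centreOsc d μ b r x ^ s ∂μ ≤ C * μ (qball d y r) := by
  have hK := H.one_le_K
  have hs0 : 0 < s := by linarith
  set Λ' := 2 * K * Λ with hΛ'
  have hΛΛ' : Λ ≤ Λ' := by nlinarith
  obtain ⟨C₁, hC₁, hC₁1, hcomp⟩ := H.exists_compar Λ'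
  obtain ⟨C₂, hC₂, hC₂1, hcomp₂⟩ := H.exists_compar (K * Λ')
  refine ⟨2 ^ s * (N * C₁ + (N * C₁ * C₂) ^ s * C₁), ?_, ?_, fun y r hr => ?_⟩
  · refine ENNReal.mul_ne_top (ENNReal.rpow_ne_top_of_nonneg hs0.le (by simp))
      (ENNReal.add_ne_top.2 ⟨ENNReal.mul_ne_top hNt hC₁, ENNReal.mul_ne_top
        (ENNReal.rpow_ne_top_of_nonneg hs0.le ?_) hC₁⟩)
    exact ENNReal.mul_ne_top (ENNReal.mul_ne_top hNt hC₁) hC₂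
  · exact one_le_mul (ENNReal.one_le_rpow one_le_two hs0)
      ((one_le_mul hN1 hC₁1).trans le_self_add)
  have hr' : 0 < Λ' * r := by positivity
  obtain ⟨c, hc⟩ := hosc y (Λ' * r) hr'
  have hself : d y y < Λ' * r := by rw [H.self]; exact hr'
  have hmy : μ (qball d y (Λ' * r)) ≤ C₁ * μ (qball d y r) := hcomp y y r hr hself
  have hL1 := lintegral_osc_le hb hs hN1 (H.ball_ne_zero y hr') hc
  have hbc : Measurable fun y => ‖b y - c‖ₑ := (hb.sub_const c).enorm
  have hpt : ∀ x ∈ qball d y (Λ * r), centreOsc d μ b r x ≤ ‖b x - c‖ₑ + N * C₁ * C₂ := by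
    intro x hx
    rw [centreOsc, H.ballAvg_le_iff hr]
    have hsub : qball d x r ⊆ qball d y (Λ' * r) := by
      intro z hz
      have := H.tri_lt hx hz
      rw [mem_qball]
      refine this.trans_le ?_
      have : r ≤ Λ * r := le_mul_of_one_le_left hr.le hΛ
      calc K * (Λ * r + r) ≤ K * (Λ * r + Λ * r) := by gcongr
        _ = Λ' * r := by rw [hΛ']; ring
    have hmx : μ (qball d y r) ≤ C₂ * μ (qball d x r) := by
      refine (measure_mono (qball_mono ?_)).trans (hcomp₂ y x r hr ?_)
      · refine le_mul_of_one_le_left hr.le ?_; nlinarith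
      · refine lt_of_lt_of_le hx ?_
        gcongr
        nlinarith
    calc ∫⁻ z in qball d x r, ‖b x - b z‖ₑ ∂μ
        ≤ ∫⁻ z in qball d x r, (‖b x - c‖ₑ + ‖b z - c‖ₑ) ∂μ := by
          refine lintegral_mono fun z => ?_
          calc ‖b x - b z‖ₑ = ‖(b x - c) - (b z - c)‖ₑ := by ring_nf
            _ ≤ _ := enorm_sub_le
      _ = ‖b x - c‖ₑ * μ (qball d x r) + ∫⁻ z in qball d x r, ‖b z - c‖ₑ ∂μ := by
          rw [lintegral_add_left measurable_const, setLIntegral_const]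
      _ ≤ ‖b x - c‖ₑ * μ (qball d x r) + N * (C₁ * (C₂ * μ (qball d x r))) := by
          refine add_le_add le_rfl ((lintegral_mono_set hsub).trans (hL1.trans ?_))
          refine mul_le_mul_right (hmy.trans ?_) _
          exact mul_le_mul_right hmx _
      _ = _ := by ring
  calc ∫⁻ x in qball d y (Λ * r), centreOsc d μ b r x ^ s ∂μ
      ≤ ∫⁻ x in qball d y (Λ * r), (‖b x - c‖ₑ + N * C₁ * C₂) ^ s ∂μ :=
        setLIntegral_mono' (H.measurableSet_ball _ _) fun x hx =>
          ENNReal.rpow_le_rpow (hpt x hx) hs0.le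
    _ ≤ ∫⁻ x in qball d y (Λ' * r), (‖b x - c‖ₑ + N * C₁ * C₂) ^ s ∂μ :=
        lintegral_mono_set (qball_mono (by gcongr))
    _ ≤ 2 ^ s * (N * (C₁ * μ (qball d y r)) + (N * C₁ * C₂) ^ s * (C₁ * μ (qball d y r))) := by
        refine (lintegral_add_rpow_le hs le_rfl hbc.aemeasurable).trans ?_
        rw [setLIntegral_const]
        gcongr
        exact hc.trans (mul_le_mul_right hmy _)
    _ = _ := by ring

/-- One scale of the duality estimate for `oscPot`: the oscillation is transferred from the
operator to the test function `h`, at the price of a maximal function of `h`. -/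
lemma exists_dual_scale {b : X → ℝ} (hb : Measurable b) {s t : ℝ} (hst : s.HolderConjugate t)
    {N : ℝ≥0∞} (hN1 : 1 ≤ N) (hNt : N ≠ ∞) (hosc : OscBound d μ b s N) {α : ℝ} (hα0 : 0 < α)
    (hα1 : α < 1) :
    ∃ C : ℝ≥0∞, C ≠ ∞ ∧ ∀ r, 0 < r → ∀ h f : X → ℝ≥0∞, Measurable h → Measurable f →
      ∫⁻ x, h x * (μ (qball d x r) ^ (α - 1) *
        (centreOsc d μ b r x * ∫⁻ y in qball d x r, f y ∂μ)) ∂μ ≤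
      C * ∫⁻ z, hlMax d μ (R₀ + 1) (fun x => h x ^ t) z ^ (1 / t) *
        (μ (qball d z r) ^ (α - 1) * ∫⁻ y in qball d z (K * r), f y ∂μ) ∂μ := by
  have hK := H.one_le_K
  have hs0 := hst.pos
  have ht0 := hst.symm.pos
  obtain ⟨C₁, hC₁, hC₁1, hcomp₁⟩ := H.exists_compar (K * K)
  obtain ⟨C₂, hC₂, hC₂1, hcomp₂⟩ := H.exists_compar (2 * K ^ 2)
  obtain ⟨C₃, hC₃, hC₃1, hosc₃⟩ := H.exists_lintegral_centreOsc_le hb hst.lt.le hN1 hNt hosc hK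
  refine ⟨C₁ * C₃ * C₂ * C₁, ENNReal.mul_ne_top (ENNReal.mul_ne_top (ENNReal.mul_ne_top hC₁ hC₃)
    hC₂) hC₁, fun r hr h f hh hf => ?_⟩
  set M : X → ℝ≥0∞ := fun z => hlMax d μ (R₀ + 1) (fun x => h x ^ t) z ^ (1 / t) with hM
  have hMm : Measurable M := (H.measurable_hlMax _ (hh.pow_const t)).pow_const _
  have hmm : Measurable fun x => μ (qball d x r) ^ (α - 1) :=
    (H.measurable_measure_ball_const r).pow_const _
  have hom := H.measurable_centreOsc hb r
  have hKr : r ≤ K * K * r := le_mul_of_one_le_left hr.le (by nlinarith)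
  have hcompar : ∀ x y, d x y < K * r →
      μ (qball d y r) ^ (α - 1) ≤ C₁ * μ (qball d x r) ^ (α - 1) := by
    intro x y hxy
    have h1 : μ (qball d x r) ≤ C₁ * μ (qball d y r) :=
      (measure_mono (qball_mono hKr)).trans (hcomp₁ x y r hr (hxy.trans_le (by nlinarith)))
    have := rpow_neg_le_of_le_mul (γ := 1 - α) (by linarith) (by linarith) hC₁1 hC₁ h1
    rwa [neg_sub] at this
  have hsubK : ∀ y, {x | d x y < r} ⊆ qball d y (K * r) := fun y x hx => H.symm_lt hx
  -- Bound for the inner integral after the first exchange of integrals.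
  have hinner : ∀ y, ∫⁻ x in {x | d x y < r}, h x * (μ (qball d x r) ^ (α - 1) *
      (centreOsc d μ b r x * f y)) ∂μ ≤
      C₁ * C₃ * C₂ * (μ (qball d y r) ^ (α - 1) * f y * ∫⁻ z in qball d y r, M z ∂μ) := by
    intro y
    set m := μ (qball d y r) with hm
    have hm0 : m ≠ 0 := H.ball_ne_zero y hr
    have hmt : m ≠ ∞ := measure_ne_top _ _
    set P := (∫⁻ x in qball d y (K * r), h x ^ t ∂μ) ^ (1 / t) with hP
    have h1 : ∫⁻ x in qball d y (K * r), h x * centreOsc d μ b r x ∂μ ≤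
        C₃ * m ^ (1 / s) * P := by
      calc ∫⁻ x in qball d y (K * r), h x * centreOsc d μ b r x ∂μ
          ≤ P * (∫⁻ x in qball d y (K * r), centreOsc d μ b r x ^ s ∂μ) ^ (1 / s) :=
            ENNReal.lintegral_mul_le_Lp_mul_Lq _ hst.symm hh.aemeasurable hom.aemeasurable
        _ ≤ P * (C₃ * m) ^ (1 / s) := by gcongr; exact hosc₃ y r hr
        _ ≤ P * (C₃ * m ^ (1 / s)) := by
            rw [ENNReal.mul_rpow_of_nonneg _ _ (by positivity)]
            gcongr
            refine rpow_le_self_of_one_le hC₃1 ?_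
            rw [div_le_one hs0]; exact hst.lt.le
        _ = _ := by ring
    have h2 : ∀ z ∈ qball d y r, P ≤ C₂ * m ^ (1 / t) * M z := by
      intro z hz
      have hzy := H.symm_lt hz
      have hsub : qball d y (K * r) ⊆ qball d z (2 * K ^ 2 * r) := by
        intro w hw
        have := H.tri_lt hzy hw
        rw [mem_qball]; nlinarith
      have hr2 : 0 < 2 * K ^ 2 * r := by positivity
      have h3 : ∫⁻ x in qball d y (K * r), h x ^ t ∂μ ≤
          C₂ * m * hlMax d μ (R₀ + 1) (fun x => h x ^ t) z := by
        calc ∫⁻ x in qball d y (K * r), h x ^ t ∂μ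
            ≤ ∫⁻ x in qball d z (2 * K ^ 2 * r), h x ^ t ∂μ := lintegral_mono_set hsub
          _ = μ (qball d z (2 * K ^ 2 * r)) *
              ballAvg d μ (fun x => h x ^ t) z (2 * K ^ 2 * r) := H.lintegral_ball_eq _ z hr2
          _ ≤ _ := by
              refine mul_le_mul' (hcomp₂ z y r hr (hzy.trans_le ?_)) (H.ballAvg_le_hlMax _ z hr2)
              nlinarith [H.K_le_sq]
      calc P ≤ (C₂ * m * hlMax d μ (R₀ + 1) (fun x => h x ^ t) z) ^ (1 / t) := by
            rw [hP]; gcongr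
        _ = C₂ ^ (1 / t) * m ^ (1 / t) * M z := by
            rw [ENNReal.mul_rpow_of_nonneg _ _ (by positivity),
              ENNReal.mul_rpow_of_nonneg _ _ (by positivity)]
        _ ≤ _ := by
            gcongr
            refine rpow_le_self_of_one_le hC₂1 ?_
            rw [div_le_one ht0]; exact hst.symm.lt.le
    have h4 : m ^ (1 / s) * P ≤ C₂ * ∫⁻ z in qball d y r, M z ∂μ := by
      refine (ENNReal.mul_le_mul_iff_left hm0 hmt).1 ?_
      calc m ^ (1 / s) * P * m = ∫⁻ z in qball d y r, m ^ (1 / s) * P ∂μ := by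
            rw [setLIntegral_const]
        _ ≤ ∫⁻ z in qball d y r, C₂ * m * M z ∂μ := by
            refine setLIntegral_mono' (H.measurableSet_ball y r) fun z hz => ?_
            calc m ^ (1 / s) * P ≤ m ^ (1 / s) * (C₂ * m ^ (1 / t) * M z) := by
                  gcongr; exact h2 z hz
              _ = C₂ * (m ^ (1 / s) * m ^ (1 / t)) * M z := by ring
              _ = _ := by
                rw [← ENNReal.rpow_add _ _ hm0 hmt, one_div, one_div, hst.inv_add_inv_eq_one,
                  ENNReal.rpow_one]
        _ = C₂ * (∫⁻ z in qball d y r, M z ∂μ) * m := by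
            rw [lintegral_const_mul _ hMm]; ring
    calc ∫⁻ x in {x | d x y < r}, h x * (μ (qball d x r) ^ (α - 1) *
          (centreOsc d μ b r x * f y)) ∂μ
        ≤ ∫⁻ x in {x | d x y < r}, C₁ * m ^ (α - 1) * f y * (h x * centreOsc d μ b r x) ∂μ := by
          refine setLIntegral_mono' (H.measurableSet_ball' y r) fun x hx => ?_
          have := hcompar y x (hsubK y hx)
          calc h x * (μ (qball d x r) ^ (α - 1) * (centreOsc d μ b r x * f y))
              ≤ h x * ((C₁ * m ^ (α - 1)) * (centreOsc d μ b r x * f y)) := by gcongr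
            _ = _ := by ring
      _ ≤ ∫⁻ x in qball d y (K * r), C₁ * m ^ (α - 1) * f y * (h x * centreOsc d μ b r x) ∂μ :=
          lintegral_mono_set (hsubK y)
      _ = C₁ * m ^ (α - 1) * f y * ∫⁻ x in qball d y (K * r), h x * centreOsc d μ b r x ∂μ :=
          lintegral_const_mul _ (hh.mul hom)
      _ ≤ C₁ * m ^ (α - 1) * f y * (C₃ * m ^ (1 / s) * P) := by gcongr
      _ = C₁ * m ^ (α - 1) * f y * C₃ * (m ^ (1 / s) * P) := by ring
      _ ≤ C₁ * m ^ (α - 1) * f y * C₃ * (C₂ * ∫⁻ z in qball d y r, M z ∂μ) := by gcongr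
      _ = _ := by ring
  calc ∫⁻ x, h x * (μ (qball d x r) ^ (α - 1) *
        (centreOsc d μ b r x * ∫⁻ y in qball d x r, f y ∂μ)) ∂μ
      = ∫⁻ x, ∫⁻ y in qball d x r, h x * (μ (qball d x r) ^ (α - 1) *
          (centreOsc d μ b r x * f y)) ∂μ ∂μ := by
        refine lintegral_congr fun x => ?_
        simp_rw [← mul_assoc]
        rw [lintegral_const_mul _ hf]
    _ = ∫⁻ y, ∫⁻ x in {x | d x y < r}, h x * (μ (qball d x r) ^ (α - 1) *
          (centreOsc d μ b r x * f y)) ∂μ ∂μ :=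
        H.lintegral_ball_swap (g := fun x y => h x * (μ (qball d x r) ^ (α - 1) *
          (centreOsc d μ b r x * f y))) ((hh.comp measurable_fst).mul
          ((hmm.comp measurable_fst).mul
            ((hom.comp measurable_fst).mul (hf.comp measurable_snd)))) r
    _ ≤ ∫⁻ y, C₁ * C₃ * C₂ * (μ (qball d y r) ^ (α - 1) * f y *
          ∫⁻ z in qball d y r, M z ∂μ) ∂μ := lintegral_mono hinner
    _ = C₁ * C₃ * C₂ * ∫⁻ y, ∫⁻ z in qball d y r, μ (qball d y r) ^ (α - 1) * f y * M z ∂μ ∂μ := by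
        rw [lintegral_const_mul' _ _
          (ENNReal.mul_ne_top (ENNReal.mul_ne_top hC₁ hC₃) hC₂)]
        congr 1
        refine lintegral_congr fun y => ?_
        rw [lintegral_const_mul _ hMm]
    _ = C₁ * C₃ * C₂ * ∫⁻ z, ∫⁻ y in {y | d y z < r},
          μ (qball d y r) ^ (α - 1) * f y * M z ∂μ ∂μ := by
        rw [H.lintegral_ball_swap (g := fun y z => μ (qball d y r) ^ (α - 1) * f y * M z)
          (((hmm.mul hf).comp measurable_fst).mul (hMm.comp measurable_snd)) r]
    _ ≤ C₁ * C₃ * C₂ * ∫⁻ z, C₁ * (M z * (μ (qball d z r) ^ (α - 1) *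
          ∫⁻ y in qball d z (K * r), f y ∂μ)) ∂μ := by
        refine mul_le_mul_right (lintegral_mono fun z => ?_) _
        calc ∫⁻ y in {y | d y z < r}, μ (qball d y r) ^ (α - 1) * f y * M z ∂μ
            ≤ ∫⁻ y in {y | d y z < r}, C₁ * μ (qball d z r) ^ (α - 1) * M z * f y ∂μ := by
              refine setLIntegral_mono' (H.measurableSet_ball' z r) fun y hy => ?_
              have := hcompar z y (hsubK z hy)
              calc μ (qball d y r) ^ (α - 1) * f y * M z
                  ≤ (C₁ * μ (qball d z r) ^ (α - 1)) * f y * M z := by gcongr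
                _ = _ := by ring
          _ ≤ ∫⁻ y in qball d z (K * r), C₁ * μ (qball d z r) ^ (α - 1) * M z * f y ∂μ :=
              lintegral_mono_set (hsubK z)
          _ = C₁ * μ (qball d z r) ^ (α - 1) * M z * ∫⁻ y in qball d z (K * r), f y ∂μ :=
              lintegral_const_mul _ hf
          _ = _ := by ring
    _ = _ := by
        rw [lintegral_const_mul' _ _ hC₁]
        ring

end HomSpace

end Commutator

/-! ### Adams' theorem for the commutator on Morrey spaces -/

/-- The exponents of Adams' theorem for potentials of order `α` on Morrey spaces, restricted to a
range on which all constants are uniform. -/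
structure AdamsExponents (α p₀ q₁ l₁ p q l : ℝ) : Prop where
  le_p : p₀ ≤ p
  q_pos : 0 < q
  q_le : q ≤ q₁
  l_nonneg : 0 ≤ l
  l_le : l ≤ l₁
  rel : 1 / p - 1 / q = α / (1 - l)

namespace AdamsExponents

variable {α p₀ q₁ l₁ p q l : ℝ} (h : AdamsExponents α p₀ q₁ l₁ p q l) (hα : 0 < α) (hp₀ : 1 < p₀)
  (hl₁ : l₁ < 1)
include h

include hp₀ in
lemma one_lt_p : 1 < p := hp₀.trans_le h.le_p

include hl₁ in
lemma one_sub_l_pos : 0 < 1 - l := by linarith [h.l_le]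

include hα hp₀ hl₁ in
lemma p_lt_q : p < q := by
  have h1 : 0 < α / (1 - l) := div_pos hα (h.one_sub_l_pos hl₁)
  have hp := h.one_lt_p hp₀
  refine (one_div_lt_one_div h.q_pos (by linarith)).1 ?_
  linarith [h.rel]

include hl₁ in
lemma sub_eq : (1 - l) / p - α = (1 - l) / q := by
  have hl := h.one_sub_l_pos hl₁
  have := h.rel
  have h2 : (1 - l) * (1 / p - 1 / q) = α := by rw [this]; field_simp
  have h3 : (1 - l) * (1 / p - 1 / q) = (1 - l) / p - (1 - l) / q := by ring
  linarith

include hp₀ hl₁ in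
lemma div_eq : α / ((1 - l) / p) = 1 - p / q := by
  have hl := h.one_sub_l_pos hl₁
  have hp := h.one_lt_p hp₀
  have hp0 : p ≠ 0 := by linarith
  have : α / ((1 - l) / p) = p * (α / (1 - l)) := by field_simp
  rw [this, ← h.rel, mul_sub, mul_one_div_cancel hp0]
  ring

include hl₁ in
lemma le_div : (1 - l₁) / q₁ ≤ (1 - l) / q := by
  have := h.q_pos
  have := h.q_le
  have := h.l_le
  gcongr
  linarith

end AdamsExponents

section Adams

variable {X : Type*} [MeasurableSpace X] {d : X → X → ℝ} {μ : Measure X} {K R₀ E : ℝ}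
  {A τ : ℝ≥0∞}

namespace HomSpace

variable (H : HomSpace d μ K R₀ E A τ) [IsFiniteMeasure μ]
include H

/-- Hedberg's pointwise estimate for potentials of Morrey functions, with `L^t` averages. -/
lemma exists_powPot_le {α p₀ q₁ l₁ t : ℝ} (hα : 0 < α) (hp₀ : 1 < p₀) (hl₁ : l₁ < 1)
    (hq₁ : 0 < q₁) (ht : 0 < t) (htp : t ≤ p₀) : ∃ C : ℝ≥0∞, C ≠ ∞ ∧ 1 ≤ C ∧
    ∀ p q l, AdamsExponents α p₀ q₁ l₁ p q l → ∀ (g : X → ℝ≥0∞) (N : ℝ≥0∞), Measurable g →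
      MorreyBound d μ g p l N → ∀ x, powPot d μ R₀ E t α g x ≤
        C * ((hlMax d μ (R₀ + 1) (fun y => g y ^ t) x ^ (1 / t)) ^ (p / q) * N ^ (1 - p / q)) := by
  have hδ : 0 < min α ((1 - l₁) / q₁) := lt_min hα (div_pos (by linarith) hq₁)
  refine ⟨geomConst τ (min α ((1 - l₁) / q₁)), geomConst_ne_top hδ H.τ_lt_one, one_le_geomConst,
    fun p q l h g N hg hN x => ?_⟩
  have h1 := tsum_hedberg (m := fun k => μ (qball d x (rad R₀ E k)))
    (a := fun k => ballAvg d μ (fun y => g y ^ t) x (rad R₀ E k) ^ (1 / t))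
    (M := hlMax d μ (R₀ + 1) (fun y => g y ^ t) x ^ (1 / t)) (N := N) (α := α)
    (β := (1 - l) / p) hδ
    (H.measure_rad_succ_le x) (fun k => H.ball_ne_zero x (H.rad_pos k))
    (fun k => measure_ne_top _ _) (min_le_left _ _)
    (by rw [h.sub_eq hl₁]; exact (min_le_right _ _).trans (h.le_div hl₁))
    (fun k => ENNReal.rpow_le_rpow (H.ballAvg_le_hlMax _ x (H.rad_pos k)) (by positivity))
    (fun k => H.ballAvg_rpow_le hg ht (htp.trans h.le_p) hN (H.rad_pos k))
  rw [h.div_eq hp₀ hl₁, sub_sub_cancel] at h1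
  exact h1

/-- Hedberg's pointwise estimate for the discretized potential with enlarged balls. -/
lemma exists_dyPot_le {α p₀ q₁ l₁ Λ : ℝ} (hα : 0 < α) (hp₀ : 1 < p₀) (hl₁ : l₁ < 1)
    (hq₁ : 0 < q₁) (hΛ : 1 ≤ Λ) : ∃ C : ℝ≥0∞, C ≠ ∞ ∧ 1 ≤ C ∧
    ∀ p q l, AdamsExponents α p₀ q₁ l₁ p q l → ∀ (g : X → ℝ≥0∞) (N : ℝ≥0∞), Measurable g →
      MorreyBound d μ g p l N → ∀ x, dyPot d μ R₀ E Λ α g x ≤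
        C * (hlMax d μ (R₀ + 1) g x ^ (p / q) * N ^ (1 - p / q)) := by
  have hδ : 0 < min α ((1 - l₁) / q₁) := lt_min hα (div_pos (by linarith) hq₁)
  obtain ⟨C, hC, hC1, hcomp⟩ := H.exists_compar Λ
  refine ⟨C * geomConst τ (min α ((1 - l₁) / q₁)), ENNReal.mul_ne_top hC
    (geomConst_ne_top hδ H.τ_lt_one), one_le_mul hC1 one_le_geomConst,
    fun p q l h g N hg hN x => ?_⟩
  have hl := h.one_sub_l_pos hl₁
  have hp := h.one_lt_p hp₀
  have hβ : 0 ≤ (1 - l) / p := by positivity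
  have hΛr : ∀ k, 0 < Λ * rad R₀ E k := fun k => mul_pos (by linarith) (H.rad_pos k)
  have h1 := tsum_hedberg (m := fun k => μ (qball d x (rad R₀ E k)))
    (a := fun k => ballAvg d μ g x (Λ * rad R₀ E k))
    (M := hlMax d μ (R₀ + 1) g x) (N := N) (α := α)
    (β := (1 - l) / p) hδ
    (H.measure_rad_succ_le x) (fun k => H.ball_ne_zero x (H.rad_pos k))
    (fun k => measure_ne_top _ _) (min_le_left _ _)
    (by rw [h.sub_eq hl₁]; exact (min_le_right _ _).trans (h.le_div hl₁))
    (fun k => H.ballAvg_le_hlMax _ x (hΛr k))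
    (fun k => (H.ballAvg_le hg hp.le hN (hΛr k)).trans (by
      refine mul_le_mul_left ?_ _
      rw [ENNReal.rpow_neg, ENNReal.rpow_neg, ENNReal.inv_le_inv]
      refine ENNReal.rpow_le_rpow (measure_mono (qball_mono ?_)) hβ
      exact le_mul_of_one_le_left (H.rad_pos k).le hΛ))
  rw [h.div_eq hp₀ hl₁, sub_sub_cancel] at h1
  rw [mul_assoc]
  refine le_trans ?_ (mul_le_mul_right h1 C)
  rw [dyPot, ← ENNReal.tsum_mul_left]
  refine ENNReal.tsum_le_tsum fun k => ?_
  set m := μ (qball d x (rad R₀ E k)) with hm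
  have hm0 : m ≠ 0 := H.ball_ne_zero x (H.rad_pos k)
  have hmt : m ≠ ∞ := measure_ne_top _ _
  have h2 : m ^ α = m ^ (α - 1) * m := by
    conv_rhs => rw [← ENNReal.rpow_one m, ← ENNReal.rpow_mul, one_mul]
    rw [← ENNReal.rpow_add _ _ hm0 hmt, sub_add_cancel]
  rw [H.lintegral_ball_eq _ x (hΛr k), h2]
  calc m ^ (α - 1) * (μ (qball d x (Λ * rad R₀ E k)) * ballAvg d μ g x (Λ * rad R₀ E k))
      ≤ m ^ (α - 1) * ((C * m) * ballAvg d μ g x (Λ * rad R₀ E k)) := by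
        refine mul_le_mul_right (mul_le_mul_left (hcomp x x _ (H.rad_pos k) ?_) _) _
        rw [H.self]; exact hΛr k
    _ = _ := by ring

omit H [IsFiniteMeasure μ] in
/-- Taking the `q`-th power in Hedberg's estimate. -/
lemma hedberg_rpow_eq {C M N : ℝ≥0∞} {p q : ℝ} (hp : 0 < p) (hpq : p < q) :
    (C * (M ^ (p / q) * N ^ (1 - p / q))) ^ q = C ^ q * N ^ (q - p) * M ^ p := by
  have hq : 0 < q := hp.trans hpq
  have e1 : p / q * q = p := by field_simp
  have e2 : (1 - p / q) * q = q - p := by field_simp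
  rw [ENNReal.mul_rpow_of_nonneg _ _ hq.le, ENNReal.mul_rpow_of_nonneg _ _ hq.le,
    ← ENNReal.rpow_mul, ← ENNReal.rpow_mul, e1, e2]
  ring

/-- Functions satisfying Hedberg's estimate are Morrey functions, by the boundedness of the
maximal operator on Morrey spaces. -/
lemma exists_morrey_of_hedberg {α p₀ q₁ l₁ t : ℝ} (hα : 0 < α) (hp₀ : 1 < p₀) (hl₁ : l₁ < 1)
    (ht : 0 < t) (htp : t < p₀) {C₀ : ℝ≥0∞} (hC₀ : C₀ ≠ ∞) :
    ∃ C : ℝ≥0∞, C ≠ ∞ ∧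
    ∀ p q l, AdamsExponents α p₀ q₁ l₁ p q l → ∀ (g F : X → ℝ≥0∞) (N : ℝ≥0∞), Measurable g →
      MorreyBound d μ g p l N → (∀ x, F x ≤
        C₀ * ((hlMax d μ (R₀ + 1) (fun y => g y ^ t) x ^ (1 / t)) ^ (p / q) * N ^ (1 - p / q))) →
      MorreyBound d μ F q l (C * N) := by
  obtain ⟨C₁, hC₁, hM⟩ := H.exists_morrey_hlMax (p₀ / t) (q₁ / t) ((one_lt_div ht).2 htp)
  refine ⟨C₀ * max 1 (C₁ ^ (1 / t)), ENNReal.mul_ne_top hC₀ (max_lt ENNReal.one_lt_top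
    (ENNReal.rpow_lt_top_of_nonneg (by positivity) hC₁)).ne,
    fun p q l h g F N hg hN hF x r hr => ?_⟩
  have hp := h.one_lt_p hp₀
  have hpq := h.p_lt_q hα hp₀ hl₁
  have hq : 0 < q := h.q_pos
  have hl := h.one_sub_l_pos hl₁
  have hp0 : 0 < p := by linarith
  have hqp : 0 < q - p := by linarith
  set D := max 1 (C₁ ^ (1 / t)) with hD
  have hgt := hM (p / t) l (by have := h.le_p; gcongr) (by have := h.q_le; gcongr; linarith)
    h.l_nonneg (by linarith) _ _ (hg.pow_const t) (hN.rpow ht) x r hr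
  have e1 : 1 / t * p = p / t := by ring
  calc ∫⁻ y in qball d x r, F y ^ q ∂μ
      ≤ ∫⁻ y in qball d x r, C₀ ^ q * N ^ (q - p) *
          hlMax d μ (R₀ + 1) (fun y => g y ^ t) y ^ (p / t) ∂μ := by
        refine lintegral_mono fun y => (ENNReal.rpow_le_rpow (hF y) hq.le).trans (le_of_eq ?_)
        rw [hedberg_rpow_eq hp0 hpq, ← ENNReal.rpow_mul, e1]
    _ = C₀ ^ q * N ^ (q - p) * ∫⁻ y in qball d x r,
          hlMax d μ (R₀ + 1) (fun y => g y ^ t) y ^ (p / t) ∂μ :=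
        lintegral_const_mul _ ((H.measurable_hlMax _ (hg.pow_const t)).pow_const _)
    _ ≤ C₀ ^ q * N ^ (q - p) * ((C₁ * N ^ t) ^ (p / t) * μ (qball d x r) ^ l) := by gcongr
    _ = C₀ ^ q * (C₁ ^ (1 / t)) ^ p * (N ^ (q - p) * N ^ p) * μ (qball d x r) ^ l := by
        rw [ENNReal.mul_rpow_of_nonneg _ _ (by positivity), ← ENNReal.rpow_mul,
          ← ENNReal.rpow_mul, e1, mul_div_cancel₀ _ ht.ne']
        ring
    _ ≤ C₀ ^ q * D ^ q * N ^ q * μ (qball d x r) ^ l := by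
        rw [← ENNReal.rpow_add_of_nonneg _ _ hqp.le hp0.le, sub_add_cancel]
        gcongr
        calc (C₁ ^ (1 / t)) ^ p ≤ D ^ p := by gcongr; exact le_max_right _ _
          _ ≤ D ^ q := ENNReal.rpow_le_rpow_of_exponent_le (le_max_left _ _) hpq.le
    _ = (C₀ * D * N) ^ q * μ (qball d x r) ^ l := by
        rw [ENNReal.mul_rpow_of_nonneg _ _ hq.le, ENNReal.mul_rpow_of_nonneg _ _ hq.le]

/-- The global `L^q` norm of the potential of the localization of a Morrey function to a ball. -/
lemma exists_lintegral_dyPot_indicator_le {α p₀ q₁ l₁ Λ : ℝ} (hα : 0 < α) (hp₀ : 1 < p₀)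
    (hl₁ : l₁ < 1) (hq₁ : 0 < q₁) (hΛ : 1 ≤ Λ) : ∃ C : ℝ≥0∞, C ≠ ∞ ∧
    ∀ p q l, AdamsExponents α p₀ q₁ l₁ p q l → ∀ (g : X → ℝ≥0∞) (N : ℝ≥0∞), Measurable g →
      MorreyBound d μ g p l N → ∀ x₀ R, 0 < R →
      ∫⁻ x, dyPot d μ R₀ E Λ α ((qball d x₀ (2 * K * R)).indicator g) x ^ q ∂μ ≤
        (C * N) ^ q * μ (qball d x₀ R) ^ l := by
  have hK := H.one_le_K
  obtain ⟨C₁, hC₁, hC₁1, hhed⟩ := H.exists_dyPot_le hα hp₀ hl₁ hq₁ hΛ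
  obtain ⟨C₂, hC₂, hC₂1, hstrong⟩ := H.exists_strong_type p₀ q₁ hp₀
  obtain ⟨C₃, hC₃, hC₃1, hcomp⟩ := H.exists_compar (2 * K)
  refine ⟨C₁ * (C₂ * C₃), ENNReal.mul_ne_top hC₁ (ENNReal.mul_ne_top hC₂ hC₃),
    fun p q l h g N hg hN x₀ R hR => ?_⟩
  have hp := h.one_lt_p hp₀
  have hpq := h.p_lt_q hα hp₀ hl₁
  have hq : 0 < q := h.q_pos
  have hl := h.one_sub_l_pos hl₁
  have hp0 : 0 < p := by linarith
  have hqp : 0 < q - p := by linarith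
  set g₁ := (qball d x₀ (2 * K * R)).indicator g with hg₁
  have hg₁m : Measurable g₁ := hg.indicator (H.measurableSet_ball _ _)
  have hg₁g : g₁ ≤ g := indicator_le_self _ _
  have hN₁ : MorreyBound d μ g₁ p l N := hN.mono hp0.le hg₁g le_rfl
  have h2KR : 0 < 2 * K * R := by positivity
  calc ∫⁻ x, dyPot d μ R₀ E Λ α g₁ x ^ q ∂μ
      ≤ ∫⁻ x, C₁ ^ q * N ^ (q - p) * hlMax d μ (R₀ + 1) g₁ x ^ p ∂μ := by
        refine lintegral_mono fun y =>
          (ENNReal.rpow_le_rpow (hhed p q l h g₁ N hg₁m hN₁ y) hq.le).trans (le_of_eq ?_)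
        rw [hedberg_rpow_eq hp0 hpq]
    _ = C₁ ^ q * N ^ (q - p) * ∫⁻ x, hlMax d μ (R₀ + 1) g₁ x ^ p ∂μ :=
        lintegral_const_mul _ ((H.measurable_hlMax _ hg₁m).pow_const _)
    _ ≤ C₁ ^ q * N ^ (q - p) * (C₂ * ∫⁻ x, g₁ x ^ p ∂μ) := by
        gcongr
        exact hstrong p h.le_p (hpq.le.trans h.q_le) g₁ hg₁m
    _ = C₁ ^ q * N ^ (q - p) * (C₂ * ∫⁻ x in qball d x₀ (2 * K * R), g x ^ p ∂μ) := by
        rw [← lintegral_indicator (H.measurableSet_ball _ _)]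
        congr 3
        funext x
        by_cases hx : x ∈ qball d x₀ (2 * K * R)
        · simp [hg₁, hx]
        · simp [hg₁, hx, hp0]
    _ ≤ C₁ ^ q * N ^ (q - p) * (C₂ * (N ^ p * (C₃ * μ (qball d x₀ R)) ^ l)) := by
        gcongr
        refine (hN x₀ _ h2KR).trans (mul_le_mul_right (ENNReal.rpow_le_rpow ?_ h.l_nonneg) _)
        exact hcomp x₀ x₀ R hR (by rw [H.self]; exact h2KR)
    _ = C₁ ^ q * (C₂ * C₃ ^ l) * (N ^ (q - p) * N ^ p) * μ (qball d x₀ R) ^ l := by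
        rw [ENNReal.mul_rpow_of_nonneg _ _ h.l_nonneg]
        ring
    _ ≤ C₁ ^ q * (C₂ * C₃) ^ q * N ^ q * μ (qball d x₀ R) ^ l := by
        rw [← ENNReal.rpow_add_of_nonneg _ _ hqp.le hp0.le, sub_add_cancel]
        gcongr
        calc C₂ * C₃ ^ l ≤ C₂ * C₃ := by
              gcongr; exact rpow_le_self_of_one_le hC₃1 (by linarith)
          _ ≤ (C₂ * C₃) ^ q :=
              ENNReal.le_rpow_self_of_one_le (one_le_mul hC₂1 hC₃1) (by linarith)
    _ = (C₁ * (C₂ * C₃) * N) ^ q * μ (qball d x₀ R) ^ l := by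
        rw [ENNReal.mul_rpow_of_nonneg (C₁ * (C₂ * C₃)) N hq.le,
          ENNReal.mul_rpow_of_nonneg C₁ (C₂ * C₃) hq.le]

/-- The local part of the duality estimate for `oscPot`. -/
lemma exists_dual_near {b : X → ℝ} (hb : Measurable b) {s t : ℝ} (hst : s.HolderConjugate t)
    {N₀ : ℝ≥0∞} (hN1 : 1 ≤ N₀) (hNt : N₀ ≠ ∞) (hosc : OscBound d μ b s N₀)
    {α p₀ q₁ l₁ : ℝ} (hα : 0 < α) (hα1 : α < 1) (hp₀ : 1 < p₀) (hl₁ : l₁ < 1)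
    (hq₁ : 1 < q₁) (hs : q₁ < s) : ∃ C : ℝ≥0∞, C ≠ ∞ ∧
    ∀ p q l, AdamsExponents α p₀ q₁ l₁ p q l → ∀ q', q.HolderConjugate q' →
      ∀ (g : X → ℝ≥0∞) (N : ℝ≥0∞), Measurable g →
      MorreyBound d μ g p l N → ∀ x₀ R, 0 < R → ∀ h : X → ℝ≥0∞, Measurable h →
      ∫⁻ x, h x * oscPot d μ R₀ E b α ((qball d x₀ (2 * K * R)).indicator g) x ∂μ ≤
        C * N * μ (qball d x₀ R) ^ (l / q) * (∫⁻ x, h x ^ q' ∂μ) ^ (1 / q') := by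
  have ht := hst.symm.pos
  have hs0 := hst.pos
  obtain ⟨C₁, hC₁, hscale⟩ := H.exists_dual_scale hb hst hN1 hNt hosc hα hα1
  obtain ⟨C₂, hC₂, hdy⟩ := H.exists_lintegral_dyPot_indicator_le (q₁ := q₁) hα hp₀ hl₁
    (by linarith) H.one_le_K
  have he : 1 < q₁ / (q₁ - 1) / t := by
    rw [one_lt_div ht, hst.conjugate_eq,
      div_lt_div_iff₀ (by linarith) (by linarith)]
    linarith
  obtain ⟨C₃, hC₃, hC₃1, hstrong⟩ := H.exists_strong_type (q₁ / (q₁ - 1) / t)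
    (p₀ / (p₀ - 1) / t) he
  refine ⟨C₁ * C₃ * C₂, ENNReal.mul_ne_top (ENNReal.mul_ne_top hC₁ hC₃) hC₂,
    fun p q l adm q' hqq g N hg hN x₀ R hR h hh => ?_⟩
  have hpq := adm.p_lt_q hα hp₀ hl₁
  have hq1 := hqq.lt
  have hp₀q : p₀ ≤ q := adm.le_p.trans hpq.le
  have hq' : q' = q / (q - 1) := hqq.conjugate_eq
  have hq'0 : 0 < q' := hqq.symm.pos
  set g₁ := (qball d x₀ (2 * K * R)).indicator g with hg₁
  have hg₁m : Measurable g₁ := hg.indicator (H.measurableSet_ball _ _)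
  set M : X → ℝ≥0∞ := fun z => hlMax d μ (R₀ + 1) (fun x => h x ^ t) z ^ (1 / t) with hM
  have hMm : Measurable M := (H.measurable_hlMax _ (hh.pow_const t)).pow_const _
  have hMq : (∫⁻ z, M z ^ q' ∂μ) ^ (1 / q') ≤ C₃ * (∫⁻ x, h x ^ q' ∂μ) ^ (1 / q') := by
    have h1 := hstrong (q' / t) (by
        rw [hq']
        gcongr ?_ / _
        rw [div_le_div_iff₀ (by linarith) (by linarith)]
        nlinarith [adm.q_le]) (by
        rw [hq']
        gcongr ?_ / _
        rw [div_le_div_iff₀ (by linarith) (by linarith)]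
        nlinarith) _ (hh.pow_const t)
    simp_rw [← ENNReal.rpow_mul, mul_div_cancel₀ _ ht.ne'] at h1
    have e1 : 1 / t * q' = q' / t := by ring
    simp_rw [hM, ← ENNReal.rpow_mul, e1]
    refine (ENNReal.rpow_le_rpow h1 (by positivity)).trans ?_
    rw [ENNReal.mul_rpow_of_nonneg _ _ (by positivity)]
    gcongr
    refine rpow_le_self_of_one_le hC₃1 ?_
    rw [div_le_one hq'0]; exact hqq.symm.lt.le
  have hdq : (∫⁻ x, dyPot d μ R₀ E K α g₁ x ^ q ∂μ) ^ (1 / q) ≤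
      C₂ * N * μ (qball d x₀ R) ^ (l / q) := by
    refine (ENNReal.rpow_le_rpow (hdy p q l adm g N hg hN x₀ R hR)
      (one_div_nonneg.2 adm.q_pos.le)).trans (le_of_eq ?_)
    rw [ENNReal.mul_rpow_of_nonneg _ _ (one_div_nonneg.2 adm.q_pos.le), ← ENNReal.rpow_mul,
      ← ENNReal.rpow_mul, mul_one_div_cancel adm.q_pos.ne', ENNReal.rpow_one, mul_one_div]
  calc ∫⁻ x, h x * oscPot d μ R₀ E b α g₁ x ∂μ
      = ∑' k, ∫⁻ x, h x * (μ (qball d x (rad R₀ E k)) ^ (α - 1) *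
          (centreOsc d μ b (rad R₀ E k) x * ∫⁻ y in qball d x (rad R₀ E k), g₁ y ∂μ)) ∂μ := by
        simp_rw [oscPot, ← ENNReal.tsum_mul_left]
        rw [lintegral_tsum]
        intro k
        exact (hh.mul (((H.measurable_measure_ball_const _).pow_const _).mul
          ((H.measurable_centreOsc hb _).mul
            (H.measurable_setLIntegral_ball_const hg₁m _)))).aemeasurable
    _ ≤ ∑' k, C₁ * ∫⁻ z, M z * (μ (qball d z (rad R₀ E k)) ^ (α - 1) *
          ∫⁻ y in qball d z (K * rad R₀ E k), g₁ y ∂μ) ∂μ :=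
        ENNReal.tsum_le_tsum fun k => hscale _ (H.rad_pos k) h g₁ hh hg₁m
    _ = C₁ * ∫⁻ z, M z * dyPot d μ R₀ E K α g₁ z ∂μ := by
        rw [ENNReal.tsum_mul_left]
        congr 1
        simp_rw [dyPot, ← ENNReal.tsum_mul_left]
        rw [lintegral_tsum]
        intro k
        exact (hMm.mul (((H.measurable_measure_ball_const _).pow_const _).mul
            (H.measurable_setLIntegral_ball_const hg₁m _))).aemeasurable
    _ ≤ C₁ * ((∫⁻ z, M z ^ q' ∂μ) ^ (1 / q') *
          (∫⁻ x, dyPot d μ R₀ E K α g₁ x ^ q ∂μ) ^ (1 / q)) := by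
        gcongr
        exact ENNReal.lintegral_mul_le_Lp_mul_Lq _ hqq.symm hMm.aemeasurable
          (H.measurable_dyPot K α hg₁m).aemeasurable
    _ ≤ C₁ * ((C₃ * (∫⁻ x, h x ^ q' ∂μ) ^ (1 / q')) *
          (C₂ * N * μ (qball d x₀ R) ^ (l / q))) := by gcongr
    _ = _ := by ring

/-- The part of the duality estimate for `oscPot` that comes from the complement of a ball. -/
lemma exists_dual_far {b : X → ℝ} (hb : Measurable b) {s : ℝ}
    {N₀ : ℝ≥0∞} (hN1 : 1 ≤ N₀) (hNt : N₀ ≠ ∞) (hosc : OscBound d μ b s N₀)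
    {α p₀ q₁ l₁ : ℝ} (hα : 0 < α) (hp₀ : 1 < p₀) (hl₁ : l₁ < 1)
    (hq₁ : 1 < q₁) (hs : q₁ ≤ s) (hs' : 1 / s < (1 - l₁) / q₁) : ∃ C : ℝ≥0∞, C ≠ ∞ ∧
    ∀ p q l, AdamsExponents α p₀ q₁ l₁ p q l → ∀ q', q.HolderConjugate q' →
      ∀ (g : X → ℝ≥0∞) (N : ℝ≥0∞), Measurable g →
      MorreyBound d μ g p l N → ∀ x₀ R, 0 < R → ∀ h : X → ℝ≥0∞, Measurable h →
      (∀ x, x ∉ qball d x₀ R → h x = 0) →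
      ∫⁻ x, h x * oscPot d μ R₀ E b α ((qball d x₀ (2 * K * R))ᶜ.indicator g) x ∂μ ≤
        C * N * μ (qball d x₀ R) ^ (l / q) * (∫⁻ x, h x ^ q' ∂μ) ^ (1 / q') := by
  have hK := H.one_le_K
  have hs1 : 1 ≤ s := by linarith
  have hs0 : 0 < s := by linarith
  obtain ⟨C₁, hC₁, hC₁1, hcomp⟩ := H.exists_compar 1
  obtain ⟨C₂, hC₂, hC₂1, hosc₂⟩ := H.exists_lintegral_centreOsc_le hb hs1 hN1 hNt hosc le_rfl
  set δ := (1 - l₁) / q₁ - 1 / s with hδ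
  have hδ0 : 0 < δ := by rw [hδ]; linarith
  refine ⟨C₁ * C₂ * geomConst τ δ, ENNReal.mul_ne_top (ENNReal.mul_ne_top hC₁ hC₂)
    (geomConst_ne_top hδ0 H.τ_lt_one),
    fun p q l adm q' hqq g N hg hN x₀ R hR h hh hsupp => ?_⟩
  have hpq := adm.p_lt_q hα hp₀ hl₁
  have hp := adm.one_lt_p hp₀
  have hp0 : 0 < p := by linarith
  have hq1 := hqq.lt
  have hq0 := hqq.pos
  have hl := adm.one_sub_l_pos hl₁
  set B := qball d x₀ R with hB
  have hBm : MeasurableSet B := H.measurableSet_ball _ _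
  have hB0 : μ B ≠ 0 := H.ball_ne_zero x₀ hR
  have hBt : μ B ≠ ∞ := measure_ne_top _ _
  set m : ℕ → ℝ≥0∞ := fun k => μ (qball d x₀ (rad R₀ E k)) with hm
  have hm0 : ∀ k, m k ≠ 0 := fun k => H.ball_ne_zero x₀ (H.rad_pos k)
  have hmt : ∀ k, m k ≠ ∞ := fun k => measure_ne_top _ _
  set β := (1 - l) / p with hβ
  have hβα : β - α = (1 - l) / q := adm.sub_eq hl₁
  have hβ1 : β ≤ 1 := by rw [hβ, div_le_one hp0]; linarith [adm.l_nonneg]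
  have hβα0 : 0 ≤ β - α := by rw [hβα]; positivity
  set g₂ := (qball d x₀ (2 * K * R))ᶜ.indicator g with hg₂
  have hg₂m : Measurable g₂ := hg.indicator (H.measurableSet_ball _ _).compl
  have hN₂ : MorreyBound d μ g₂ p l N := hN.mono hp0.le (indicator_le_self _ _) le_rfl
  set Hq := (∫⁻ x, h x ^ q' ∂μ) ^ (1 / q') with hHq
  -- Only the scales larger than `R` contribute on `B`.
  have hpt : ∀ x ∈ B, oscPot d μ R₀ E b α g₂ x ≤ ∑' k,
      (if R < rad R₀ E k then C₁ * N * m k ^ (-(β - α)) else 0) *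
        centreOsc d μ b (rad R₀ E k) x := by
    intro x hx
    refine ENNReal.tsum_le_tsum fun k => ?_
    set v := μ (qball d x (rad R₀ E k)) with hv
    have hv0 : v ≠ 0 := H.ball_ne_zero x (H.rad_pos k)
    have hvt : v ≠ ∞ := measure_ne_top _ _
    split_ifs with hk
    · have h1 : ∫⁻ y in qball d x (rad R₀ E k), g₂ y ∂μ ≤ v * (v ^ (-β) * N) := by
        rw [H.lintegral_ball_eq _ x (H.rad_pos k)]
        exact mul_le_mul_right (H.ballAvg_le hg₂m hp.le hN₂ (H.rad_pos k)) _
      have h2 : v ^ (-(β - α)) ≤ C₁ * m k ^ (-(β - α)) := by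
        refine rpow_neg_le_of_le_mul hβα0 (by linarith) hC₁1 hC₁ ?_
        have := hcomp x₀ x (rad R₀ E k) (H.rad_pos k) (by rw [one_mul]; exact lt_trans hx hk)
        rwa [one_mul] at this
      have h3 : v ^ (α - 1) * (v * v ^ (-β)) = v ^ (-(β - α)) := by
        conv_lhs => rw [← ENNReal.rpow_one v, ← ENNReal.rpow_mul, ← ENNReal.rpow_mul, one_mul,
          one_mul, ← ENNReal.rpow_add _ _ hv0 hvt, ← ENNReal.rpow_add _ _ hv0 hvt]
        congr 1; ring
      calc v ^ (α - 1) * (centreOsc d μ b (rad R₀ E k) x *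
            ∫⁻ y in qball d x (rad R₀ E k), g₂ y ∂μ)
          ≤ v ^ (α - 1) * (centreOsc d μ b (rad R₀ E k) x * (v * (v ^ (-β) * N))) := by gcongr
        _ = (v ^ (α - 1) * (v * v ^ (-β))) * N * centreOsc d μ b (rad R₀ E k) x := by ring
        _ ≤ (C₁ * m k ^ (-(β - α))) * N * centreOsc d μ b (rad R₀ E k) x := by rw [h3]; gcongr
        _ = _ := by ring
    · have h1 : ∫⁻ y in qball d x (rad R₀ E k), g₂ y ∂μ = 0 := by
        rw [setLIntegral_eq_zero_iff (H.measurableSet_ball _ _) hg₂m]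
        refine ae_of_all _ fun y hy => ?_
        rw [hg₂, indicator_of_notMem]
        rw [mem_compl_iff, not_not, mem_qball]
        have := H.tri_lt hx hy
        nlinarith [not_lt.1 hk]
      rw [h1]; simp
  have hterm : ∀ k, R < rad R₀ E k → ∫⁻ x in B, h x * centreOsc d μ b (rad R₀ E k) x ∂μ ≤
      C₂ * Hq * (m k ^ (1 / s) * μ B ^ (1 / q - 1 / s)) := by
    intro k hk
    have hom := H.measurable_centreOsc hb (rad R₀ E k)
    have h1 : (∫⁻ x in B, centreOsc d μ b (rad R₀ E k) x ^ q ∂μ) ^ (1 / q) ≤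
        (C₂ * m k) ^ (1 / s) * μ B ^ (1 / q - 1 / s) := by
      have h2 := lintegral_rpow_le_of_le (ν := μ.restrict B) hq0 (adm.q_le.trans hs)
        hom.aemeasurable
      rw [Measure.restrict_apply_univ] at h2
      refine h2.trans (mul_le_mul_left (ENNReal.rpow_le_rpow ?_ (by positivity)) _)
      have h3 := hosc₂ x₀ (rad R₀ E k) (H.rad_pos k)
      rw [one_mul] at h3
      exact (lintegral_mono_set (qball_mono hk.le)).trans h3
    calc ∫⁻ x in B, h x * centreOsc d μ b (rad R₀ E k) x ∂μ
        ≤ (∫⁻ x in B, h x ^ q' ∂μ) ^ (1 / q') *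
          (∫⁻ x in B, centreOsc d μ b (rad R₀ E k) x ^ q ∂μ) ^ (1 / q) :=
          ENNReal.lintegral_mul_le_Lp_mul_Lq _ hqq.symm hh.aemeasurable hom.aemeasurable
      _ ≤ Hq * ((C₂ * m k) ^ (1 / s) * μ B ^ (1 / q - 1 / s)) := by
          refine mul_le_mul' (ENNReal.rpow_le_rpow (setLIntegral_le_lintegral _ _) ?_) h1
          exact one_div_nonneg.2 hqq.symm.nonneg
      _ ≤ Hq * ((C₂ * m k ^ (1 / s)) * μ B ^ (1 / q - 1 / s)) := by
          rw [ENNReal.mul_rpow_of_nonneg _ _ (by positivity)]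
          gcongr
          refine rpow_le_self_of_one_le hC₂1 ?_
          rw [div_le_one hs0]; exact hs1
      _ = _ := by ring
  set γ := (1 - l) / q - 1 / s with hγ
  have hδγ : δ ≤ γ := by rw [hδ, hγ]; linarith [adm.le_div hl₁]
  calc ∫⁻ x, h x * oscPot d μ R₀ E b α g₂ x ∂μ
      = ∫⁻ x in B, h x * oscPot d μ R₀ E b α g₂ x ∂μ := by
        rw [← lintegral_indicator hBm]
        refine lintegral_congr fun x => ?_
        by_cases hx : x ∈ B
        · rw [indicator_of_mem hx]
        · rw [indicator_of_notMem hx, hsupp x hx, zero_mul]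
    _ ≤ ∫⁻ x in B, ∑' k, (if R < rad R₀ E k then C₁ * N * m k ^ (-(β - α)) else 0) *
          (h x * centreOsc d μ b (rad R₀ E k) x) ∂μ := by
        refine setLIntegral_mono' hBm fun x hx => ?_
        refine (mul_le_mul_right (hpt x hx) _).trans (le_of_eq ?_)
        rw [← ENNReal.tsum_mul_left]
        congr 1; funext k
        ring
    _ = ∑' k, (if R < rad R₀ E k then C₁ * N * m k ^ (-(β - α)) else 0) *
          ∫⁻ x in B, h x * centreOsc d μ b (rad R₀ E k) x ∂μ := by
        have hk : ∀ k, Measurable fun x => h x * centreOsc d μ b (rad R₀ E k) x :=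
          fun k => hh.mul (H.measurable_centreOsc hb _)
        rw [lintegral_tsum fun k => ((hk k).const_mul _).aemeasurable]
        congr 1; funext k
        rw [lintegral_const_mul _ (hk k)]
    _ ≤ ∑' k, C₁ * N * C₂ * Hq * μ B ^ (1 / q - 1 / s) *
          (if μ B ≤ m k then m k ^ (-γ) else 0) := by
        refine ENNReal.tsum_le_tsum fun k => ?_
        by_cases hk : R < rad R₀ E k
        · have h1 : μ B ≤ m k := measure_mono (qball_mono hk.le)
          have h2 : m k ^ (-γ) = m k ^ (-(β - α)) * m k ^ (1 / s) := by
            rw [← ENNReal.rpow_add _ _ (hm0 k) (hmt k), hγ, hβα]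
            congr 1; ring
          rw [if_pos hk, if_pos h1, h2]
          refine (mul_le_mul_right (hterm k hk) _).trans (le_of_eq ?_)
          ring
        · rw [if_neg hk, zero_mul]; exact zero_le
    _ ≤ C₁ * N * C₂ * Hq * μ B ^ (1 / q - 1 / s) * (geomConst τ δ * μ B ^ (-γ)) := by
        rw [ENNReal.tsum_mul_left]
        gcongr
        exact tsum_rpow_neg_le hδ0 (H.measure_rad_succ_le x₀) hB0 hBt hmt hδγ
    _ = C₁ * C₂ * geomConst τ δ * N * μ B ^ (l / q) * Hq := by
        have : μ B ^ (l / q) = μ B ^ (1 / q - 1 / s) * μ B ^ (-γ) := by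
          rw [← ENNReal.rpow_add _ _ hB0 hBt, hγ]
          congr 1; ring
        rw [this]; ring

omit H [IsFiniteMeasure μ] in
lemma oscPot_add {b : X → ℝ} {α : ℝ} {f g : X → ℝ≥0∞} (hf : Measurable f) (x : X) :
    oscPot d μ R₀ E b α (fun y => f y + g y) x =
      oscPot d μ R₀ E b α f x + oscPot d μ R₀ E b α g x := by
  rw [oscPot, oscPot, oscPot, ← ENNReal.tsum_add]
  congr 1; funext k
  rw [lintegral_add_left hf]
  ring

/-- Adams' theorem for the oscillation part of the commutator. -/
lemma exists_morrey_oscPot {b : X → ℝ} (hb : Measurable b) {s t : ℝ} (hst : s.HolderConjugate t)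
    {N₀ : ℝ≥0∞} (hN1 : 1 ≤ N₀) (hNt : N₀ ≠ ∞) (hosc : OscBound d μ b s N₀)
    {α p₀ q₁ l₁ : ℝ} (hα : 0 < α) (hα1 : α < 1) (hp₀ : 1 < p₀) (hl₁ : l₁ < 1)
    (hq₁ : 1 < q₁) (hs : q₁ < s) (hs' : 1 / s < (1 - l₁) / q₁) : ∃ C : ℝ≥0∞, C ≠ ∞ ∧
    ∀ p q l, AdamsExponents α p₀ q₁ l₁ p q l → ∀ (g : X → ℝ≥0∞) (N : ℝ≥0∞), Measurable g →
      MorreyBound d μ g p l N → MorreyBound d μ (oscPot d μ R₀ E b α g) q l (C * N) := by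
  obtain ⟨C₁, hC₁, hnear⟩ := H.exists_dual_near hb hst hN1 hNt hosc hα hα1 hp₀ hl₁ hq₁ hs
  obtain ⟨C₂, hC₂, hfar⟩ := H.exists_dual_far hb hN1 hNt hosc hα hp₀ hl₁ hq₁ hs.le hs'
  refine ⟨C₁ + C₂, ENNReal.add_ne_top.2 ⟨hC₁, hC₂⟩, fun p q l adm g N hg hN x₀ R hR => ?_⟩
  have hq1 : 1 < q := (adm.one_lt_p hp₀).trans (adm.p_lt_q hα hp₀ hl₁)
  have hqq := Real.HolderConjugate.conjExponent hq1
  have hB := H.measurableSet_ball x₀ (2 * K * R)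
  have hm1 : Measurable ((qball d x₀ (2 * K * R)).indicator g) := hg.indicator hB
  have hsplit : ∀ x, oscPot d μ R₀ E b α g x =
      oscPot d μ R₀ E b α ((qball d x₀ (2 * K * R)).indicator g) x +
      oscPot d μ R₀ E b α ((qball d x₀ (2 * K * R))ᶜ.indicator g) x := by
    intro x
    rw [← oscPot_add hm1]
    congr 1; funext y
    exact (indicator_self_add_compl_apply (qball d x₀ (2 * K * R)) g y).symm
  have := setLIntegral_rpow_le_of_dual (μ := μ) (H.measurable_oscPot hb α hg)
    (H.measurableSet_ball x₀ R) hqq (Q := (C₁ + C₂) * N * μ (qball d x₀ R) ^ (l / q))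
    (fun h hh hsupp => by
      simp_rw [hsplit, mul_add]
      rw [lintegral_add_left (f := fun x => h x *
        oscPot d μ R₀ E b α ((qball d x₀ (2 * K * R)).indicator g) x)
        (hh.mul (H.measurable_oscPot hb α hm1))]
      refine (add_le_add (hnear p q l adm _ hqq g N hg hN x₀ R hR h hh)
        (hfar p q l adm _ hqq g N hg hN x₀ R hR h hh hsupp)).trans (le_of_eq ?_)
      ring)
  refine this.trans (le_of_eq ?_)
  rw [ENNReal.mul_rpow_of_nonneg _ _ hqq.nonneg, ← ENNReal.rpow_mul,
    div_mul_cancel₀ _ hqq.pos.ne']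

/-- Adams' theorem for the discretized commutator. -/
lemma exists_morrey_dyPot_comm {b : X → ℝ} (hb : Measurable b) {s t : ℝ}
    (hst : s.HolderConjugate t)
    {N₀ : ℝ≥0∞} (hN1 : 1 ≤ N₀) (hNt : N₀ ≠ ∞) (hosc : OscBound d μ b s N₀)
    {α p₀ q₁ l₁ : ℝ} (hα : 0 < α) (hα1 : α < 1) (hp₀ : 1 < p₀) (hl₁ : l₁ < 1)
    (hq₁ : 1 < q₁) (hs : q₁ < s) (hs' : 1 / s < (1 - l₁) / q₁) (htp : t < p₀) :
    ∃ C : ℝ≥0∞, C ≠ ∞ ∧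
    ∀ p q l, AdamsExponents α p₀ q₁ l₁ p q l → ∀ (g : X → ℝ≥0∞) (N : ℝ≥0∞), Measurable g →
      MorreyBound d μ g p l N →
      MorreyBound d μ (fun x => dyPot d μ R₀ E 1 α (fun y => ‖b x - b y‖ₑ * g y) x) q l (C * N) ∧
      MorreyBound d μ (dyPot d μ R₀ E 1 α g) q l (C * N) := by
  have hq₁0 : 0 < q₁ := by linarith
  obtain ⟨C₁, hC₁, hC₁1, hpow⟩ := H.exists_powPot_le hα hp₀ hl₁ hq₁0 hst.symm.pos htp.le
  obtain ⟨C₂, hC₂, hmor⟩ := H.exists_morrey_of_hedberg (q₁ := q₁) hα hp₀ hl₁ hst.symm.pos htp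
    hC₁
  obtain ⟨C₃, hC₃, hC₃1, hdy⟩ := H.exists_dyPot_le hα hp₀ hl₁ hq₁0 (le_refl (1 : ℝ))
  obtain ⟨C₄, hC₄, hmor₁⟩ := H.exists_morrey_of_hedberg (q₁ := q₁) hα hp₀ hl₁ one_pos hp₀
    hC₃
  obtain ⟨C₅, hC₅, hoscM⟩ := H.exists_morrey_oscPot hb hst hN1 hNt hosc hα hα1 hp₀ hl₁ hq₁
    hs hs'
  have h2t : (2 : ℝ≥0∞) ^ q₁ ≠ ∞ := ENNReal.rpow_ne_top_of_nonneg hq₁0.le (by simp)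
  refine ⟨max C₄ (2 ^ q₁ * (C₅ + 2 * (N₀ * C₂))), ?_, fun p q l adm g N hg hN => ⟨?_, ?_⟩⟩
  · refine (max_lt hC₄.lt_top (ENNReal.mul_lt_top h2t.lt_top (ENNReal.add_lt_top.2 ⟨hC₅.lt_top,
      ENNReal.mul_lt_top ENNReal.ofNat_lt_top (ENNReal.mul_lt_top hNt.lt_top hC₂.lt_top)⟩))).ne
  · have hq1 : 1 < q := (adm.one_lt_p hp₀).trans (adm.p_lt_q hα hp₀ hl₁)
    have hq0 : 0 < q := by linarith
    have h1 := hoscM p q l adm g N hg hN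
    have h2 := hmor p q l adm g _ N hg hN (hpow p q l adm g N hg hN)
    intro x r hr
    set v := μ (qball d x r) ^ l with hv
    have h21 : (1 : ℝ≥0∞) ≤ 2 ^ q₁ := ENNReal.one_le_rpow one_le_two hq₁0
    calc ∫⁻ y in qball d x r, dyPot d μ R₀ E 1 α (fun z => ‖b y - b z‖ₑ * g z) y ^ q ∂μ
        ≤ ∫⁻ y in qball d x r, (oscPot d μ R₀ E b α g y +
            2 * N₀ * powPot d μ R₀ E t α g y) ^ q ∂μ :=
          lintegral_mono fun y =>
            ENNReal.rpow_le_rpow (H.dyPot_comm_le hb hst hN1 hosc hg α y) hq0.le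
      _ ≤ 2 ^ q₁ * ((C₅ * N) ^ q * v + (2 * N₀ * (C₂ * N)) ^ q * v) := by
          refine (lintegral_add_rpow_le hq1.le adm.q_le
            (H.measurable_oscPot hb α hg).aemeasurable).trans ?_
          gcongr
          · exact h1 x r hr
          · simp_rw [ENNReal.mul_rpow_of_nonneg (2 * N₀) _ hq0.le]
            rw [lintegral_const_mul _ ((H.measurable_powPot t α hg).pow_const q), mul_assoc]
            exact mul_le_mul_right (h2 x r hr) _
      _ ≤ (2 ^ q₁ * (C₅ + 2 * (N₀ * C₂))) ^ q * N ^ q * v := by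
          rw [← add_mul, ← mul_assoc, ENNReal.mul_rpow_of_nonneg (2 ^ q₁) _ hq0.le]
          refine mul_le_mul_left ?_ v
          rw [mul_assoc ((2 ^ q₁) ^ q)]
          refine mul_le_mul' (ENNReal.le_rpow_self_of_one_le h21 hq1.le) ?_
          rw [← ENNReal.mul_rpow_of_nonneg _ _ hq0.le]
          refine (ENNReal.add_rpow_le_rpow_add _ _ hq1.le).trans (le_of_eq ?_)
          congr 1; ring
      _ ≤ (max C₄ (2 ^ q₁ * (C₅ + 2 * (N₀ * C₂))) * N) ^ q * v := by
          rw [← ENNReal.mul_rpow_of_nonneg _ _ hq0.le]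
          gcongr
          exact le_max_right _ _
  · have hq0 := adm.q_pos
    refine (hmor₁ p q l adm g _ N hg hN fun x => ?_).mono hq0.le le_rfl
      (mul_le_mul_left (le_max_left _ _) _)
    simpa using hdy p q l adm g N hg hN x

end HomSpace

end Adams

/-! ### From spaces of homogeneous type to all radii -/

section Transfer

variable {X : Type*} [MeasurableSpace X] {d : X → X → ℝ} {μ : Measure X}

namespace DoublingSpace

variable {K R₀ : ℝ} {A : ℝ≥0∞} (H : DoublingSpace d μ K R₀ A)
include H

/-- If annuli of small radii have positive measure, then a doubling measure is reverse doubling: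
an annulus contains a point, and balls around that point and around the centre, of radii
proportional to those of the annulus, are disjoint. -/
lemma exists_homSpace [IsFiniteMeasure μ] {R₁ : ℝ} (hR₁ : 0 < R₁)
    (hann : ∀ x r R, 0 < r → r < R → R < R₁ → 0 < μ (qball d x R \ qball d x r)) :
    ∃ (E : ℝ) (τ : ℝ≥0∞), HomSpace d μ K R₀ E A τ := by
  have hK := H.one_le_K
  have hK0 := H.K_pos
  obtain ⟨C, hC, hC1, hcomp⟩ := H.exists_compar (8 * K ^ 3)
  set σ : ℝ := 1 / (4 * K ^ 2) with hσ
  have hσ0 : 0 < σ := by positivity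
  have hσ1 : σ ≤ 1 := by rw [hσ, div_le_one (by positivity)]; nlinarith
  have hKσ : K * (1 + K) * σ ≤ 1 / 2 := by
    rw [hσ, mul_one_div, div_le_div_iff₀ (by positivity) (by norm_num)]; nlinarith
  have key : ∀ x R, 0 < R → R < R₁ →
      μ (qball d x (σ * R)) ≤ (1 - C⁻¹) * μ (qball d x (2 * K * R)) := by
    intro x R hR hRR
    obtain ⟨y, hy, hy'⟩ := nonempty_of_measure_ne_zero
      (hann x (R / 2) R (by positivity) (by linarith) hRR).ne'
    rw [mem_qball] at hy hy'
    have hσR : 0 < σ * R := by positivity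
    have hdisj : Disjoint (qball d x (σ * R)) (qball d y (σ * R)) := by
      rw [Set.disjoint_left]
      intro z hz hz'
      have h1 := H.tri_lt hz (H.symm_lt hz')
      nlinarith
    have hsub : qball d x (σ * R) ∪ qball d y (σ * R) ⊆ qball d x (2 * K * R) := by
      rintro z (hz | hz)
      · refine qball_mono ?_ hz
        nlinarith
      · have h1 := H.tri_lt hy hz
        rw [mem_qball]
        nlinarith [mul_pos hK0 hR]
    have h1 : μ (qball d x (σ * R)) + μ (qball d y (σ * R)) ≤ μ (qball d x (2 * K * R)) := by
      rw [← measure_union hdisj (H.measurableSet_ball _ _)]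
      exact measure_mono hsub
    have he : 8 * K ^ 3 * (σ * R) = 2 * K * R := by rw [hσ]; field_simp; ring
    have h2 := hcomp x y (σ * R) hσR (by rw [he]; nlinarith)
    rw [he] at h2
    set m := μ (qball d x (2 * K * R)) with hm
    have h3 : C⁻¹ * m ≤ μ (qball d y (σ * R)) := by
      rw [mul_comm, ← div_eq_mul_inv]
      exact ENNReal.div_le_of_le_mul (by rwa [mul_comm])
    rw [ENNReal.sub_mul (fun _ _ => measure_ne_top _ _), one_mul]
    refine ENNReal.le_sub_of_add_le_right (ENNReal.mul_ne_top (by simp; positivity)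
      (measure_ne_top _ _)) ((add_le_add le_rfl h3).trans h1)
  set θ : ℝ := min 1 (K * R₁ / R₀) with hθ
  have hR₀ := H.R₀_pos
  have hθ0 : 0 < θ := lt_min one_pos (by positivity)
  have hθ1 : θ ≤ 1 := min_le_left _ _
  refine ⟨8 * K ^ 3 / θ, 1 - C⁻¹, H, ?_, fun x r hr hrR => ?_, ?_⟩
  · rw [le_div_iff₀ hθ0]
    nlinarith [one_le_pow₀ hK (n := 3)]
  · have h1 : θ * r / (2 * K) < R₁ := by
      have h2 : θ * R₀ ≤ K * R₁ := by
        calc θ * R₀ ≤ K * R₁ / R₀ * R₀ := by gcongr; exact min_le_right _ _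
          _ = K * R₁ := by field_simp
      rw [div_lt_iff₀ (by positivity)]
      nlinarith [mul_pos hK0 hR₁]
    have h3 := key x (θ * r / (2 * K)) (by positivity) h1
    have e1 : σ * (θ * r / (2 * K)) = r / (8 * K ^ 3 / θ) := by
      rw [hσ]; field_simp; norm_num
    have e2 : 2 * K * (θ * r / (2 * K)) = θ * r := by field_simp
    rw [e1, e2] at h3
    exact h3.trans (mul_le_mul_right (measure_mono (qball_mono (by nlinarith))) _)
  · exact ENNReal.sub_lt_self ENNReal.one_ne_top one_ne_zero (by simpa using hC)

/-- The space is covered by finitely many balls of a given radius. -/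
lemma exists_finite_cover [IsFiniteMeasure μ] {ρ : ℝ} (hρ : 0 < ρ) :
    ∃ s : Finset X, ⋃ x ∈ s, qball d x ρ = univ := by
  rcases isEmpty_or_nonempty X with hX | ⟨⟨x₀⟩⟩
  · exact ⟨∅, Subsingleton.elim _ _⟩
  have hK := H.K_pos
  set r := ρ / (5 * K ^ 3) with hr
  have hr0 : 0 < r := by positivity
  obtain ⟨u, hu, -, hdis, hcov⟩ := H.exists_vitali (univ ×ˢ {r}) r (by
    rintro ⟨a, b⟩ ⟨-, hb⟩
    rw [mem_singleton_iff] at hb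
    subst hb
    exact ⟨hr0, le_rfl⟩)
  obtain ⟨C, hC, hC1, hcomp⟩ := H.exists_compar (R₀ / r)
  have hur : ∀ a ∈ u, a.2 = r := fun a ha => (hu ha).2
  have hm : ∀ a : u, C⁻¹ * μ univ ≤ μ (qball d a.1.1 a.1.2) := by
    intro a
    have h1 := hcomp x₀ a.1.1 r hr0 (by rw [div_mul_cancel₀ _ hr0.ne']; exact H.lt_diam _ _)
    rw [div_mul_cancel₀ _ hr0.ne', H.qball_eq_univ le_rfl] at h1
    rw [hur _ a.2, mul_comm, ← div_eq_mul_inv]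
    exact ENNReal.div_le_of_le_mul (by rwa [mul_comm])
  have hpos : 0 < C⁻¹ * μ univ := by
    refine ENNReal.mul_pos (by simpa using hC) ?_
    rw [← H.qball_eq_univ (x := x₀) le_rfl]
    exact (H.pos _ _ H.R₀_pos).ne'
  have hfin := Measure.finite_const_le_meas_of_disjoint_iUnion μ hpos
    (As := fun a : u => qball d a.1.1 a.1.2) (fun a => H.measurableSet_ball _ _)
    (fun a b hab => hdis a.2 b.2 (fun h => hab (Subtype.ext h))) (measure_ne_top _ _)
  have huf : u.Finite := by
    have : {i : u | C⁻¹ * μ univ ≤ μ (qball d i.1.1 i.1.2)} = univ :=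
      eq_univ_of_forall hm
    rw [this] at hfin
    exact finite_coe_iff.1 (finite_univ_iff.1 hfin)
  classical
  refine ⟨huf.toFinset.image Prod.fst, eq_univ_of_forall fun x => ?_⟩
  obtain ⟨b, hb, hsub⟩ := hcov (x, r) ⟨mem_univ _, rfl⟩
  have hx := hsub (H.mem_self hr0)
  rw [hur b hb, hr, mul_div_cancel₀ _ (by positivity)] at hx
  simp only [Finset.mem_image, Finite.mem_toFinset, mem_iUnion]
  exact ⟨b.1, ⟨b, hb, rfl⟩, hx⟩

end DoublingSpace

omit [MeasurableSpace X] in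
lemma le_qdiam (hbdd : BddAbove (range fun z : X × X => d z.1 z.2)) (x y : X) :
    d x y ≤ qdiam d :=
  le_ciSup hbdd (x, y)

namespace IsHomogeneousType

variable [TopologicalSpace X] (hX : IsHomogeneousType d μ)
  (hbdd : BddAbove (range fun z : X × X => d z.1 z.2))

include hX in
lemma ball_pos (hD : 0 < qdiam d) (x : X) {r : ℝ} (hr : 0 < r) : 0 < μ (qball d x r) := by
  obtain ⟨c, hc, hann⟩ := hX.annulus_pos
  have hcD : 0 < c * qdiam d := by positivity
  have hm : 0 < min r (c * qdiam d) := lt_min hr hcD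
  refine (hann x (min r (c * qdiam d) / 4) (min r (c * qdiam d) / 2) (by positivity)
    (by linarith) ?_).trans_le (measure_mono (sdiff_subset.trans (qball_mono ?_)))
  · linarith [min_le_right r (c * qdiam d)]
  · linarith [min_le_left r (c * qdiam d)]

include hX hbdd in
lemma isFiniteMeasure (hD : 0 < qdiam d) : IsFiniteMeasure μ := by
  rcases isEmpty_or_nonempty X with h | ⟨⟨x⟩⟩
  · exact ⟨by simp [univ_eq_empty_iff.2 h]⟩
  · refine ⟨(measure_mono fun y _ => ?_).trans_lt (hX.measure_ball_lt_top x (2 * qdiam d)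
      (by positivity))⟩
    rw [mem_qball]
    linarith [le_qdiam hbdd x y]

include hX hbdd in
/-- A space of homogeneous type of positive finite diameter is a doubling space. -/
lemma exists_doublingSpace (hD : 0 < qdiam d) :
    ∃ (K : ℝ) (A : ℝ≥0∞), DoublingSpace d μ K (2 * qdiam d) A ∧
      ∀ x r, qdiam d ≤ r → μ univ ≤ A * μ (qball d x r) := by
  obtain ⟨Ct, -, ht⟩ := hX.quasi_triangle
  obtain ⟨Cs, -, hs⟩ := hX.quasi_symm
  obtain ⟨Cd, hd⟩ := hX.doubling
  have hd0 := hX.nonneg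
  have hbig : ∀ x r, qdiam d ≤ r → μ univ ≤ Cd * μ (qball d x r) := by
    intro x r hr
    calc μ univ ≤ μ (qball d x (2 * (3 / 4 * qdiam d))) := measure_mono fun y _ => by
          rw [mem_qball]; linarith [le_qdiam hbdd x y]
      _ ≤ Cd * μ (qball d x (3 / 4 * qdiam d)) := hd _ _ (by positivity) (by linarith)
      _ ≤ Cd * μ (qball d x r) :=
          mul_le_mul_right (measure_mono (qball_mono (by linarith))) _
  refine ⟨max 1 (max Ct Cs), Cd, ⟨fun x => (hX.eq_zero_iff x x).2 rfl,
    fun x y => (hX.eq_zero_iff x y).1, hd0, le_max_left _ _, fun x y z => (ht x y z).trans ?_,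
    fun x y => (hs x y).trans ?_, hX.measurable_dist, fun x y => ?_, by positivity,
    fun x r hr => hX.ball_pos hD x hr, fun x r hr => ?_, ENNReal.coe_ne_top⟩, hbig⟩
  · have := add_nonneg (hd0 x z) (hd0 z y)
    gcongr
    exact (le_max_left _ _).trans (le_max_right _ _)
  · have := hd0 y x
    gcongr
    exact (le_max_right _ _).trans (le_max_right _ _)
  · linarith [le_qdiam hbdd x y]
  · rcases lt_or_ge r (qdiam d) with h | h
    · exact hd x r hr h
    · exact (measure_mono (subset_univ _)).trans (hbig x r h)

end IsHomogeneousType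

/-- Integrals over the whole space are controlled by the integrals over balls. -/
lemma lintegral_le_card_mul {s : Finset X} {ρ : ℝ} (hs : ⋃ x ∈ s, qball d x ρ = univ)
    {g : X → ℝ≥0∞} {W : ℝ≥0∞} (hW : ∀ x, ∫⁻ y in qball d x ρ, g y ∂μ ≤ W) :
    ∫⁻ y, g y ∂μ ≤ s.card * W := by
  calc ∫⁻ y, g y ∂μ = ∫⁻ y in ⋃ x ∈ s, qball d x ρ, g y ∂μ := by rw [hs, setLIntegral_univ]
    _ ≤ ∑' x : s, ∫⁻ y in qball d x ρ, g y ∂μ := by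
        rw [← Set.iUnion_subtype (· ∈ s) fun x => qball d x ρ]
        exact lintegral_iUnion_le _ _
    _ ≤ ∑' _x : s, W := ENNReal.tsum_le_tsum fun x => hW x
    _ = s.card * W := by simp

/-- A bound of the Morrey norm, which involves only the balls of radius less than the diameter,
gives a bound on all balls. -/
lemma exists_morreyBound_of_morreyNorm_le [IsFiniteMeasure μ] (hD : 0 < qdiam d)
    (hpos : ∀ x r, 0 < r → 0 < μ (qball d x r))
    (hcov : ∃ s : Finset X, ⋃ x ∈ s, qball d x (qdiam d / 2) = univ)
    {A : ℝ≥0∞} (hA : A ≠ ∞) (hbig : ∀ x r, qdiam d ≤ r → μ univ ≤ A * μ (qball d x r)) :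
    ∃ C : ℝ≥0∞, C ≠ ∞ ∧ ∀ p l, 1 ≤ p → 0 ≤ l → l ≤ 1 → ∀ (g : X → ℝ≥0∞) (N : ℝ≥0∞),
      morreyNorm d μ p l g ≤ N → MorreyBound d μ g p l (C * N) := by
  obtain ⟨s, hs⟩ := hcov
  set C : ℝ≥0∞ := max 1 (s.card * max 1 A) with hC
  have hC1 : 1 ≤ C := le_max_left _ _
  refine ⟨C, (max_lt ENNReal.one_lt_top (ENNReal.mul_lt_top (by simp)
    (max_lt ENNReal.one_lt_top hA.lt_top))).ne, fun p l hp hl0 hl1 g N hN x r hr => ?_⟩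
  have hp0 : 0 < p := by linarith
  have hsmall : ∀ x r, 0 < r → r < qdiam d →
      ∫⁻ y in qball d x r, g y ^ p ∂μ ≤ N ^ p * μ (qball d x r) ^ l := by
    intro x r hr hrD
    have h1 : ((∫⁻ y in qball d x r, g y ^ p ∂μ) / μ (qball d x r) ^ l) ^ (1 / p) ≤ N := by
      refine le_trans ?_ hN
      exact le_iSup_of_le x (le_iSup₂_of_le r ⟨hr, hrD⟩ le_rfl)
    have h2 := ENNReal.rpow_le_rpow h1 hp0.le
    rw [← ENNReal.rpow_mul, one_div_mul_cancel hp0.ne', ENNReal.rpow_one,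
      ENNReal.div_le_iff_le_mul
        (Or.inl (ENNReal.rpow_pos (hpos x r hr) (measure_ne_top _ _)).ne')
        (Or.inl (ENNReal.rpow_ne_top_of_nonneg hl0 (measure_ne_top _ _)))] at h2
    exact h2
  have hCp : C ≤ C ^ p := ENNReal.le_rpow_self_of_one_le hC1 hp
  rw [ENNReal.mul_rpow_of_nonneg _ _ hp0.le]
  rcases lt_or_ge r (qdiam d) with hrD | hrD
  · refine (hsmall x r hr hrD).trans ?_
    gcongr
    exact le_mul_of_one_le_left' (hC1.trans hCp)
  · calc ∫⁻ y in qball d x r, g y ^ p ∂μ ≤ ∫⁻ y, g y ^ p ∂μ := setLIntegral_le_lintegral _ _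
      _ ≤ s.card * (N ^ p * μ univ ^ l) := lintegral_le_card_mul hs fun z =>
          (hsmall z _ (by positivity) (by linarith)).trans
            (mul_le_mul_right (ENNReal.rpow_le_rpow (measure_mono (subset_univ _)) hl0) _)
      _ ≤ s.card * (N ^ p * (max 1 A * μ (qball d x r) ^ l)) := by
          refine mul_le_mul_right (mul_le_mul_right ?_ _) _
          refine (ENNReal.rpow_le_rpow (hbig x r hrD) hl0).trans ?_
          rw [ENNReal.mul_rpow_of_nonneg _ _ hl0]
          refine mul_le_mul_left ?_ _
          exact (ENNReal.rpow_le_rpow (le_max_right 1 A) hl0).trans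
            (rpow_le_self_of_one_le (le_max_left _ _) hl1)
      _ = s.card * max 1 A * N ^ p * μ (qball d x r) ^ l := by ring
      _ ≤ C ^ p * N ^ p * μ (qball d x r) ^ l :=
          mul_le_mul_left (mul_le_mul_left ((le_max_right _ _).trans hCp) _) _

/-- The converse passage, from `MorreyBound` to the Morrey norm. -/
lemma morreyNorm_le_of_morreyBound [IsFiniteMeasure μ]
    (hpos : ∀ x r, 0 < r → 0 < μ (qball d x r)) {p l : ℝ} (hp : 0 < p) (hl : 0 ≤ l)
    {g : X → ℝ≥0∞} {N : ℝ≥0∞} (hN : MorreyBound d μ g p l N) : morreyNorm d μ p l g ≤ N := by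
  refine iSup_le fun x => iSup₂_le fun r hr => ?_
  have h2 : (∫⁻ y in qball d x r, g y ^ p ∂μ) / μ (qball d x r) ^ l ≤ N ^ p := by
    rw [ENNReal.div_le_iff_le_mul
        (Or.inl (ENNReal.rpow_pos (hpos x r hr.1) (measure_ne_top _ _)).ne')
        (Or.inl (ENNReal.rpow_ne_top_of_nonneg hl (measure_ne_top _ _)))]
    exact hN x r hr.1
  refine (ENNReal.rpow_le_rpow h2 (by positivity)).trans (le_of_eq ?_)
  rw [← ENNReal.rpow_mul, mul_one_div_cancel hp.ne', ENNReal.rpow_one]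

/-- Functions of bounded mean oscillation are integrable over a bounded space. -/
lemma MemBMO.integrable (hD : 0 < qdiam d)
    (hcov : ∃ s : Finset X, ⋃ x ∈ s, qball d x (qdiam d / 2) = univ) {b : X → ℝ}
    (hb : MemBMO d μ b) : Integrable b μ := by
  obtain ⟨s, hs⟩ := hcov
  rw [← integrableOn_univ, ← hs, integrableOn_finset_iUnion]
  exact fun x _ => hb.2.1 x _ (by positivity) (by linarith)

/-- The mean oscillation of a function of `BMO` is bounded on all balls. -/
lemma MemBMO.exists_osc [IsFiniteMeasure μ] (hD : 0 < qdiam d)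
    (hpos : ∀ x r, 0 < r → 0 < μ (qball d x r))
    (hcov : ∃ s : Finset X, ⋃ x ∈ s, qball d x (qdiam d / 2) = univ)
    {A : ℝ≥0∞} (hA : A ≠ ∞) (hbig : ∀ x r, qdiam d ≤ r → μ univ ≤ A * μ (qball d x r))
    {b : X → ℝ} (hb : MemBMO d μ b) : ∃ N : ℝ≥0∞, N ≠ ∞ ∧
      ∀ x r, 0 < r → ∃ c : ℝ, ∫⁻ y in qball d x r, ‖b y - c‖ₑ ∂μ ≤ N * μ (qball d x r) := by
  have hint := hb.integrable hD hcov
  rcases isEmpty_or_nonempty X with h | ⟨⟨x₀⟩⟩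
  · exact ⟨0, by simp, fun x => h.elim x⟩
  have hμ : μ univ ≠ 0 :=
    ((hpos x₀ 1 one_pos).trans_le (measure_mono (subset_univ _))).ne'
  set W := ∫⁻ y, ‖b y‖ₑ ∂μ with hW
  have hWt : W ≠ ∞ := hint.2.ne
  refine ⟨max (bmoNorm d μ b) (W / μ univ * A), (max_lt hb.2.2 (ENNReal.mul_lt_top
    (ENNReal.div_lt_top hWt hμ) hA.lt_top)).ne, fun x r hr => ?_⟩
  rcases lt_or_ge r (qdiam d) with hrD | hrD
  · refine ⟨⨍ z in qball d x r, b z ∂μ, ?_⟩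
    rw [← ENNReal.div_le_iff_le_mul (Or.inl (hpos x r hr).ne') (Or.inl (measure_ne_top _ _))]
    refine le_trans ?_ (le_max_left _ _)
    exact le_iSup_of_le x (le_iSup₂_of_le r ⟨hr, hrD⟩ le_rfl)
  · refine ⟨0, ?_⟩
    simp only [sub_zero]
    calc ∫⁻ y in qball d x r, ‖b y‖ₑ ∂μ ≤ W := setLIntegral_le_lintegral _ _
      _ = W / μ univ * μ univ := (ENNReal.div_mul_cancel hμ (measure_ne_top _ _)).symm
      _ ≤ W / μ univ * (A * μ (qball d x r)) := mul_le_mul_right (hbig x r hrD) _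
      _ = W / μ univ * A * μ (qball d x r) := by ring
      _ ≤ _ := mul_le_mul_left (le_max_right _ _) _

end Transfer

/-! ### Exponents, weights and the reduction to small parameters -/

section Exponents

/-- The function `φ̄` is defined so that the exponents `p - φ̄(ε)` and `q - ε` are related as in
Adams' theorem for the Morrey parameter `l - A₂(ε)`. -/
lemma sub_phiBar {p q α l ε : ℝ} {A₂ : ℝ → ℝ} (hα : 0 < α) (hl : l < 1) (hε : ε < q)
    (hA : 0 ≤ A₂ ε) :
    p - phiBar p q α l A₂ ε = (1 / (q - ε) + α / (1 - l + A₂ ε))⁻¹ := by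
  have h1 : 0 < q - ε := by linarith
  have h2 : 0 < 1 - l + A₂ ε := by linarith
  have h3 : 0 < 1 - l + A₂ ε - α * (ε - q) := by nlinarith
  have h4 : 1 / (q - ε) + α / (1 - l + A₂ ε) =
      (1 - l + A₂ ε - α * (ε - q)) / ((q - ε) * (1 - l + A₂ ε)) := by
    field_simp
    ring
  rw [h4, inv_div, phiBar]
  field_simp
  ring

/-- A function with limit `0` at `0+` whose derivative has limit `B < B'` at `0+` is eventually
below `x ↦ B' x`. -/
lemma eventually_le_mul_of_tendsto_deriv {A : ℝ → ℝ} {B B' δ : ℝ} (hδ : 0 < δ)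
    (hA : ContDiffOn ℝ 1 A (Ioc 0 δ)) (hlim : Tendsto A (𝓝[>] 0) (𝓝 0))
    (hderiv : Tendsto (deriv A) (𝓝[>] 0) (𝓝 B)) (hB : B < B') :
    ∀ᶠ ε in 𝓝[>] (0 : ℝ), A ε ≤ B' * ε := by
  obtain ⟨u, hu, hsub⟩ := mem_nhdsGT_iff_exists_Ioo_subset.1 (hderiv.eventually_lt_const hB)
  have hu0 : (0 : ℝ) < u := hu
  have hm : 0 < min u δ := lt_min hu0 hδ
  have hdiff : DifferentiableOn ℝ A (Ioo 0 (min u δ)) :=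
    (hA.differentiableOn one_ne_zero).mono fun x hx =>
      ⟨hx.1, (hx.2.trans_le (min_le_right _ _)).le⟩
  filter_upwards [Ioo_mem_nhdsGT hm] with ε hε
  have hineq : ∀ᶠ s in 𝓝[>] (0 : ℝ), A ε - A s ≤ B' * (ε - s) := by
    filter_upwards [Ioo_mem_nhdsGT hε.1] with s hs
    refine (convex_Ioo 0 (min u δ)).image_sub_le_mul_sub_of_deriv_le hdiff.continuousOn
      (by rwa [interior_Ioo]) (fun x hx => ?_) s ⟨hs.1, hs.2.trans hε.2⟩ ε hε hs.2.le
    rw [interior_Ioo] at hx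
    exact le_of_lt (hsub ⟨hx.1, hx.2.trans_le (min_le_left _ _)⟩)
  have hl : Tendsto (fun s => A ε - A s) (𝓝[>] 0) (𝓝 (A ε - 0)) := tendsto_const_nhds.sub hlim
  have hr : Tendsto (fun s : ℝ => B' * (ε - s)) (𝓝[>] 0) (𝓝 (B' * (ε - 0))) :=
    (Continuous.tendsto (by fun_prop) 0).mono_left nhdsWithin_le_nhds
  simpa using le_of_tendsto_of_tendsto hl hr hineq

/-- Two-sided control of the shift of the first exponent in terms of the shift `ε` of the second
one. The lower bound is linear in `ε` because the growth of `A₂` is below the critical rate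
`(1 - l)² / (α q²)`. -/
lemma one_div_sub_one_div_bounds {p q α l ε a B' P : ℝ} (hq : 0 < q) (hα : 0 < α) (hl : l < 1)
    (hε : 0 < ε) (hεq : ε < q) (ha : 0 ≤ a) (haB : a ≤ B' * ε)
    (hp : 1 / p = 1 / q + α / (1 - l)) (hP : 1 / P = 1 / (q - ε) + α / (1 - l + a)) :
    (1 / q ^ 2 - α * B' / (1 - l) ^ 2) * ε ≤ 1 / P - 1 / p ∧
      1 / P - 1 / p ≤ 1 / (q - ε) - 1 / q := by
  have h1 : 0 < q - ε := by linarith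
  have h2 : 0 < 1 - l := by linarith
  have h3 : 0 < 1 - l + a := by linarith
  have e1 : 1 / (q - ε) - 1 / q = ε / (q * (q - ε)) := by field_simp; ring
  have e2 : α / (1 - l) - α / (1 - l + a) = α * a / ((1 - l) * (1 - l + a)) := by
    field_simp; ring
  have i1 : ε / q ^ 2 ≤ ε / (q * (q - ε)) := by
    gcongr
    nlinarith
  have i2 : α * a / ((1 - l) * (1 - l + a)) ≤ α * (B' * ε) / (1 - l) ^ 2 := by
    have : 0 ≤ B' * ε := ha.trans haB
    gcongr
    nlinarith
  have i3 : 0 ≤ α * a / ((1 - l) * (1 - l + a)) := by positivity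
  constructor
  · have e3 : (1 / q ^ 2 - α * B' / (1 - l) ^ 2) * ε =
        ε / q ^ 2 - α * (B' * ε) / (1 - l) ^ 2 := by ring
    linarith
  · linarith

/-- For small `ε` the exponents `p - φ̄(ε)`, `q - ε`, `l - A₂(ε)` are admissible in Adams' theorem,
with uniform bounds, and `φ̄(ε)` is at least a multiple of `ε`. -/
lemma exists_adamsExponents {p q α l B : ℝ} (hp : 1 < p) (hl0 : 0 < l) (hl1 : l < 1)
    (hα0 : 0 < α) (hα : α < (1 - l) / p) (hpq : 1 / p - 1 / q = α / (1 - l)) {A₁ A₂ : ℝ → ℝ}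
    (hA₂nonneg : ∀ x ∈ Ioc 0 (q - 1), 0 ≤ A₂ x)
    (hA₂C1 : ∃ δ : ℝ, 0 < δ ∧ ContDiffOn ℝ 1 A₂ (Ioc 0 δ))
    (hA₂lim : Tendsto A₂ (𝓝[>] 0) (𝓝 0))
    (hA₂deriv : Tendsto (deriv A₂) (𝓝[>] 0) (𝓝 B))
    (hB : B < (1 - l) ^ 2 / (α * q ^ 2))
    (hA₁ : ∃ δ : ℝ, 0 < δ ∧ InjOn (phiBar p q α l A₂) (Ioc 0 δ) ∧
      ∀ η ∈ phiBar p q α l A₂ '' Ioc 0 δ,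
        A₁ η = A₂ (Function.invFunOn (phiBar p q α l A₂) (Ioc 0 δ) η)) :
    ∃ σ κ : ℝ, 0 < σ ∧ σ ≤ 1 ∧ σ < q - 1 ∧ 0 < κ ∧ κ ≤ 1 ∧ ∀ ε, 0 < ε → ε ≤ σ → ∃ η, 0 < η ∧
      η < sMax p l A₁ ∧ κ * ε ≤ η ∧ A₁ η = A₂ ε ∧
      AdamsExponents α ((1 + p) / 2) q l (p - η) (q - ε) (l - A₂ ε) := by
  have hp0 : 0 < p := by linarith
  have hl : 0 < 1 - l := by linarith
  have hq' : 0 < 1 / q := by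
    have : α / (1 - l) < 1 / p := by
      rw [div_lt_div_iff₀ hl hp0]; rw [lt_div_iff₀ hp0] at hα; linarith
    linarith
  have hq0 : 0 < q := one_div_pos.1 hq'
  have hpq' : p < q := by
    refine (one_div_lt_one_div hq0 hp0).1 ?_
    have : 0 < α / (1 - l) := by positivity
    linarith
  have hq1 : 1 < q := by linarith
  obtain ⟨B', hBB, hB'⟩ := exists_between hB
  set κ₀ := 1 / q ^ 2 - α * B' / (1 - l) ^ 2 with hκ₀
  have hκ₀pos : 0 < κ₀ := by
    rw [hκ₀, sub_pos, div_lt_div_iff₀ (by positivity) (by positivity)]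
    rw [lt_div_iff₀ (by positivity)] at hB'
    linarith
  obtain ⟨δ₁, hδ₁, hC1⟩ := hA₂C1
  obtain ⟨δ, hδ, hinj, hA₁⟩ := hA₁
  have hsmall := eventually_le_mul_of_tendsto_deriv hδ₁ hC1 hA₂lim hA₂deriv hBB
  have hcont : Tendsto (fun ε => 1 / (q - ε)) (𝓝[>] 0) (𝓝 (1 / q)) := by
    have : ContinuousAt (fun ε => 1 / (q - ε)) 0 := by
      refine ContinuousAt.div continuousAt_const (by fun_prop) ?_
      simpa using hq0.ne'
    simpa using this.tendsto.mono_left nhdsWithin_le_nhds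
  -- The properties of `φ̄(ε)` that need only smallness of `ε`.
  have hgood : ∀ᶠ ε in 𝓝[>] (0 : ℝ), κ₀ * ε ≤ phiBar p q α l A₂ ε ∧ 0 < phiBar p q α l A₂ ε ∧
      phiBar p q α l A₂ ε ≤ p ^ 2 * (1 / (q - ε) - 1 / q) ∧ A₁ (phiBar p q α l A₂ ε) = A₂ ε ∧
      AdamsExponents α ((1 + p) / 2) q l (p - phiBar p q α l A₂ ε) (q - ε) (l - A₂ ε) := by
    have hev : ∀ᶠ ε in 𝓝[>] (0 : ℝ), 1 / (q - ε) < 1 / ((1 + p) / 2) - α / (1 - l) := by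
      refine hcont.eventually_lt_const ?_
      have : 1 / p < 1 / ((1 + p) / 2) := one_div_lt_one_div_of_lt (by linarith) (by linarith)
      linarith
    filter_upwards [hsmall, hev, hA₂lim.eventually_le_const hl0,
      Ioo_mem_nhdsGT (show (0 : ℝ) < q - 1 by linarith), Ioc_mem_nhdsGT hδ]
      with ε haB hp₀ hal hεq hεδ
    have ha : 0 ≤ A₂ ε := hA₂nonneg ε ⟨hεq.1, hεq.2.le⟩
    have hεq' : ε < q := by linarith [hεq.2]
    have hqε : 0 < q - ε := by linarith
    have hL : 0 < 1 - l + A₂ ε := by linarith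
    set η := phiBar p q α l A₂ ε with hη
    have hP := sub_phiBar (p := p) hα0 hl1 hεq' ha
    rw [← hη] at hP
    have hPpos : 0 < p - η := by rw [hP]; positivity
    have hP1 : 1 / (p - η) = 1 / (q - ε) + α / (1 - l + A₂ ε) := by rw [hP, one_div, inv_inv]
    obtain ⟨hlow, hup⟩ := one_div_sub_one_div_bounds (p := p) hq0 hα0 hl1 hεq.1 hεq' ha haB
      (by linarith) hP1
    have hκε : 0 < κ₀ * ε := mul_pos hκ₀pos hεq.1
    have hdiff : η = p * (p - η) * (1 / (p - η) - 1 / p) := by field_simp; ring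
    have hP₀ : (1 + p) / 2 ≤ p - η := by
      refine (one_div_le_one_div hPpos (by linarith)).1 ?_
      have : α / (1 - l + A₂ ε) ≤ α / (1 - l) := by gcongr; linarith
      linarith
    have hPp1 : 1 ≤ p * (p - η) := by nlinarith
    have hηlow : κ₀ * ε ≤ η := by
      rw [hdiff]
      calc κ₀ * ε ≤ 1 / (p - η) - 1 / p := hlow
        _ ≤ p * (p - η) * (1 / (p - η) - 1 / p) :=
            le_mul_of_one_le_left (hκε.le.trans hlow) hPp1
    have hη0 : 0 < η := hκε.trans_le hηlow
    refine ⟨hηlow, hη0, ?_, ?_, ⟨hP₀, hqε, by linarith [hεq.1], by linarith, by linarith, ?_⟩⟩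
    · calc η = p * (p - η) * (1 / (p - η) - 1 / p) := hdiff
        _ ≤ p ^ 2 * (1 / (p - η) - 1 / p) := by
            have := hκε.le.trans hlow
            gcongr
            nlinarith
        _ ≤ p ^ 2 * (1 / (q - ε) - 1 / q) := mul_le_mul_of_nonneg_left hup (by positivity)
    · rw [hA₁ η ⟨ε, hεδ, rfl⟩, hη, hinj.leftInvOn_invFunOn hεδ]
    · rw [hP1]; ring
  have hzero : Tendsto (fun ε => p ^ 2 * (1 / (q - ε) - 1 / q)) (𝓝[>] 0) (𝓝 0) := by
    simpa using (hcont.sub_const (1 / q)).const_mul (p ^ 2)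
  -- A fixed value `η₁` of `φ̄` in the set defining `s_max`.
  obtain ⟨ε₁, ⟨-, hη₁0, hη₁up, hA₁η₁, hadm₁⟩, hε₁p⟩ :=
    (hgood.and (hzero.eventually_le_const (show (0 : ℝ) < p - 1 by linarith))).exists
  set η₁ := phiBar p q α l A₂ ε₁ with hη₁
  have hη₁p : η₁ ≤ p - 1 := hη₁up.trans hε₁p
  have hmax : η₁ ≤ sMax p l A₁ := by
    refine le_min hη₁p (le_csSup ⟨p - 1, fun x hx => hx.1.2⟩ ⟨⟨hη₁0, hη₁p⟩, ?_⟩)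
    rw [hA₁η₁]
    linarith [hadm₁.l_nonneg]
  obtain ⟨σ₀, hσ₀, hsub⟩ := mem_nhdsGT_iff_exists_Ioc_subset.1
    (hgood.and (hzero.eventually_lt_const hη₁0))
  refine ⟨min σ₀ (min 1 ((q - 1) / 2)), min 1 κ₀,
    lt_min hσ₀ (lt_min one_pos (by linarith)), (min_le_right _ _).trans (min_le_left _ _),
    ((min_le_right _ _).trans (min_le_right _ _)).trans_lt (by linarith),
    lt_min one_pos hκ₀pos, min_le_left _ _, fun ε hε hεσ => ?_⟩
  obtain ⟨⟨h1, h2, h3, h4, h5⟩, h6⟩ := hsub ⟨hε, hεσ.trans (min_le_left _ _)⟩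
  exact ⟨phiBar p q α l A₂ ε, h2, (h3.trans_lt h6).trans_le hmax,
    (mul_le_mul_of_nonneg_right (min_le_right _ _) hε.le).trans h1, h4, h5⟩

/-- Comparison of the weights `ε^{θ₂/(q-ε)}` and `η^{θ₁/(p-η)}` of the two grand norms. -/
lemma weight_le {p' q' q α l l' θ₁ θ₂ ε η κ : ℝ} (hp' : 1 < p') (hq' : 0 < q') (hq'q : q' ≤ q)
    (hl : l < 1) (hl' : l' ≤ l) (hα : 0 < α) (hrel : 1 / p' - 1 / q' = α / (1 - l'))
    (hθ₁ : 0 < θ₁) (hθ₂ : θ₁ * (1 + α * q / (1 - l)) ≤ θ₂) (hε : 0 < ε) (hε1 : ε ≤ 1)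
    (hη : 0 < η) (hκ : 0 < κ) (hκ1 : κ ≤ 1) (hκε : κ * ε ≤ η) :
    ENNReal.ofReal (ε ^ θ₂) ^ (1 / q') ≤
      ENNReal.ofReal (κ ^ (-θ₁)) * ENNReal.ofReal (η ^ θ₁) ^ (1 / p') := by
  have hl0 : 0 < 1 - l := by linarith
  have hl'0 : 0 < 1 - l' := by linarith
  have hp0 : 0 < p' := by linarith
  have hq0 : 0 < q := by linarith
  rw [ENNReal.ofReal_rpow_of_pos (by positivity), ENNReal.ofReal_rpow_of_pos (by positivity),
    ← Real.rpow_mul hε.le, ← Real.rpow_mul hη.le, ← ENNReal.ofReal_mul (by positivity)]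
  refine ENNReal.ofReal_le_ofReal ?_
  have hexp : θ₁ * (1 / p') ≤ θ₂ * (1 / q') := by
    have e1 : 1 / p' = 1 / q' + α / (1 - l') := by linarith
    have e2 : θ₁ * (1 / q' + α / (1 - l')) = θ₁ * (1 + α * q' / (1 - l')) * (1 / q') := by
      field_simp
    rw [e1, e2]
    gcongr
    refine le_trans ?_ hθ₂
    gcongr
  have hz0 : 0 ≤ θ₁ * (1 / p') := by positivity
  have hz1 : θ₁ * (1 / p') ≤ θ₁ := by
    rw [mul_one_div]; exact div_le_self hθ₁.le hp'.le
  have hεη : ε ≤ κ⁻¹ * η := by rw [inv_mul_eq_div, le_div_iff₀ hκ]; linarith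
  calc ε ^ (θ₂ * (1 / q')) ≤ ε ^ (θ₁ * (1 / p')) := Real.rpow_le_rpow_of_exponent_ge hε hε1 hexp
    _ ≤ (κ⁻¹ * η) ^ (θ₁ * (1 / p')) := Real.rpow_le_rpow hε.le hεη hz0
    _ = κ ^ (-(θ₁ * (1 / p'))) * η ^ (θ₁ * (1 / p')) := by
        rw [Real.mul_rpow (by positivity) hη.le, Real.inv_rpow hκ.le, Real.rpow_neg hκ.le]
    _ ≤ κ ^ (-θ₁) * η ^ (θ₁ * (1 / p')) := by
        gcongr ?_ * _
        exact Real.rpow_le_rpow_of_exponent_ge hκ hκ1 (by linarith)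

end Exponents

section Reduction

variable {X : Type*} [MeasurableSpace X] {d : X → X → ℝ} {μ : Measure X}

/-- Hölder's inequality for Morrey norms on a space of finite measure. -/
lemma morreyNorm_le_of_le [IsFiniteMeasure μ] (hpos : ∀ x r, 0 < r → 0 < μ (qball d x r))
    {s t k m : ℝ} (hs : 1 ≤ s) (hst : s ≤ t) (hk : 0 ≤ k) (hkm : k ≤ m) (hm : m ≤ 1)
    {g : X → ℝ≥0∞} (hg : AEMeasurable g μ) :
    morreyNorm d μ s k g ≤ max 1 (μ univ) * morreyNorm d μ t m g := by
  have hs0 : 0 < s := by linarith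
  have ht0 : 0 < t := by linarith
  refine iSup_le fun x => iSup₂_le fun r hr => ?_
  set v := μ (qball d x r) with hv
  have hv0 : v ≠ 0 := (hpos x r hr.1).ne'
  have hvt : v ≠ ∞ := measure_ne_top _ _
  have h1 := lintegral_rpow_le_of_le (ν := μ.restrict (qball d x r)) hs0 hst hg.restrict
  rw [Measure.restrict_apply_univ, ← hv] at h1
  have h2 : ((∫⁻ y in qball d x r, g y ^ t ∂μ) / v ^ m) ^ (1 / t) ≤ morreyNorm d μ t m g :=
    le_iSup_of_le x (le_iSup₂_of_le r hr le_rfl)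
  have he0 : 0 ≤ (1 - k) / s - (1 - m) / t := by
    rw [sub_nonneg]
    have : 0 ≤ 1 - k := by linarith
    gcongr
  have he1 : (1 - k) / s - (1 - m) / t ≤ 1 := by
    have e1 : (1 - k) / s ≤ 1 := by rw [div_le_one hs0]; linarith
    have e2 : 0 ≤ (1 - m) / t := div_nonneg (by linarith) ht0.le
    linarith
  have h3 : v ^ ((1 - k) / s - (1 - m) / t) ≤ max 1 (μ univ) :=
    (ENNReal.rpow_le_rpow ((measure_mono (subset_univ _)).trans (le_max_right 1 (μ univ)))
      he0).trans (rpow_le_self_of_one_le (le_max_left _ _) he1)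
  have key : ∀ (a : ℝ≥0∞) (z w : ℝ), 0 < z →
      (a / v ^ w) ^ (1 / z) = a ^ (1 / z) * v ^ (-(w / z)) := by
    intro a z w hz
    rw [ENNReal.div_rpow_of_nonneg _ _ (by positivity), div_eq_mul_inv, ← ENNReal.rpow_mul,
      ← ENNReal.rpow_neg, mul_one_div]
  calc ((∫⁻ y in qball d x r, g y ^ s ∂μ) / v ^ k) ^ (1 / s)
      = (∫⁻ y in qball d x r, g y ^ s ∂μ) ^ (1 / s) * v ^ (-(k / s)) := key _ _ _ hs0
    _ ≤ (∫⁻ y in qball d x r, g y ^ t ∂μ) ^ (1 / t) * v ^ (1 / s - 1 / t) * v ^ (-(k / s)) :=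
        mul_le_mul_left h1 _
    _ = v ^ ((1 - k) / s - (1 - m) / t) *
        ((∫⁻ y in qball d x r, g y ^ t ∂μ) ^ (1 / t) * v ^ (-(m / t))) := by
        rw [mul_assoc, ← ENNReal.rpow_add _ _ hv0 hvt, mul_left_comm,
          ← ENNReal.rpow_add _ _ hv0 hvt]
        congr 2
        ring
    _ = v ^ ((1 - k) / s - (1 - m) / t) *
        ((∫⁻ y in qball d x r, g y ^ t ∂μ) / v ^ m) ^ (1 / t) := by rw [key _ _ _ ht0]
    _ ≤ _ := mul_le_mul' h3 h2

/-- A bound of the terms of the grand Morrey norm for small `ε` bounds the whole norm. -/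
lemma exists_grandMorreyNormPow_le [IsFiniteMeasure μ]
    (hpos : ∀ x r, 0 < r → 0 < μ (qball d x r)) {q l θ σ : ℝ} (hl1 : l < 1)
    (hθ : 0 < θ) {A : ℝ → ℝ} (hAnonneg : ∀ x ∈ Ioc 0 (q - 1), 0 ≤ A x)
    (hAmono : MonotoneOn A (Ioc 0 (q - 1))) (hσ0 : 0 < σ) (hσq : σ < q - 1) :
    ∃ C : ℝ≥0∞, C ≠ ∞ ∧ ∀ (g : X → ℝ≥0∞) (W : ℝ≥0∞), AEMeasurable g μ →
      (∀ ε, 0 < ε → ε ≤ σ →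
        ENNReal.ofReal (ε ^ θ) ^ (1 / (q - ε)) * morreyNorm d μ (q - ε) (l - A ε) g ≤ W) →
      grandMorreyNormPow d μ q l θ A g ≤ C * W := by
  set w := ENNReal.ofReal (σ ^ θ) ^ (1 / (q - σ)) with hw
  have hw0 : w ≠ 0 := (ENNReal.rpow_pos (ENNReal.ofReal_pos.2 (by positivity))
    ENNReal.ofReal_ne_top).ne'
  have hwt : w ≠ ∞ := ENNReal.rpow_ne_top_of_nonneg
    (one_div_nonneg.2 (by linarith)) ENNReal.ofReal_ne_top
  set M := max 1 (μ univ) with hM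
  have hMt : M ≠ ∞ := (max_lt ENNReal.one_lt_top (measure_lt_top _ _)).ne
  refine ⟨max 1 (ENNReal.ofReal (q ^ θ) * (M * w⁻¹)), (max_lt ENNReal.one_lt_top
    (ENNReal.mul_lt_top ENNReal.ofReal_lt_top (ENNReal.mul_lt_top hMt.lt_top
      (ENNReal.inv_lt_top.2 (pos_iff_ne_zero.2 hw0))))).ne, fun g W hg hW => ?_⟩
  refine iSup₂_le fun ε hε => ?_
  rcases le_or_gt ε σ with h | h
  · exact (hW ε hε.1 h).trans (le_mul_of_one_le_left' (le_max_left _ _))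
  have hεq : ε < q - 1 := hε.2.trans_le (min_le_left _ _)
  have hεS : ε < sSup {x | x ∈ Ioc 0 (q - 1) ∧ A x ≤ l} := hε.2.trans_le (min_le_right _ _)
  have hne : {x | x ∈ Ioc 0 (q - 1) ∧ A x ≤ l}.Nonempty := by
    by_contra hem
    rw [not_nonempty_iff_eq_empty.1 hem, Real.sSup_empty] at hεS
    linarith [hε.1]
  obtain ⟨x, ⟨hx, hxl⟩, hεx⟩ := exists_lt_of_lt_csSup hne hεS
  have hεmem : ε ∈ Ioc 0 (q - 1) := ⟨hε.1, hεq.le⟩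
  have hσmem : σ ∈ Ioc 0 (q - 1) := ⟨hσ0, hσq.le⟩
  have h1 : A ε ≤ l := (hAmono hεmem hx hεx.le).trans hxl
  have h2 : A σ ≤ A ε := hAmono hσmem hεmem h.le
  have h3 := morreyNorm_le_of_le (d := d) (μ := μ) hpos (s := q - ε) (t := q - σ) (k := l - A ε)
    (m := l - A σ) (by linarith) (by linarith) (by linarith) (by linarith)
    (by linarith [hAnonneg σ hσmem]) hg
  have h4 : morreyNorm d μ (q - σ) (l - A σ) g ≤ w⁻¹ * W := by
    calc morreyNorm d μ (q - σ) (l - A σ) g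
        = w⁻¹ * (w * morreyNorm d μ (q - σ) (l - A σ) g) := by
          rw [← mul_assoc, ENNReal.inv_mul_cancel hw0 hwt, one_mul]
      _ ≤ w⁻¹ * W := mul_le_mul_right (hW σ hσ0 le_rfl) _
  have h5 : ENNReal.ofReal (ε ^ θ) ^ (1 / (q - ε)) ≤ ENNReal.ofReal (q ^ θ) := by
    have hε0 := hε.1
    have hq1 : 1 < q := by linarith
    rw [ENNReal.ofReal_rpow_of_pos (by positivity), ← Real.rpow_mul hε0.le]
    refine ENNReal.ofReal_le_ofReal ?_
    have hz : θ * (1 / (q - ε)) ≤ θ := by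
      rw [mul_one_div]; exact div_le_self hθ.le (by linarith)
    have hz0 : 0 ≤ θ * (1 / (q - ε)) := mul_nonneg hθ.le (one_div_nonneg.2 (by linarith))
    exact (Real.rpow_le_rpow hε0.le (by linarith) hz0).trans
      (Real.rpow_le_rpow_of_exponent_le hq1.le hz)
  calc ENNReal.ofReal (ε ^ θ) ^ (1 / (q - ε)) * morreyNorm d μ (q - ε) (l - A ε) g
      ≤ ENNReal.ofReal (q ^ θ) * (M * (w⁻¹ * W)) :=
        mul_le_mul' h5 (h3.trans (mul_le_mul_right h4 _))
    _ = ENNReal.ofReal (q ^ θ) * (M * w⁻¹) * W := by ring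
    _ ≤ _ := mul_le_mul_left (le_max_right _ _) _

end Reduction

/-! ### The potential operator, its commutator and measurability -/

section Operators

variable {X : Type*} [MeasurableSpace X] {d : X → X → ℝ} {μ : Measure X}

lemma potentialIntegrand_congr_ae {α : ℝ} {f f' : X → ℝ} (h : f =ᵐ[μ] f') (x : X) :
    potentialIntegrand d μ α f x =ᵐ[μ] potentialIntegrand d μ α f' x := by
  filter_upwards [h] with y hy
  rw [potentialIntegrand, potentialIntegrand, hy]

lemma commutator_congr_ae {α : ℝ} {b b' f f' : X → ℝ} (hb : b =ᵐ[μ] b') (hf : f =ᵐ[μ] f') :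
    commutator b (potential d μ α) f =ᵐ[μ] commutator b' (potential d μ α) f' := by
  filter_upwards [hb] with x hx
  have h1 := integral_congr_ae (potentialIntegrand_congr_ae (d := d) (α := α) hf x)
  have h2 := integral_congr_ae (potentialIntegrand_congr_ae (d := d) (α := α) (hb.mul hf) x)
  rw [commutator, commutator, hx]
  exact congrArg₂ _ (congrArg _ h1) h2

lemma maximalFn_eq_hlMax (g : X → ℝ) :
    maximalFn d μ g = hlMax d μ (qdiam d) (fun y => ‖g y‖ₑ) := rfl

lemma maximalFn_congr_ae {g g' : X → ℝ} (h : g =ᵐ[μ] g') :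
    maximalFn d μ g = maximalFn d μ g' := by
  funext x
  refine iSup_congr fun r => iSup_congr fun _ => ?_
  congr 1
  refine lintegral_congr_ae (ae_restrict_of_ae ?_)
  filter_upwards [h] with y hy
  rw [hy]

lemma MorreyBound.congr_ae {g g' : X → ℝ≥0∞} (h : g =ᵐ[μ] g') {p l : ℝ} {N : ℝ≥0∞}
    (hN : MorreyBound d μ g p l N) : MorreyBound d μ g' p l N := by
  intro x r hr
  refine le_trans (le_of_eq ?_) (hN x r hr)
  refine lintegral_congr_ae (ae_restrict_of_ae ?_)
  filter_upwards [h] with y hy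
  rw [hy]

lemma MorreyBound.of_ae_le_const_mul {g h : X → ℝ≥0∞} {p l : ℝ} {N C : ℝ≥0∞} (hp : 0 ≤ p)
    (hC : C ≠ ∞) (hN : MorreyBound d μ g p l N) (hh : ∀ᵐ x ∂μ, h x ≤ C * g x) :
    MorreyBound d μ h p l (C * N) := by
  intro x r hr
  calc ∫⁻ y in qball d x r, h y ^ p ∂μ ≤ ∫⁻ y in qball d x r, C ^ p * g y ^ p ∂μ := by
        refine lintegral_mono_ae (ae_restrict_of_ae ?_)
        filter_upwards [hh] with y hy
        rw [← ENNReal.mul_rpow_of_nonneg _ _ hp]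
        exact ENNReal.rpow_le_rpow hy hp
    _ = C ^ p * ∫⁻ y in qball d x r, g y ^ p ∂μ :=
        lintegral_const_mul' _ _ (ENNReal.rpow_ne_top_of_nonneg hp hC)
    _ ≤ C ^ p * (N ^ p * μ (qball d x r) ^ l) := mul_le_mul_right (hN x r hr) _
    _ = (C * N) ^ p * μ (qball d x r) ^ l := by
        rw [ENNReal.mul_rpow_of_nonneg _ _ hp, mul_assoc]

namespace HomSpace

variable {K R₀ E : ℝ} {A τ : ℝ≥0∞} (H : HomSpace d μ K R₀ E A τ) [IsFiniteMeasure μ]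
include H

lemma measurable_potentialIntegrand (α : ℝ) {f : X → ℝ} (hf : Measurable f) :
    Measurable (Function.uncurry (potentialIntegrand d μ α f)) := by
  have h1 : Measurable fun z : X × X => μ (qball d z.1 (d z.1 z.2)) :=
    H.measurable_measure_ball measurable_fst H.meas
  exact (hf.comp measurable_snd).div (h1.ennreal_toReal.pow_const _)

lemma measurable_potential (α : ℝ) {f : X → ℝ} (hf : Measurable f) :
    Measurable (potential d μ α f) :=
  (H.measurable_potentialIntegrand α hf).stronglyMeasurable.integral_prod_right.measurable

lemma measurable_commutator (α : ℝ) {b f : X → ℝ} (hb : Measurable b) (hf : Measurable f) :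
    Measurable (commutator b (potential d μ α) f) :=
  (hb.mul (H.measurable_potential α hf)).sub (H.measurable_potential α (hb.mul hf))

lemma ae_lt_top_of_morreyBound [Nonempty X] {g : X → ℝ≥0∞} (hg : Measurable g) {p l : ℝ} {N : ℝ≥0∞}
    (hp : 0 < p) (hl : 0 ≤ l) (hN : MorreyBound d μ g p l N) (hNt : N ≠ ∞) :
    ∀ᵐ x ∂μ, g x < ∞ := by
  obtain ⟨x₀⟩ := ‹Nonempty X›
  have h := hN x₀ R₀ H.R₀_pos
  rw [H.qball_eq_univ le_rfl, setLIntegral_univ] at h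
  have h1 : ∫⁻ y, g y ^ p ∂μ ≠ ∞ := ne_top_of_le_ne_top (ENNReal.mul_ne_top
    (ENNReal.rpow_ne_top_of_nonneg hp.le hNt)
    (ENNReal.rpow_ne_top_of_nonneg hl (measure_ne_top _ _))) h
  filter_upwards [ae_lt_top (hg.pow_const p) h1] with x hx
  exact (ENNReal.rpow_lt_top_iff_of_pos hp).1 hx

/-- At points where the discretized potentials are finite, the integrals in the commutator converge
and the commutator is dominated by its discretization. -/
lemma exists_commutator_le {α : ℝ} (hα : α < 1) {b : X → ℝ} (hb : Measurable b) :
    ∃ C : ℝ≥0∞, C ≠ ∞ ∧ ∀ f : X → ℝ, Measurable f → ∀ x,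
      dyPot d μ R₀ E 1 α (fun y => ‖f y‖ₑ) x < ∞ →
      dyPot d μ R₀ E 1 α (fun y => ‖b x - b y‖ₑ * ‖f y‖ₑ) x < ∞ →
      Integrable (potentialIntegrand d μ α f x) μ ∧
      Integrable (potentialIntegrand d μ α (fun y => b y * f y) x) μ ∧
      ‖commutator b (potential d μ α) f x‖ₑ ≤
        C * dyPot d μ R₀ E 1 α (fun y => ‖b x - b y‖ₑ * ‖f y‖ₑ) x := by
  obtain ⟨C, hC, hle⟩ := H.exists_lintegral_potential_le (α := α) hα
  refine ⟨C, hC, fun f hf x h1 h2 => ?_⟩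
  have hm : Measurable fun y => (b x - b y) * f y := (measurable_const.sub hb).mul hf
  have hint : ∀ g : X → ℝ, Measurable g → dyPot d μ R₀ E 1 α (fun y => ‖g y‖ₑ) x < ∞ →
      Integrable (potentialIntegrand d μ α g x) μ := fun g hg hfin =>
    ⟨((H.measurable_potentialIntegrand α hg).comp measurable_prodMk_left).aestronglyMeasurable,
      (hle g hg x).trans_lt (ENNReal.mul_lt_top hC.lt_top hfin)⟩
  have e0 : (fun y => ‖b x - b y‖ₑ * ‖f y‖ₑ) = fun y => ‖(b x - b y) * f y‖ₑ := by
    funext y; rw [enorm_mul]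
  rw [e0] at h2 ⊢
  have i1 := hint f hf h1
  have i2 := hint _ hm h2
  have e1 : potentialIntegrand d μ α (fun y => b y * f y) x = fun y =>
      b x * potentialIntegrand d μ α f x y -
        potentialIntegrand d μ α (fun y => (b x - b y) * f y) x y := by
    funext y
    simp only [potentialIntegrand]
    ring
  refine ⟨i1, ?_, ?_⟩
  · rw [e1]
    exact (i1.const_mul _).sub i2
  · have e2 : commutator b (potential d μ α) f x =
        ∫ y, potentialIntegrand d μ α (fun y => (b x - b y) * f y) x y ∂μ := by
      rw [commutator, potential, potential, e1, integral_sub (i1.const_mul _) i2,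
        integral_const_mul]
      ring
    rw [e2]
    exact (enorm_integral_le_lintegral_enorm _).trans (hle _ hm x)

/-- The maximal function of the commutator of a potential on Morrey spaces, with a bound that is
uniform in the exponents. -/
lemma exists_morrey_maximal_commutator [Nonempty X] {b : X → ℝ} (hb : Measurable b) {s t : ℝ}
    (hst : s.HolderConjugate t)
    {N₀ : ℝ≥0∞} (hN1 : 1 ≤ N₀) (hNt : N₀ ≠ ∞) (hosc : OscBound d μ b s N₀)
    {α p₀ q₁ l₁ : ℝ} (hα : 0 < α) (hα1 : α < 1) (hp₀ : 1 < p₀) (hl₁ : l₁ < 1)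
    (hq₁ : 1 < q₁) (hs : q₁ < s) (hs' : 1 / s < (1 - l₁) / q₁) (htp : t < p₀) :
    ∃ C : ℝ≥0∞, C ≠ ∞ ∧
    ∀ p q l, AdamsExponents α p₀ q₁ l₁ p q l → ∀ (f : X → ℝ) (N : ℝ≥0∞), Measurable f → N ≠ ∞ →
      MorreyBound d μ (fun x => ‖f x‖ₑ) p l N →
      (∀ᵐ x ∂μ, Integrable (potentialIntegrand d μ α f x) μ) ∧
      (∀ᵐ x ∂μ, Integrable (potentialIntegrand d μ α (fun y => b y * f y) x) μ) ∧
      MorreyBound d μ (hlMax d μ (R₀ + 1) fun x => ‖commutator b (potential d μ α) f x‖ₑ)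
        q l (C * N) := by
  obtain ⟨C₁, hC₁, hmor⟩ := H.exists_morrey_dyPot_comm hb hst hN1 hNt hosc hα hα1 hp₀ hl₁ hq₁ hs
    hs' htp
  obtain ⟨C₂, hC₂, hcomm⟩ := H.exists_commutator_le hα1 hb
  obtain ⟨C₃, hC₃, hmax⟩ := H.exists_morrey_hlMax p₀ q₁ hp₀
  refine ⟨C₃ * (C₂ * C₁), ENNReal.mul_ne_top hC₃ (ENNReal.mul_ne_top hC₂ hC₁),
    fun p q l adm f N hf hN hfN => ?_⟩
  have hpq := adm.p_lt_q hα hp₀ hl₁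
  obtain ⟨h1, h2⟩ := hmor p q l adm _ N hf.enorm hfN
  have hCN : C₁ * N ≠ ∞ := ENNReal.mul_ne_top hC₁ hN
  have hm : Measurable fun x => dyPot d μ R₀ E 1 α (fun y => ‖b x - b y‖ₑ * ‖f y‖ₑ) x := by
    refine Measurable.tsum fun k => ((H.measurable_measure_ball_const _).pow_const _).mul ?_
    refine H.measurable_setLIntegral_ball (g := fun x y => ‖b x - b y‖ₑ * ‖f y‖ₑ) ?_ _
    exact (((hb.comp measurable_fst).sub (hb.comp measurable_snd)).enorm).mul
      (hf.comp measurable_snd).enorm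
  have hae : ∀ᵐ x ∂μ, Integrable (potentialIntegrand d μ α f x) μ ∧
      Integrable (potentialIntegrand d μ α (fun y => b y * f y) x) μ ∧
      ‖commutator b (potential d μ α) f x‖ₑ ≤
        C₂ * dyPot d μ R₀ E 1 α (fun y => ‖b x - b y‖ₑ * ‖f y‖ₑ) x := by
    filter_upwards [H.ae_lt_top_of_morreyBound hm adm.q_pos adm.l_nonneg h1 hCN,
      H.ae_lt_top_of_morreyBound (H.measurable_dyPot 1 α hf.enorm) adm.q_pos adm.l_nonneg h2 hCN]
      with x hx1 hx2
    exact hcomm f hf x hx2 hx1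
  refine ⟨hae.mono fun x hx => hx.1, hae.mono fun x hx => hx.2.1, ?_⟩
  have h3 := h1.of_ae_le_const_mul adm.q_pos.le hC₂ (hae.mono fun x hx => hx.2.2)
  have h4 := hmax q l (adm.le_p.trans hpq.le) adm.q_le adm.l_nonneg (by linarith [adm.l_le]) _ _
    (H.measurable_commutator α hb hf).enorm h3
  rw [← mul_assoc, ← mul_assoc] at h4
  rwa [← mul_assoc]

end HomSpace

/-- If the diameter vanishes, then the space has at most one point, and the potential operator
vanishes because its kernel involves the measure of empty balls only. -/
lemma potentialIntegrand_eq_zero {α : ℝ} (hα : α < 1) (hd0 : ∀ x y : X, d x y = 0) (f : X → ℝ)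
    (x : X) : potentialIntegrand d μ α f x = 0 := by
  funext y
  have h : qball d x (d x y) = ∅ := by
    ext z
    simp [mem_qball, hd0]
  rw [potentialIntegrand, h, measureReal_empty, Real.zero_rpow (by linarith), div_zero]
  rfl

lemma grandMorreyNormPow_eq_zero (hD : qdiam d ≤ 0) (p l θ : ℝ) (A : ℝ → ℝ) (g : X → ℝ≥0∞) :
    grandMorreyNormPow d μ p l θ A g = 0 := by
  rw [← nonpos_iff_eq_zero]
  refine iSup₂_le fun ε _ => ?_
  have : morreyNorm d μ (p - ε) (l - A ε) g = 0 := by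
    rw [← nonpos_iff_eq_zero]
    exact iSup_le fun x => iSup₂_le fun r hr => absurd (hr.1.trans hr.2) (not_lt.2 hD)
  rw [this, mul_zero]

end Operators

end GrandMorrey

/-! ### Boundedness on grand Morrey spaces -/

theorem mainTheorem2 {X : Type*} [TopologicalSpace X] [MeasurableSpace X]
    (d : X → X → ℝ) (μ : Measure X) (hX : GrandMorrey.IsHomogeneousType d μ)
    (hbdd : BddAbove (range fun z : X × X => d z.1 z.2))
    (p q α l θ₁ θ₂ B : ℝ) (hp : 1 < p) (hl0 : 0 < l) (hl1 : l < 1)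
    (hα0 : 0 < α) (hα : α < (1 - l) / p) (hpq : 1 / p - 1 / q = α / (1 - l))
    (hθ₁ : 0 < θ₁) (hθ₂ : θ₁ * (1 + α * q / (1 - l)) ≤ θ₂)
    (A₁ A₂ : ℝ → ℝ)
    (hA₁cont : ContinuousOn A₁ (Ioc 0 (p - 1))) (hA₁nonneg : ∀ x ∈ Ioc 0 (p - 1), 0 ≤ A₁ x)
    (hA₁mono : MonotoneOn A₁ (Ioc 0 (p - 1)))
    (hA₂cont : ContinuousOn A₂ (Ioc 0 (q - 1))) (hA₂nonneg : ∀ x ∈ Ioc 0 (q - 1), 0 ≤ A₂ x)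
    (hA₂mono : MonotoneOn A₂ (Ioc 0 (q - 1)))
    (hA₂C1 : ∃ δ : ℝ, 0 < δ ∧ ContDiffOn ℝ 1 A₂ (Ioc 0 δ))
    (hA₂lim : Tendsto A₂ (𝓝[>] 0) (𝓝 0))
    (hA₂deriv : Tendsto (deriv A₂) (𝓝[>] 0) (𝓝 B))
    (hB0 : 0 ≤ B) (hB : B < (1 - l) ^ 2 / (α * q ^ 2))
    (hA₁ : ∃ δ : ℝ, 0 < δ ∧ InjOn (GrandMorrey.phiBar p q α l A₂) (Ioc 0 δ) ∧
      ∀ η ∈ GrandMorrey.phiBar p q α l A₂ '' Ioc 0 δ,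
        A₁ η = A₂ (Function.invFunOn (GrandMorrey.phiBar p q α l A₂) (Ioc 0 δ) η))
    (b : X → ℝ) (hb : GrandMorrey.MemBMO d μ b) :
    ∃ C : ℝ≥0, ∀ f : X → ℝ, AEMeasurable f μ →
      GrandMorrey.grandMorreyNormPow d μ p l θ₁ A₁ (fun x => ‖f x‖ₑ) < ∞ →
      (∀ᵐ x ∂μ, Integrable (GrandMorrey.potentialIntegrand d μ α f x) μ) ∧
      (∀ᵐ x ∂μ, Integrable (GrandMorrey.potentialIntegrand d μ α (fun y => b y * f y) x) μ) ∧
      AEMeasurable (GrandMorrey.commutator b (GrandMorrey.potential d μ α) f) μ ∧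
      AEMeasurable (GrandMorrey.maximalFn d μ
        (GrandMorrey.commutator b (GrandMorrey.potential d μ α) f)) μ ∧
      GrandMorrey.grandMorreyNormPow d μ q l θ₂ A₂ (GrandMorrey.maximalFn d μ
        (GrandMorrey.commutator b (GrandMorrey.potential d μ α) f)) ≤
        C * GrandMorrey.grandMorreyNormPow d μ p l θ₁ A₁ (fun x => ‖f x‖ₑ) := by
  open GrandMorrey in
  -- The case of a one-point space.
  rcases le_or_gt (qdiam d) 0 with hD | hD
  · have hd0 : ∀ x y : X, d x y = 0 := fun x y =>
      le_antisymm ((le_qdiam hbdd x y).trans hD) (hX.nonneg x y)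
    have hsub : Subsingleton X := ⟨fun x y => (hX.eq_zero_iff x y).1 (hd0 x y)⟩
    have hα1 : α < 1 := hα.trans_le (by rw [div_le_one (by linarith)]; linarith)
    refine ⟨0, fun f _ _ => ⟨ae_of_all _ fun x => ?_, ae_of_all _ fun x => ?_,
      Subsingleton.measurable.aemeasurable, Subsingleton.measurable.aemeasurable, ?_⟩⟩
    · rw [potentialIntegrand_eq_zero hα1 hd0]; exact integrable_zero _ _ _
    · rw [potentialIntegrand_eq_zero hα1 hd0]; exact integrable_zero _ _ _
    · rw [grandMorreyNormPow_eq_zero hD]; exact zero_le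
  -- Geometry of the space.
  have hfin : IsFiniteMeasure μ := hX.isFiniteMeasure hbdd hD
  have hne : Nonempty X := by
    by_contra h
    rw [not_nonempty_iff] at h
    rw [qdiam, Real.iSup_of_isEmpty] at hD
    exact lt_irrefl _ hD
  have hpos : ∀ x r, 0 < r → 0 < μ (qball d x r) := fun x r hr => hX.ball_pos hD x hr
  obtain ⟨K, A, H₀, hbig⟩ := hX.exists_doublingSpace hbdd hD
  have hA := H₀.A_ne_top
  obtain ⟨c, hc, hann⟩ := hX.annulus_pos
  obtain ⟨E, τ, H⟩ := H₀.exists_homSpace (mul_pos hc hD) hann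
  have hcov := H₀.exists_finite_cover (ρ := qdiam d / 2) (by positivity)
  -- A measurable version of `b`, and its mean oscillations.
  obtain ⟨b', hb'm, hbb'⟩ := hb.1
  have hbint := hb.integrable hD hcov
  have hb'int : Integrable b' μ := hbint.congr hbb'
  obtain ⟨N₁, hN₁, hosc₁⟩ := hb.exists_osc hD hpos hcov hA hbig
  have hosc' : ∀ x r, 0 < r → ∃ c : ℝ,
      ∫⁻ y in qball d x r, ‖b' y - c‖ₑ ∂μ ≤ N₁ * μ (qball d x r) := by
    intro x r hr
    obtain ⟨c, hc⟩ := hosc₁ x r hr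
    refine ⟨c, le_trans (le_of_eq (lintegral_congr_ae (ae_restrict_of_ae ?_))) hc⟩
    filter_upwards [hbb'] with y hy
    rw [hy]
  -- Choice of the exponents.
  have hl : 0 < 1 - l := by linarith
  obtain ⟨σ, κ, hσ0, hσ1, hσq, hκ0, hκ1, hexp⟩ := exists_adamsExponents hp hl0 hl1 hα0 hα hpq
    hA₂nonneg hA₂C1 hA₂lim hA₂deriv hB hA₁
  have hq1 : 1 < q := by linarith
  have hα1 : α < 1 := hα.trans_le (by rw [div_le_one (by linarith)]; linarith)
  set p₀ := (1 + p) / 2 with hp₀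
  have hp₀1 : 1 < p₀ := by rw [hp₀]; linarith
  have hp₀s : 0 < p₀ / (p₀ - 1) := div_pos (by linarith) (by linarith)
  have hql : 0 < q / (1 - l) := by positivity
  -- The exponent `s` exceeds `q` and `q / (1 - l)`, and its conjugate exponent is less than `p₀`.
  set s := q + q / (1 - l) + p₀ / (p₀ - 1) with hs
  have hsq : q < s := by linarith
  have hs1 : 1 < s := by linarith
  have hst := Real.HolderConjugate.conjExponent hs1
  have hsl : 1 / s < (1 - l) / q := by
    rw [← one_div_div q (1 - l)]
    exact one_div_lt_one_div_of_lt hql (by linarith)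
  have htp : s.conjExponent < p₀ := by
    have h1 : p₀ / (p₀ - 1) < s := by linarith
    rw [div_lt_iff₀ (by linarith)] at h1
    rw [Real.conjExponent, div_lt_iff₀ (by linarith)]
    linarith
  obtain ⟨N₀, hN₀, hN₀1, hosc⟩ := H.exists_osc_rpow hb'm hb'int
    (fun c ρ hρ => H.ae_enorm_le_hlMax hX.exists_ball_subset hX.dense_compactlySupported
      (hb'int.sub (integrable_const c)) hρ) hN₁ hosc' (s := s) (by linarith)
  obtain ⟨C₁, hC₁, hcomm⟩ := H.exists_morrey_maximal_commutator hb'm hst hN₀1 hN₀ hosc hα0 hα1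
    hp₀1 hl1 hq1 hsq hsl htp
  obtain ⟨C₂, hC₂, hmor⟩ := exists_morreyBound_of_morreyNorm_le hD hpos hcov hA hbig
  have hθ₂0 : 0 < θ₂ := lt_of_lt_of_le (by positivity) hθ₂
  obtain ⟨C₃, hC₃, hgrand⟩ := exists_grandMorreyNormPow_le (d := d) (μ := μ) hpos hl1 hθ₂0
    hA₂nonneg hA₂mono hσ0 hσq
  set C₄ := ENNReal.ofReal (κ ^ (-θ₁)) with hC₄
  set C := C₃ * (C₁ * C₂ * C₄) with hC
  have hCt : C ≠ ∞ := ENNReal.mul_ne_top hC₃ (ENNReal.mul_ne_top (ENNReal.mul_ne_top hC₁ hC₂)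
    ENNReal.ofReal_ne_top)
  refine ⟨C.toNNReal, fun f hf hffin => ?_⟩
  obtain ⟨f', hf'm, hff'⟩ := hf
  have hcongr := commutator_congr_ae (d := d) (α := α) hbb' hff'
  have hbf : (fun y => b y * f y) =ᵐ[μ] fun y => b' y * f' y := hbb'.mul hff'
  -- The estimate for small `ε`.
  have hsmall : ∀ ε, 0 < ε → ε ≤ σ →
      (∀ᵐ x ∂μ, Integrable (potentialIntegrand d μ α f' x) μ) ∧
      (∀ᵐ x ∂μ, Integrable (potentialIntegrand d μ α (fun y => b' y * f' y) x) μ) ∧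
      ENNReal.ofReal (ε ^ θ₂) ^ (1 / (q - ε)) * morreyNorm d μ (q - ε) (l - A₂ ε)
        (maximalFn d μ (commutator b' (potential d μ α) f')) ≤
        C₁ * C₂ * C₄ * grandMorreyNormPow d μ p l θ₁ A₁ (fun x => ‖f x‖ₑ) := by
    intro ε hε hεσ
    obtain ⟨η, hη, hηS, hκε, hA₁η, adm⟩ := hexp ε hε hεσ
    set w := ENNReal.ofReal (η ^ θ₁) ^ (1 / (p - η)) with hw
    set N := morreyNorm d μ (p - η) (l - A₂ ε) (fun x => ‖f x‖ₑ) with hN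
    have hw0 : w ≠ 0 := (ENNReal.rpow_pos (ENNReal.ofReal_pos.2 (by positivity))
      ENNReal.ofReal_ne_top).ne'
    have hwN : w * N ≤ grandMorreyNormPow d μ p l θ₁ A₁ (fun x => ‖f x‖ₑ) := by
      rw [hw, hN, ← hA₁η]
      exact le_iSup₂_of_le (f := fun (ε : ℝ) (_ : 0 < ε ∧ ε < sMax p l A₁) =>
        ENNReal.ofReal (ε ^ θ₁) ^ (1 / (p - ε)) *
          morreyNorm d μ (p - ε) (l - A₁ ε) fun x => ‖f x‖ₑ) η ⟨hη, hηS⟩ le_rfl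
    have hNt : N ≠ ∞ := by
      intro h
      rw [h, ENNReal.mul_top hw0] at hwN
      exact absurd hffin (not_lt.2 hwN)
    have hp'1 := adm.one_lt_p hp₀1
    have hfN : MorreyBound d μ (fun x => ‖f' x‖ₑ) (p - η) (l - A₂ ε) (C₂ * N) :=
      (hmor _ _ hp'1.le adm.l_nonneg (by linarith [adm.l_le]) _ _ hN.ge).congr_ae
        (hff'.mono fun x hx => by simp only [hx])
    obtain ⟨i1, i2, hbound⟩ := hcomm _ _ _ adm f' _ hf'm (ENNReal.mul_ne_top hC₂ hNt) hfN
    refine ⟨i1, i2, ?_⟩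
    have h1 : morreyNorm d μ (q - ε) (l - A₂ ε)
        (maximalFn d μ (commutator b' (potential d μ α) f')) ≤ C₁ * (C₂ * N) := by
      refine morreyNorm_le_of_morreyBound hpos adm.q_pos adm.l_nonneg
        (hbound.mono adm.q_pos.le (fun x => ?_) le_rfl)
      rw [maximalFn_eq_hlMax]
      exact H.hlMax_le_hlMax _ _ x
    have h2 := weight_le hp'1 adm.q_pos adm.q_le hl1 adm.l_le hα0 adm.rel hθ₁ hθ₂ hε
      (hεσ.trans hσ1) hη hκ0 hκ1 hκε
    calc _ ≤ C₄ * w * (C₁ * (C₂ * N)) := mul_le_mul' h2 h1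
      _ = C₁ * C₂ * C₄ * (w * N) := by ring
      _ ≤ _ := mul_le_mul_right hwN _
  have hmeas := H.measurable_commutator α hb'm hf'm
  have hmaxm : Measurable (maximalFn d μ (commutator b' (potential d μ α) f')) := by
    rw [maximalFn_eq_hlMax]
    exact H.measurable_hlMax _ hmeas.enorm
  obtain ⟨i1, i2, -⟩ := hsmall σ hσ0 le_rfl
  refine ⟨i1.mono fun x hx => hx.congr (potentialIntegrand_congr_ae hff' x).symm,
    i2.mono fun x hx => hx.congr (potentialIntegrand_congr_ae hbf x).symm,
    hmeas.aemeasurable.congr hcongr.symm, ?_, ?_⟩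
  · rw [maximalFn_congr_ae hcongr]
    exact hmaxm.aemeasurable
  · rw [maximalFn_congr_ae hcongr, ENNReal.coe_toNNReal hCt, hC, mul_assoc C₃]
    exact hgrand _ _ hmaxm.aemeasurable fun ε h0 h1 => (hsmall ε h0 h1).2.2
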